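/- **Theorem.** Let $x_1,\dots,x_n$ be any finite sequence of side lengths with $0<x_i\le 1/4$ and $\sum_i x_i^2\le 11/32$. Then the online subroutine *packSmall* described below, which places each square when it arrives, without knowledge of later squares and without ever moving a square, does not fail on this sequence and produces a packing into the unit square $[0,1]^2$: the (axis-parallel) squares of side $x_1,\dots,x_n$ are all contained in $[0,1]^2$ and have pairwise disjoint interiors. **The subroutine packSmall.** *Classes.* A square of side $x$ is an $H_k$-square if $2^{-(k+1)}<x\le 2^{-k}$; small squares have $k\ge2$. Write $w_k=2^{-k}$. *Regions.* $M_1=[0,1]\times[0,\frac14]$ (filled from left to right), $M_2=[\frac12,1]\times[\frac14,\frac12]$, $M_3=[\frac18,\frac78]\times[\frac12,\frac34]$, $M_4=[0,\frac78]\times[\frac34,1]$ (these three filled from right to left); $B_1=[0,\frac12]\times[\frac14,\frac38]$, $B_2=[\frac14,\frac12]\times[\frac38,\frac12]$ (filled from left to right), $B_3=[\frac78,1]\times[\frac12,1]$, $B_4=[0,\frac18]\times[\frac12,\frac34]$ (filled from bottom to top); $A=[0,\frac14]\times[\frac38,\frac12]$. For $i\le3$, $E_i$ is the part of $M_i$ within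 distance $\frac18$ of the end at which its filling stops. The used section of a shelf is the initial part of it that has been allocated; each new square or slice is put directly behind it (squares lie at the bottom, respectively left, side of the shelf), and overflow means that it does not fit. *Main regions.* A section of width $w$ is allocated in $M_1$; if it overflows, $M_1$ is closed and $M_2$ is used; if $M_2$ overflows, it is closed. Then the one of $M_3,M_4$ with the shorter used section is taken ($M_3$ in case of a tie), except that $M_3$ is always taken if more than $\frac38$ of the length of $M_4$ is used; if $M_3$ overflows, it is closed and only $M_4$ is used from then on. If $M_4$ overflows, the subroutine fails. An $H_2$-square of side $x$ is packed into a section of width $x$ allocated in this way. *Initial shelves.* For $k\ge4$, the first $H_k$-square opens an initial shelf of length $\frac14$ and height $w_k$ in $A$, on top of those opened before; the initial $H_3$-shelf is the left half of $B_1$. $H_k$-squares ($k\ge3$) are packed into the initial shelf from left to right until one overflows; this square then opens the first vertical $H_k$-shelf, and the initial shelf is not used again. A vertical $H_k$-shelf is a slice of width $w_k$ and height $\frac14$ allocated in the main regions, filled from bottom to top. The buffer packing in $B_1$ starts at the end of the initial $H_3$-packing if the initial $H_3$-shelf is closed before any buffer packing in $B_1$, and at the middle of $B_1$ otherwise. *Vertical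 shelves.* Let $V$ be the current vertical $H_k$-shelf and let an $H_k$-square $Q$ of side $x$ arrive. If there is an open buffer subshelf for $V$, pack $Q$ into it; if $Q$ overflows it, close the subshelf and pack $Q$ into $V$. If there is none and $Q$, packed into $V$, would for the first time reach into the last section of length $w_k$ of $V$, carry out a buffer step for $Q$. In all other cases pack $Q$ into $V$, and if it overflows, open a new vertical $H_k$-shelf with $Q$. *Buffer step.* Let $b$ be the total length of the used sections in $B_1,\dots,B_4$ (including the initial $H_3$-packing), $e$ the number of end buffers $E_i$ closed so far, $v$ the total width of all vertical shelves opened in the main regions, $\beta=b+\frac{1.5}{16}e-\frac3{16}$ and $\alpha=\frac v2$. If $\beta\ge\alpha$ or $\beta+x\ge\alpha+\frac1{16}$, pack $Q$ into $V$. Otherwise use the active buffer region: the first $E_i$ that is in use as an end buffer, or, if there is none, the active $B_j$ (starting with $B_1$). If $k=3$, pack $Q$ directly behind the used section of that region; if $k\ge4$, cut a perpendicular slice of width $w_k$ behind the used section, make it the open buffer subshelf for $V$, and pack $Q$ into it. If $B_j$ overflows and $j<4$, $B_{j+1}$ becomes the active one and is used. If $B_4$ overflows and $k\ge4$, the slice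 is cut behind the used section of the first region among $B_1,\dots,B_4$, and then among the closed $E_1,E_2,E_3$, that has room for it. If no buffer region can take $Q$ or its slice, pack $Q$ into $V$. *End buffers.* When $M_i$ ($i\le3$) is closed, let $\ell$ be the length of the part of its used section inside $E_i$. If $\ell>\frac1{16}$, the end buffer $E_i$ is closed at once. Otherwise the unused part of $E_i$, of width $\frac18-\ell$ and height $\frac14$, is in use as an end buffer, filled from bottom to top. An $H_3$-square wider than $\frac18-\ell$ is packed into $V$ instead. $E_i$ is closed when the length of its packing reaches $\frac2{16}$ or when a second $H_3$-square has been too wide. -/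

import Mathlib

namespace OnlinePacking

/-! ### Squares and packings -/

/-- The closed axis-parallel square with lower left corner `c` and side length `s`. -/
def square (c : ℝ × ℝ) (s : ℝ) : Set (ℝ × ℝ) :=
  Set.Icc c.1 (c.1 + s) ×ˢ Set.Icc c.2 (c.2 + s)

/-- The container `[0,1] × [0,1]`. -/
def unitSquare : Set (ℝ × ℝ) := square (0, 0) 1

/-- Placing the square of side `xs[i]` with lower left corner `ps[i]`, for every `i`, is a packing
into the unit square: all squares lie in the container and no two of them overlap. -/
structure IsPacking (xs : List ℝ) (ps : List (ℝ × ℝ)) : Prop where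
  length_eq : ps.length = xs.length
  inside : ∀ q ∈ ps.zip xs, square q.1 q.2 ⊆ unitSquare
  disjoint : (ps.zip xs).Pairwise fun q r =>
    Disjoint (interior (square q.1 q.2)) (interior (square r.1 r.2))

/-- The height class of a side length `x ≤ 1`: the `k` with `2^(-(k+1)) < x ≤ 2^(-k)`. -/
noncomputable def heightClass (x : ℝ) : ℕ := Nat.log 2 ⌊x⁻¹⌋₊

/-- The shelf width `2^(-k)` that belongs to the height class `H_k`. -/
noncomputable def classWidth (k : ℕ) : ℝ := (1 / 2) ^ k

theorem heightClass_eq_iff {x : ℝ} (h0 : 0 < x) (h1 : x ≤ 1) (k : ℕ) :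
    heightClass x = k ↔ classWidth (k + 1) < x ∧ x ≤ classWidth k := by
  have hx : 1 ≤ x⁻¹ := (one_le_inv₀ h0).2 h1
  have hf : ⌊x⁻¹⌋₊ ≠ 0 := by
    have : 1 ≤ ⌊x⁻¹⌋₊ := Nat.le_floor (by simpa using hx)
    omega
  unfold heightClass classWidth
  rw [Nat.log_eq_iff (Or.inr ⟨by norm_num, hf⟩), Nat.le_floor_iff (by positivity),
    Nat.floor_lt (by positivity), and_comm]
  push_cast
  rw [one_div, inv_pow, inv_pow, le_inv_comm₀ (by positivity) h0,
    inv_lt_comm₀ h0 (by positivity)]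

/-! ### Shelves -/

/-- The direction in which a shelf is filled. -/
inductive Dir
  | right
  | left
  | up

/-- A rectangular shelf with lower left corner `(x, y)`.  It is filled in direction `dir`; its
extent along `dir` is `length`, its extent perpendicular to `dir` is `height`, and its used section
is the initial section of length `used`. -/
structure Shelf where
  x : ℝ
  y : ℝ
  length : ℝ
  height : ℝ
  used : ℝ
  dir : Dir

namespace Shelf

/-- An object of extent `w` (along the shelf) fits behind the used section. -/
def Fits (S : Shelf) (w : ℝ) : Prop := S.used + w ≤ S.length

noncomputable instance (S : Shelf) (w : ℝ) : Decidable (S.Fits w) := Classical.dec _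

/-- The lower left corner of a square of side `s` packed directly behind the used section. -/
noncomputable def place (S : Shelf) (s : ℝ) : ℝ × ℝ :=
  match S.dir with
  | .right => (S.x + S.used, S.y)
  | .left => (S.x + S.length - S.used - s, S.y)
  | .up => (S.x, S.y + S.used)

/-- Extend the used section by `w`. -/
noncomputable def advance (S : Shelf) (w : ℝ) : Shelf := { S with used := S.used + w }

/-- The perpendicular slice of width `w` directly behind the used section, as an empty shelf. -/
noncomputable def slice (S : Shelf) (w : ℝ) : Shelf :=
  match S.dir with
  | .right => ⟨S.x + S.used, S.y, S.height, w, 0, .up⟩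
  | .left => ⟨S.x + S.length - S.used - w, S.y, S.height, w, 0, .up⟩
  | .up => ⟨S.x, S.y + S.used, S.height, w, 0, .right⟩

end Shelf

/-! ### The state of the packing subroutine -/

/-- The status of an end `E_i` (the last `1/8` of `M_i`) as a buffer. -/
inductive EndBuffer
  /-- The main region `M_i` has not been closed yet. -/
  | reserved
  /-- `E_i` is in use as a buffer.  The shelf is the part of `E_i` left free by the main packing;
  the number counts the `H_3`-squares that were too wide for it. -/
  | active (S : Shelf) (misses : ℕ)
  /-- `E_i` has been closed as a buffer. -/
  | closed (S : Shelf)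

namespace EndBuffer

def isReserved : EndBuffer → Bool
  | reserved => true
  | _ => false

def isClosed : EndBuffer → Bool
  | closed _ => true
  | _ => false

/-- The end buffer obtained when the main shelf `S` is closed.  It consists of the part of the last
`1/8` of `S` behind the used section; if more than half of the end is used, it is closed at once. -/
noncomputable def ofMain (S : Shelf) : EndBuffer :=
  let t := max S.used (S.length - 1 / 8)
  let F : Shelf :=
    match S.dir with
    | .left => ⟨S.x, S.y, S.height, S.length - t, 0, .up⟩
    | _ => ⟨S.x + t, S.y, S.height, S.length - t, 0, .up⟩
  if 1 / 16 < t - (S.length - 1 / 8) then closed F else active F 0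

end EndBuffer

/-- The current vertical main shelf of a height class. -/
structure Vertical where
  /-- the shelf itself, a slice of some `M_i` -/
  shelf : Shelf
  /-- whether the buffer packing of this shelf has been initiated already -/
  started : Bool
  /-- the open buffer subshelf that belongs to this shelf, if there is one -/
  sub : Option Shelf

structure State where
  /-- the main regions `M_1, …, M_4` -/
  main : Fin 4 → Shelf
  /-- the ends `E_1, E_2, E_3`; `M_i` is closed iff `E_i` is not `reserved` any more -/
  ends : Fin 3 → EndBuffer
  /-- the buffer regions `B_1, …, B_4`, where `B_1` is without the initial `H_3`-shelf -/
  buf : Fin 4 → Shelf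
  /-- the active buffer region among `B_1, …, B_4` -/
  activeBuf : Fin 4
  /-- the initial shelf of each height class, once it has been opened -/
  initial : ℕ → Option Shelf
  /-- the total height of the initial shelves opened in the region `A` -/
  heightA : ℝ
  /-- the current vertical main shelf of each height class; `none` until the first one is opened,
  that is, as long as the initial shelf has not been closed -/
  vertical : ℕ → Option Vertical
  /-- the total width of all vertical shelves opened in the main regions -/
  vertWidth : ℝ

/-- The subdivision of the unit square.  Lower half: `M_1` at the bottom, `M_2` above it in the
right half; in the left half `B_1` (its left half is the initial `H_3`-shelf), and above `B_1` the
region `A = [0,1/4] × [3/8,1/2]` followed by `B_2`.  Upper half: `B_3` at the right boundary, `M_4`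
at the top, `M_3` below `M_4`, and `B_4` to the left of `M_3`. -/
noncomputable def State.init : State where
  main := ![⟨0, 0, 1, 1 / 4, 0, .right⟩, ⟨1 / 2, 1 / 4, 1 / 2, 1 / 4, 0, .left⟩,
    ⟨1 / 8, 1 / 2, 3 / 4, 1 / 4, 0, .left⟩, ⟨0, 3 / 4, 7 / 8, 1 / 4, 0, .left⟩]
  ends := fun _ => .reserved
  buf := ![⟨1 / 4, 1 / 4, 1 / 4, 1 / 8, 0, .right⟩, ⟨1 / 4, 3 / 8, 1 / 4, 1 / 8, 0, .right⟩,
    ⟨7 / 8, 1 / 2, 1 / 2, 1 / 8, 0, .up⟩, ⟨0, 1 / 2, 1 / 4, 1 / 8, 0, .up⟩]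
  activeBuf := 0
  initial := fun k => if k = 3 then some ⟨0, 1 / 4, 1 / 4, 1 / 8, 0, .right⟩ else none
  heightA := 0
  vertical := fun _ => none
  vertWidth := 0

namespace State

/-! ### Space in the main packing area -/

/-- Close `M_i` (`i = 1, 2, 3`). -/
noncomputable def closeMain (σ : State) (i : Fin 3) : State :=
  { σ with ends := Function.update σ.ends i (.ofMain (σ.main i.castSucc)) }

/-- Try to use `M_4`. -/
noncomputable def tryFourth (σ : State) (w : ℝ) : Option (State × Fin 4) :=
  if (σ.main 3).Fits w then some (σ, 3) else none

/-- `M_3` and `M_4` are used alternately, whichever has the shorter used section; once more than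
`3/8` of `M_4` is used, `M_3` is preferred until it is closed. -/
noncomputable def tryUpper (σ : State) (w : ℝ) : Option (State × Fin 4) :=
  if (σ.ends 2).isReserved ∧
      (3 / 8 < (σ.main 3).used ∨ (σ.main 2).used ≤ (σ.main 3).used) then
    if (σ.main 2).Fits w then some (σ, 2) else (σ.closeMain 2).tryFourth w
  else σ.tryFourth w

noncomputable def trySecond (σ : State) (w : ℝ) : Option (State × Fin 4) :=
  if (σ.ends 1).isReserved then
    if (σ.main 1).Fits w then some (σ, 1) else (σ.closeMain 1).tryUpper w
  else σ.tryUpper w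

/-- Find the main region for an object of width `w`, closing the regions that overflow.  The result
is `none` if there is no room left. -/
noncomputable def findMain (σ : State) (w : ℝ) : Option (State × Fin 4) :=
  if (σ.ends 0).isReserved then
    if (σ.main 0).Fits w then some (σ, 0) else (σ.closeMain 0).trySecond w
  else σ.trySecond w

/-- Allocate the next section of width `w` in the main packing area.  The returned shelf is the main
region as it was before the allocation. -/
noncomputable def takeMain (σ : State) (w : ℝ) : Option (State × Shelf) :=
  (σ.findMain w).map fun r =>
    ({ r.1 with main := Function.update r.1.main r.2 ((r.1.main r.2).advance w) }, r.1.main r.2)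

/-- Open a new vertical `H_k`-shelf in the main packing area with a square of side `x`. -/
noncomputable def openVertical (σ : State) (k : ℕ) (x : ℝ) : Option (State × (ℝ × ℝ)) :=
  (σ.takeMain (classWidth k)).map fun r =>
    let V := r.2.slice (classWidth k)
    ({ r.1 with
        vertical := Function.update r.1.vertical k (some ⟨V.advance x, false, none⟩)
        vertWidth := r.1.vertWidth + classWidth k }, V.place x)

/-! ### Space in the buffer regions -/

/-- The total width `b` of the used sections in `B` (including the initial `H_3`-shelf). -/
noncomputable def bufLength (σ : State) : ℝ :=
  (σ.initial 3).elim 0 Shelf.used + ∑ j, (σ.buf j).used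

/-- The number `e` of end buffers that have been closed. -/
def closedEnds (σ : State) : ℕ := (Finset.univ.filter fun i => (σ.ends i).isClosed).card

/-- `β = b + (1.5/16) e - 3/16`. -/
noncomputable def beta (σ : State) : ℝ :=
  σ.bufLength + 3 / 32 * (σ.closedEnds : ℝ) - 3 / 16

/-- `α = v / 2`, where `v` is the total width of the vertical shelves in the main regions. -/
noncomputable def alpha (σ : State) : ℝ := σ.vertWidth / 2

/-- The extent that a buffer packing of `H_k` needs along a buffer shelf: an `H_3`-square is packed
directly, smaller squares get a perpendicular subshelf of width `2^(-k)`. -/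
noncomputable def bufExtent (k : ℕ) (x : ℝ) : ℝ := if k = 3 then x else classWidth k

/-- Allocate buffer space in the active end buffer `E_i`.  There is no allocation if the square is
an `H_3`-square that is too wide. `E_i` is closed as soon as the length of its packing reaches
`1/8` or two squares were too wide. -/
noncomputable def takeEnd (σ : State) (i : Fin 3) (S : Shelf) (misses : ℕ) (k : ℕ) (x : ℝ) :
    State × Option Shelf :=
  if k = 3 ∧ S.height < x then
    let E : EndBuffer := if 2 ≤ misses + 1 then .closed S else .active S (misses + 1)
    ({ σ with ends := Function.update σ.ends i E }, none)
  else
    let S' := S.advance (bufExtent k x)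
    let E : EndBuffer := if 1 / 8 ≤ S'.used then .closed S' else .active S' misses
    ({ σ with ends := Function.update σ.ends i E }, some S)

/-- Allocate `w` at the end of `B_j`. -/
noncomputable def takeBuf (σ : State) (j : Fin 4) (w : ℝ) : State × Option Shelf :=
  ({ σ with buf := Function.update σ.buf j ((σ.buf j).advance w) }, some (σ.buf j))

/-- The end buffer can host a subshelf of width `w` behind its used section. -/
noncomputable def endHasRoom (w : ℝ) : EndBuffer → Bool
  | .closed S => decide (w ≤ S.height ∧ S.used + w ≤ S.length)
  | _ => false

/-- Search for a subshelf of width `w` at the end of any buffer region of `B`, then of `E`. -/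
noncomputable def takeAnyEnd (σ : State) (w : ℝ) : State × Option Shelf :=
  match (List.finRange 4).find? fun j => decide ((σ.buf j).Fits w) with
  | some j => σ.takeBuf j w
  | none =>
    match (List.finRange 3).find? fun i => endHasRoom w (σ.ends i) with
    | none => (σ, none)
    | some i =>
      match σ.ends i with
      | .closed S =>
        ({ σ with ends := Function.update σ.ends i (.closed (S.advance w)) }, some S)
      | _ => (σ, none)

/-- Allocate buffer space in `B`: in the active region or, if that overflows, in the next one.  If
`B_4` overflows, squares of class at least `4` may use the end of any buffer region. -/
noncomputable def takeB (σ : State) (k : ℕ) (x : ℝ) : State × Option Shelf :=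
  let w := bufExtent k x
  if (σ.buf σ.activeBuf).Fits w then σ.takeBuf σ.activeBuf w
  else
    let j : Fin 4 := ![1, 2, 3, 3] σ.activeBuf
    let τ : State := { σ with activeBuf := j }
    if (τ.buf j).Fits w then τ.takeBuf j w
    else if k = 3 then (τ, none) else τ.takeAnyEnd w

/-- Allocate buffer space for an `H_k`-square of side `x`: in the first active end buffer if there
is one, and in `B` otherwise. The returned shelf is the buffer region as it was before the
allocation; `none` means that the buffer regions cannot take the square. -/
noncomputable def takeBuffer (σ : State) (k : ℕ) (x : ℝ) : State × Option Shelf :=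
  match σ.ends 0, σ.ends 1, σ.ends 2 with
  | .active S m, _, _ => σ.takeEnd 0 S m k x
  | _, .active S m, _ => σ.takeEnd 1 S m k x
  | _, _, .active S m => σ.takeEnd 2 S m k x
  | _, _, _ => σ.takeB k x

/-! ### Packing a square -/

/-- Pack an `H_k`-square (`k ≥ 3`) whose initial shelf is still in use.  Initial shelves have length
`1/4`; those of class at least `4` are stacked in `A`.  On overflow, the first vertical `H_k`-shelf
is opened; in the case `k = 3`, an unused `B_1` then continues at the end of the initial packing. -/
noncomputable def packInitial (σ : State) (k : ℕ) (x : ℝ) : Option (State × (ℝ × ℝ)) :=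
  let I : Shelf := (σ.initial k).getD ⟨0, 3 / 8 + σ.heightA, 1 / 4, classWidth k, 0, .right⟩
  if I.Fits x then
    some ({ σ with
      initial := Function.update σ.initial k (some (I.advance x))
      heightA := if (σ.initial k).isNone then σ.heightA + classWidth k else σ.heightA }, I.place x)
  else if k = 3 ∧ (σ.buf 0).used = 0 then
    let B₁ : Shelf := ⟨I.used, 1 / 4, 1 / 2 - I.used, 1 / 8, 0, .right⟩
    { σ with buf := Function.update σ.buf 0 B₁ }.openVertical k x
  else σ.openVertical k x

/-- Pack an `H_k`-square into the vertical shelf `V`, or into a new one if it does not fit. -/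
noncomputable def packInto (σ : State) (k : ℕ) (x : ℝ) (V : Vertical) :
    Option (State × (ℝ × ℝ)) :=
  if V.shelf.Fits x then
    some ({ σ with vertical :=
      Function.update σ.vertical k (some { V with shelf := V.shelf.advance x }) }, V.shelf.place x)
  else σ.openVertical k x

/-- The buffer packing initiated by an `H_k`-square of side `x` for the vertical shelf `V`. -/
noncomputable def packBuffer (σ : State) (k : ℕ) (x : ℝ) (V : Vertical) :
    Option (State × (ℝ × ℝ)) :=
  if σ.alpha ≤ σ.beta ∨ σ.alpha + 1 / 16 ≤ σ.beta + x then
    σ.packInto k x { V with started := true }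
  else
    match σ.takeBuffer k x with
    | (τ, none) => τ.packInto k x { V with started := true }
    | (τ, some S) =>
      if k = 3 then
        some ({ τ with vertical :=
          Function.update τ.vertical k (some { V with started := true }) }, S.place x)
      else
        let T := S.slice (classWidth k)
        let V' : Vertical := { V with started := true, sub := some (T.advance x) }
        some ({ τ with vertical := Function.update τ.vertical k (some V') }, T.place x)

/-- Pack an `H_k`-square (`k ≥ 3`) once the class has a vertical shelf `V`: into the open buffer
subshelf if there is one and the square fits; otherwise into `V`, except that the first square
reaching into the last section of length `2^(-k)` of `V` initiates a buffer packing. -/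
noncomputable def packVertical (σ : State) (k : ℕ) (x : ℝ) (V : Vertical) :
    Option (State × (ℝ × ℝ)) :=
  match V.sub with
  | some T =>
    if T.Fits x then
      some ({ σ with vertical :=
        Function.update σ.vertical k (some { V with sub := some (T.advance x) }) }, T.place x)
    else σ.packInto k x { V with sub := none }
  | none =>
    if V.started = false ∧ V.shelf.length - classWidth k < V.shelf.used + x then
      σ.packBuffer k x V
    else σ.packInto k x V

/-- Pack the next square of side `x`: the new state and the lower left corner of the square, or
`none` if the subroutine fails. -/
noncomputable def step (σ : State) (x : ℝ) : Option (State × (ℝ × ℝ)) :=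
  let k := heightClass x
  if k < 2 then none
  else if k = 2 then (σ.takeMain x).map fun r => (r.1, r.2.place x)
  else
    match σ.vertical k with
    | none => σ.packInitial k x
    | some V => σ.packVertical k x V

/-- Pack a sequence of squares one after the other. -/
noncomputable def run : State → List ℝ → Option (List (ℝ × ℝ))
  | _, [] => some []
  | σ, x :: xs =>
    match σ.step x with
    | none => none
    | some (τ, p) => (run τ xs).map fun ps => p :: ps

end State

/-- The packSmall subroutine: the lower left corners of the squares with side lengths `xs`, where
each square is placed on its arrival and without knowledge of the later ones; `none` if the
subroutine fails on one of the squares. -/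
noncomputable def packSmall (xs : List ℝ) : Option (List (ℝ × ℝ)) := State.init.run xs

end OnlinePacking

/-! The proof is an amortized density argument. Lengths are counted in units of 1/16 and areas in
units of 1/256, so the area bound reads 88. A main region has height 4, and each unit of its length
should be paid for by area 2. If the last 2 units of M_1, M_2, M_3 are not counted, the main regions
ask for 2·(14+6+10+14) = 88. An overflow of M_4 would therefore force a total area above 88,
provided that all losses are compensated.

An H_2-square of side X pays for its own section and for what is lost beyond the end when it closes
a region, since X² ≥ 2X + 2(X-2). A vertical shelf of width w is paid for by its predecessor (the
first one by the initial shelf): the content of the full predecessor together with the overflowing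
square yields 2w up to a loss of at most w²/4. These losses are to be made good by the squares in
the buffers, which lie outside the counted area. `VerticalLedger` keeps the balance `q` of losses
and credits, and also a charge `s` for each shelf whose buffer step has been decided, at rate 1/2
per unit width for H_3 and H_4 and 1/3 for smaller classes. In the regions B_j a packing of extent l
gains at least l minus its charge. As each change of region costs at most 1, the regions B_j
together supply (4-1)+(4-1)+(8-1)+(4-1) = 16. A closed end supplies at least 3/2, and the part of it
taken by the main packing is paid for as well (`EndLedger.closed_supply`).

What is needed is that the balance, the excess of the initial H_3-packing over 3 and the credits of
the closed ends are together nonnegative (`Balance.surplus`). The test β ≥ α ensures this when a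
buffer packing is skipped (`Balance.skip`). When the buffers are full (`Balance.noRoom`), the supply
16 suffices while M_1 or M_2 is open; without vertical H_3-shelves, half of the charges is enough.
In the remaining case the claim is postponed until M_4 overflows. There `Balance.overflow` uses that
the current shelf of each class need not be charged (`Classes.le_area_of_opened`), that H_3-shelves
come in whole units of 2, and that M_4 was used only sparingly while M_3 was open
(`MainLedger.last`).

`Accounts.step` shows that these ledgers are preserved and that no step fails. Independently,
`Layout.step` shows that the free parts of all shelves stay disjoint from each other and from the
packed squares. `exists_run` combines the two by induction on the sequence. -/

namespace OnlinePacking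

/-! ### The ledger of a height class

Lengths are measured in units of `1/16` and areas in units of `1/256`. -/

/-- The shelf width of the class `H_k` in units of `1/16`. -/
noncomputable def unitWidth (k : ℕ) : ℝ := 16 * classWidth k

/-- The side `x` belongs to the class `H_k`. -/
def IsClass (k : ℕ) (x : ℝ) : Prop := unitWidth k / 2 < 16 * x ∧ 16 * x ≤ unitWidth k

theorem unitWidth_pos (k : ℕ) : 0 < unitWidth k := by
  unfold unitWidth classWidth; positivity

theorem unitWidth_succ (k : ℕ) : unitWidth (k + 1) = unitWidth k / 2 := by
  unfold unitWidth classWidth; rw [pow_succ]; ring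

theorem unitWidth_two : unitWidth 2 = 4 := by norm_num [unitWidth, classWidth]

theorem unitWidth_three : unitWidth 3 = 2 := by norm_num [unitWidth, classWidth]

theorem unitWidth_four : unitWidth 4 = 1 := by norm_num [unitWidth, classWidth]

theorem unitWidth_anti {i j : ℕ} (h : i ≤ j) : unitWidth j ≤ unitWidth i := by
  unfold unitWidth classWidth
  have := pow_le_pow_of_le_one (by norm_num : (0 : ℝ) ≤ 1 / 2) (by norm_num) h
  linarith

theorem unitWidth_le_two {k : ℕ} (hk : 3 ≤ k) : unitWidth k ≤ 2 :=
  unitWidth_three ▸ unitWidth_anti hk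

theorem unitWidth_le_one {k : ℕ} (hk : 4 ≤ k) : unitWidth k ≤ 1 :=
  unitWidth_four ▸ unitWidth_anti hk

theorem unitWidth_le_half {k : ℕ} (hk : 5 ≤ k) : unitWidth k ≤ 1 / 2 := by
  have h5 : unitWidth 5 = 1 / 2 := by norm_num [unitWidth, classWidth]
  exact h5 ▸ unitWidth_anti hk

theorem IsClass.pos {k : ℕ} {x : ℝ} (h : IsClass k x) : 0 < 16 * x := by
  have := unitWidth_pos k
  linarith [h.1]

/-- The part of the buffer demand that is charged for a unit of vertical shelf width. -/
noncomputable def rate (k : ℕ) : ℝ := if k ≤ 4 then 1 / 2 else 1 / 3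

theorem rate_three : rate 3 = 1 / 2 := by norm_num [rate]

theorem rate_four : rate 4 = 1 / 2 := by norm_num [rate]

theorem rate_of_five_le {k : ℕ} (h : 5 ≤ k) : rate k = 1 / 3 := by
  unfold rate; rw [if_neg (by omega)]

theorem rate_le (k : ℕ) : rate k ≤ 1 / 2 := by unfold rate; split_ifs <;> norm_num

theorem third_le_rate (k : ℕ) : 1 / 3 ≤ rate k := by unfold rate; split_ifs <;> norm_num

/-- The content `C` of a buffer subshelf of length `len` with used section `t` can guarantee the
credit `cr` when the subshelf is closed. -/
def SubLedger (k : ℕ) (len t C cr : ℝ) : Prop :=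
  len ≤ 2 ∧ unitWidth k ^ 2 / 4 ≤ C ∧ unitWidth k / 2 * t ≤ C ∧
    (cr ≤ max 0 (len * unitWidth k / 2 - 9 * unitWidth k ^ 2 / 16) ∨
      (k = 4 ∧ len = 2 ∧ cr = 1 / 2 ∧
        (t ^ 2 ≤ C ∨ (1 / 2 ≤ C ∧ t ^ 2 ≤ 2 * C) ∨ 3 / 4 ≤ C)))

theorem SubLedger.start {k : ℕ} {len x cr : ℝ} (hx : IsClass k x) (hl : len ≤ 2)
    (h : cr ≤ max 0 (len * unitWidth k / 2 - 9 * unitWidth k ^ 2 / 16) ∨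
      (k = 4 ∧ len = 2 ∧ cr = 1 / 2)) :
    SubLedger k len (16 * x) ((16 * x) ^ 2) cr := by
  have hw := unitWidth_pos k
  obtain ⟨h1, h2⟩ := hx
  refine ⟨hl, by nlinarith, by nlinarith, h.imp id fun h => ⟨h.1, h.2.1, h.2.2, .inl le_rfl⟩⟩

/-- The three alternatives for k = 4 correspond to one square (t² ≤ C), two squares (t² ≤ 2C by
Cauchy-Schwarz, each of area above 1/4) and at least three squares. -/
theorem SubLedger.add {k : ℕ} {len t C cr x : ℝ} (hx : IsClass k x)
    (h : SubLedger k len t C cr) :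
    SubLedger k len (t + 16 * x) (C + (16 * x) ^ 2) cr := by
  have hw := unitWidth_pos k
  obtain ⟨h1, h2⟩ := hx
  obtain ⟨hl2, hC, hC', h⟩ := h
  refine ⟨hl2, by nlinarith, by nlinarith, h.imp id ?_⟩
  rintro ⟨rfl, hl, hc, h⟩
  rw [unitWidth_four] at *
  refine ⟨rfl, hl, hc, .inr ?_⟩
  rcases h with h | ⟨h, h'⟩ | h
  · exact .inl ⟨by nlinarith, by nlinarith [sq_nonneg (t - 16 * x)]⟩
  · exact .inr (by nlinarith)
  · exact .inr (by nlinarith)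

/-- Put w = `unitWidth k` and X = 16x. From C ≥ (w/2)t and t > len - X one gets C - X(w-X) > len·w/2
- 3wX/2 + X², whose minimum, at X = 3w/4, produces the term 9w²/16. A single square already has C ≥
w²/4 ≥ X(w-X), so the credit 0 is always safe. For H_4 in a subshelf of length 2 this gives only
7/16; counting squares improves it to the 1/2 that matches the charge. -/
theorem SubLedger.close {k : ℕ} {len t C cr x : ℝ} (hx : IsClass k x)
    (h : SubLedger k len t C cr) (ht : len < t + 16 * x) :
    cr ≤ C - 16 * x * (unitWidth k - 16 * x) := by
  have hw := unitWidth_pos k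
  obtain ⟨h1, h2⟩ := hx
  obtain ⟨-, hC, hC', h⟩ := h
  generalize 16 * x = y at *
  rcases h with h | ⟨rfl, hl, hc, h⟩
  · rcases le_max_iff.1 h with h | h
    · nlinarith [sq_nonneg (unitWidth k - 2 * y)]
    · nlinarith [sq_nonneg (3 * unitWidth k - 4 * y)]
  · rw [unitWidth_four] at *
    subst hl hc
    rcases h with h | ⟨h, h'⟩ | h
    · nlinarith [sq_nonneg (1 - y)]
    · nlinarith [sq_nonneg (1 - y)]
    · nlinarith [sq_nonneg (1 - 2 * y)]

/-- The ledger of a class whose current vertical shelf is `V`: `a` is the area of its squares, `v`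
the width of its vertical shelves, `q` the balance of losses and buffer credits, `s` the charged
width of those vertical shelves for which the buffer packing has been decided. -/
def VerticalLedger (k : ℕ) (a v q s z : ℝ) (V : Vertical) : Prop :=
  V.shelf.length = 1 / 4 ∧ V.shelf.height = classWidth k ∧
  unitWidth k / 2 < 16 * V.shelf.used ∧ 16 * V.shelf.used ≤ 4 ∧ unitWidth k ≤ v ∧
  match V.started, V.sub with
  | false, none => 16 * V.shelf.used ≤ 4 - unitWidth k ∧ s = rate k * (v - unitWidth k) ∧
      2 * v - unitWidth k ^ 2 / 4 + unitWidth k / 2 * (16 * V.shelf.used) + z + q ≤ a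
  | true, none => 4 - 2 * unitWidth k < 16 * V.shelf.used ∧ s = rate k * v ∧
      2 * v + unitWidth k / 2 * (16 * V.shelf.used) + z + q ≤ a
  | true, some T => 4 ≤ k ∧ T.height = classWidth k ∧
      4 - 2 * unitWidth k < 16 * V.shelf.used ∧ s = rate k * v ∧
      ∃ C cr, SubLedger k (16 * T.length) (16 * T.used) C cr ∧
        2 * v - unitWidth k ^ 2 / 4 + unitWidth k / 2 * (16 * V.shelf.used) + z + q - cr + C ≤ a
  | false, some _ => False

/-- The ledger of a class, depending on its initial shelf and its current vertical shelf. -/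
def ClassLedger (k : ℕ) (a v q s z : ℝ) (I : Option Shelf) : Option Vertical → Prop
  | none => v = 0 ∧ q = 0 ∧ s = 0 ∧ 0 ≤ a ∧ ∀ S, I = some S → S.length = 1 / 4 ∧
      S.height = classWidth k ∧ 0 ≤ S.used ∧ S.used ≤ 1 / 4 ∧
      unitWidth k / 2 * (16 * S.used) ≤ a
  | some V => VerticalLedger k a v q s z V

/-! ### Transitions of the ledger of vertical shelves -/

section
variable {k : ℕ} {a v q s z x : ℝ} {V : Vertical}

/-- The initial shelf pays for the first vertical shelf: its content is at least (w/2)(4-X), and (X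
- w/2)² ≥ 0 bounds the loss by w²/4. For H_3 the content is at least the length itself while only 4
- 1 = 3 is needed, so the excess over 3 is left as `z`. -/
theorem VerticalLedger.open_first {I : ℝ} {S : Shelf} (hk : 3 ≤ k) (hx : IsClass k x)
    (ha : unitWidth k / 2 * (16 * I) ≤ a) (hI : 1 / 4 < I + x) (hI' : I ≤ 1 / 4)
    (hz : z = if k = 3 then max 0 (16 * I - 3) else 0)
    (hl : S.length = 1 / 4) (hh : S.height = classWidth k) (hu : S.used = x) :
    VerticalLedger k (a + (16 * x) ^ 2) (unitWidth k) 0 0 z ⟨S, false, none⟩ := by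
  have hw := unitWidth_pos k
  have hw2 := unitWidth_le_two hk
  obtain ⟨h1, h2⟩ := hx
  refine ⟨hl, hh, by simpa [hu], by rw [hu]; linarith, le_rfl, by simp only [hu]; linarith,
    by ring, ?_⟩
  simp only [hu]
  subst hz
  split_ifs with h
  · subst h
    rw [unitWidth_three] at *
    rcases max_cases 0 (16 * I - 3) with ⟨h, _⟩ | ⟨h, _⟩ <;> rw [h] <;>
      nlinarith [sq_nonneg (16 * x - 1)]
  · nlinarith [sq_nonneg (16 * x - unitWidth k / 2)]

theorem VerticalLedger.pack (hx : IsClass k x) (h : VerticalLedger k a v q s z V)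
    (hs : V.sub = none) (hf : V.shelf.used + x ≤ 1 / 4)
    (hb : ¬ (V.started = false ∧ V.shelf.length - classWidth k < V.shelf.used + x)) :
    VerticalLedger k (a + (16 * x) ^ 2) v q s z { V with shelf := V.shelf.advance x } := by
  have hw := unitWidth_pos k
  obtain ⟨S, st, sub⟩ := V
  subst hs
  obtain ⟨h1, h2⟩ := hx
  have hxp : 0 < 16 * x := by linarith
  have hwd : unitWidth k = 16 * classWidth k := rfl
  cases st <;> simp only [VerticalLedger, Shelf.advance] at h hf hb ⊢ <;>
    obtain ⟨e1, e2, e3, e4, e5, e6, e7, e8⟩ := h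
  · simp only [true_and, not_lt] at hb
    exact ⟨e1, e2, by linarith, by linarith, e5, by linarith, e7, by nlinarith⟩
  · exact ⟨e1, e2, by linarith, by linarith, e5, by linarith, e7, by nlinarith⟩

/-- The full shelf now plays the role of the initial shelf. It must have been started, as an
unstarted shelf still has its last section of length w free. -/
theorem VerticalLedger.reopen {S : Shelf} (hk : 3 ≤ k) (hx : IsClass k x)
    (h : VerticalLedger k a v q s z V) (hs : V.sub = none) (hf : 1 / 4 < V.shelf.used + x)
    (hl : S.length = 1 / 4) (hh : S.height = classWidth k) (hu : S.used = x) :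
    VerticalLedger k (a + (16 * x) ^ 2) (v + unitWidth k) q s z ⟨S, false, none⟩ := by
  have hw := unitWidth_pos k
  have hw2 := unitWidth_le_two hk
  obtain ⟨V, st, sub⟩ := V
  subst hs
  obtain ⟨h1, h2⟩ := hx
  have hwd : unitWidth k = 16 * classWidth k := rfl
  cases st <;> simp only [VerticalLedger] at h hf ⊢ <;>
    obtain ⟨e1, e2, e3, e4, e5, e6, e7, e8⟩ := h
  · linarith
  · rw [hu]
    exact ⟨hl, hh, by linarith, by linarith, by linarith, by linarith, by rw [e7]; ring,
      by nlinarith [sq_nonneg (16 * x - unitWidth k / 2)]⟩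

theorem VerticalLedger.fits (hx : IsClass k x) (h : VerticalLedger k a v q s z V)
    (hst : V.started = false) : V.sub = none ∧ V.shelf.used + x ≤ 1 / 4 := by
  obtain ⟨V, st, sub⟩ := V
  subst hst
  obtain ⟨h1, h2⟩ := hx
  cases sub <;> simp only [VerticalLedger] at h ⊢
  · exact ⟨trivial, by linarith [h.2.2.2.2.2.1]⟩
  · exact absurd h.2.2.2.2.2 id

/-- The loss w²/4 is moved from the ledger inequality into the balance `q`. The square counts in V
only with (w/2)X, so its excess area is credited. -/
theorem VerticalLedger.start_unbuffered (hk : 3 ≤ k) (hx : IsClass k x)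
    (h : VerticalLedger k a v q s z V) (hst : V.started = false)
    (hb : V.shelf.length - classWidth k < V.shelf.used + x) :
    VerticalLedger k (a + (16 * x) ^ 2) v
      (q - unitWidth k ^ 2 / 4 + ((16 * x) ^ 2 - unitWidth k / 2 * (16 * x)))
      (s + rate k * unitWidth k) z { V with started := true, shelf := V.shelf.advance x } := by
  have hw := unitWidth_pos k
  have hw2 := unitWidth_le_two hk
  obtain ⟨V, st, sub⟩ := V
  subst hst
  obtain ⟨h1, h2⟩ := hx
  have hwd : unitWidth k = 16 * classWidth k := rfl
  cases sub <;> simp only [VerticalLedger, Shelf.advance] at h hb ⊢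
  · obtain ⟨e1, e2, e3, e4, e5, e6, e7, e8⟩ := h
    exact ⟨e1, e2, by linarith, by linarith, e5, by linarith, by rw [e7]; ring, by nlinarith⟩
  · exact absurd h.2.2.2.2.2 id

/-- For H_3 the loss w²/4 equals 1. The square does not use up length of V, hence its whole area is
credited. -/
theorem VerticalLedger.start_direct (h : VerticalLedger 3 a v q s z V)
    (hst : V.started = false) :
    VerticalLedger 3 (a + (16 * x) ^ 2) v (q - 1 + (16 * x) ^ 2)
      (s + rate 3 * unitWidth 3) z { V with started := true } := by
  obtain ⟨V, st, sub⟩ := V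
  subst hst
  cases sub <;> simp only [VerticalLedger] at h ⊢
  · obtain ⟨e1, e2, e3, e4, e5, e6, e7, e8⟩ := h
    rw [unitWidth_three] at *
    exact ⟨e1, e2, by linarith, by linarith, e5, by linarith, by rw [e7]; ring, by nlinarith⟩
  · exact absurd h.2.2.2.2.2 id

/-- The credit is granted in advance; the term `- cr + C` remembers the debt until the subshelf is
closed and `SubLedger.close` redeems it. -/
theorem VerticalLedger.start_sub {T : Shelf} {cr : ℝ} (hk : 4 ≤ k) (hx : IsClass k x)
    (h : VerticalLedger k a v q s z V) (hst : V.started = false)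
    (hb : V.shelf.length - classWidth k < V.shelf.used + x)
    (hh : T.height = classWidth k) (hu : T.used = x) (hT : 16 * T.length ≤ 2)
    (hc : cr ≤ max 0 (16 * T.length * unitWidth k / 2 - 9 * unitWidth k ^ 2 / 16) ∨
      (k = 4 ∧ 16 * T.length = 2 ∧ cr = 1 / 2)) :
    VerticalLedger k (a + (16 * x) ^ 2) v (q + cr)
      (s + rate k * unitWidth k) z { V with started := true, sub := some T } := by
  obtain ⟨V, st, sub⟩ := V
  subst hst
  have hwd : unitWidth k = 16 * classWidth k := rfl
  cases sub <;> simp only [VerticalLedger] at h hb ⊢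
  · obtain ⟨e1, e2, e3, e4, e5, e6, e7, e8⟩ := h
    refine ⟨e1, e2, e3, e4, e5, hk, hh, ?_, by rw [e7]; ring, (16 * x) ^ 2, cr, ?_, by linarith⟩
    · linarith [hx.2]
    · rw [hu]; exact .start hx hT hc
  · exact absurd h.2.2.2.2.2 id

theorem VerticalLedger.pack_sub {T : Shelf} (hx : IsClass k x)
    (h : VerticalLedger k a v q s z V) (hs : V.sub = some T) :
    VerticalLedger k (a + (16 * x) ^ 2) v q s z { V with sub := some (T.advance x) } := by
  obtain ⟨V, st, sub⟩ := V
  subst hs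
  cases st <;> simp only [VerticalLedger, Shelf.advance] at h ⊢
  · exact absurd h.2.2.2.2.2 id
  · obtain ⟨e1, e2, e3, e4, e5, e6, e7, e8, e9, C, cr, hC, ha⟩ := h
    refine ⟨e1, e2, e3, e4, e5, e6, e7, e8, e9, C + (16 * x) ^ 2, cr, ?_, ?_⟩
    · rw [mul_add]; exact hC.add hx
    · linarith

theorem VerticalLedger.started_of_sub {T : Shelf}
    (h : VerticalLedger k a v q s z V) (hs : V.sub = some T) : V.started = true := by
  obtain ⟨V, st, sub⟩ := V
  subst hs
  cases st
  · exact absurd h.2.2.2.2.2 id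
  · rfl

/-- After the credit is redeemed, Xw - w²/4 remains, and this is at least (w/2)X because X > w/2. -/
theorem VerticalLedger.pack_close {T : Shelf} (hx : IsClass k x)
    (h : VerticalLedger k a v q s z V) (hs : V.sub = some T) (hT : T.length < T.used + x)
    (hf : V.shelf.used + x ≤ 1 / 4) :
    VerticalLedger k (a + (16 * x) ^ 2) v q s z
      { V with sub := none, shelf := V.shelf.advance x } := by
  have hst := h.started_of_sub hs
  have hw := unitWidth_pos k
  obtain ⟨V, st, sub⟩ := V
  subst hs
  subst hst
  simp only [VerticalLedger, Shelf.advance] at h hf ⊢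
  obtain ⟨e1, e2, e3, e4, e5, e6, e7, e8, e9, C, cr, hC, ha⟩ := h
  have hcl := hC.close hx (by linarith)
  have hp := hx.pos
  exact ⟨e1, e2, by linarith, by linarith, e5, by linarith, e9, by nlinarith [hx.1]⟩

/-- This case dictates the bound in `SubLedger.close`: with wU/2 > 2w - wX/2 from the full shelf,
the new shelf is paid for as soon as C - cr + X² ≥ wX. -/
theorem VerticalLedger.reopen_close {S T : Shelf} (hk : 3 ≤ k) (hx : IsClass k x)
    (h : VerticalLedger k a v q s z V) (hs : V.sub = some T) (hT : T.length < T.used + x)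
    (hf : 1 / 4 < V.shelf.used + x)
    (hl : S.length = 1 / 4) (hh : S.height = classWidth k) (hu : S.used = x) :
    VerticalLedger k (a + (16 * x) ^ 2) (v + unitWidth k) q s z ⟨S, false, none⟩ := by
  have hst := h.started_of_sub hs
  have hw := unitWidth_pos k
  have hw2 := unitWidth_le_two hk
  obtain ⟨V, st, sub⟩ := V
  subst hs
  subst hst
  simp only [VerticalLedger] at h hf ⊢
  obtain ⟨e1, e2, e3, e4, e5, e6, e7, e8, e9, C, cr, hC, ha⟩ := h
  have hcl := hC.close hx (by linarith)
  obtain ⟨h1, h2⟩ := hx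
  rw [hu]
  exact ⟨hl, hh, by linarith, by linarith, by linarith, by linarith, by rw [e9]; ring,
    by nlinarith⟩

end

theorem ClassLedger.width_nonneg {k : ℕ} {a v q s z : ℝ} {I : Option Shelf}
    {Vt : Option Vertical} (h : ClassLedger k a v q s z I Vt) : 0 ≤ v := by
  cases Vt
  · exact h.1.ge
  · exact (unitWidth_pos k).le.trans h.2.2.2.2.1

theorem ClassLedger.charge_le {k : ℕ} {a v q s z : ℝ} {I : Option Shelf}
    {Vt : Option Vertical} (h : ClassLedger k a v q s z I Vt) : s ≤ rate k * v := by
  have hr := third_le_rate k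
  have hw := unitWidth_pos k
  rcases Vt with _ | ⟨V, st, sub⟩
  · rw [h.1, h.2.2.1]; simp
  · cases st <;> cases sub <;> simp only [ClassLedger, VerticalLedger] at h
    · rw [h.2.2.2.2.2.2.1]; nlinarith
    · exact absurd h.2.2.2.2.2 id
    · exact h.2.2.2.2.2.2.1.le
    · exact h.2.2.2.2.2.2.2.2.1.le

theorem VerticalLedger.le_charge {k : ℕ} {a v q s z : ℝ}
    {V : Vertical} (h : VerticalLedger k a v q s z V) : rate k * (v - unitWidth k) ≤ s := by
  have hr := third_le_rate k
  have hw := unitWidth_pos k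
  obtain ⟨V, st, sub⟩ := V
  cases st <;> cases sub <;> simp only [VerticalLedger] at h
  · rw [h.2.2.2.2.2.2.1]
  · exact absurd h.2.2.2.2.2 id
  · rw [h.2.2.2.2.2.2.1]; nlinarith
  · rw [h.2.2.2.2.2.2.2.2.1]; nlinarith

/-- The content of the current shelf has not yet been spent on a successor, and it is large enough
to cover the charge of that shelf, even before an open subshelf has earned its credit. So only the
width v - w is effectively charged. -/
theorem VerticalLedger.le_area {k : ℕ} {a v q s z : ℝ}
    {V : Vertical} (hk : 3 ≤ k) (h : VerticalLedger k a v q s z V) :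
    2 * v + q + z + s ≤ a + rate k * (v - unitWidth k) := by
  have hr := third_le_rate k
  have hr' := rate_le k
  have hw := unitWidth_pos k
  have hw2 := unitWidth_le_two hk
  obtain ⟨V, st, sub⟩ := V
  cases st <;> cases sub <;> simp only [VerticalLedger] at h
  · obtain ⟨e1, e2, e3, e4, e5, e6, e7, e8⟩ := h
    rw [e7]; nlinarith
  · exact absurd h.2.2.2.2.2 id
  · obtain ⟨e1, e2, e3, e4, e5, e6, e7, e8⟩ := h
    rw [e7]
    rcases hk.eq_or_lt with rfl | hk
    · rw [rate_three, unitWidth_three] at *; linarith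
    · have := unitWidth_le_one hk
      nlinarith
  · obtain ⟨e1, e2, e3, e4, e5, e6, e7, e8, e9, C, cr, ⟨hl, hC, -, hc⟩, ha⟩ := h
    rw [e9]
    have h1 := unitWidth_le_one e6
    have hc' : cr ≤ unitWidth k / 2 ∨ cr ≤ unitWidth k - 9 * unitWidth k ^ 2 / 16 := by
      rcases hc with hc | ⟨rfl, -, rfl, -⟩
      · rcases le_max_iff.1 hc with hc | hc
        · left; linarith
        · right; nlinarith
      · left; rw [unitWidth_four]
    have hu : unitWidth k * (2 - unitWidth k) ≤ unitWidth k / 2 * (16 * V.used) := by nlinarith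
    rcases hc' with hc | hc <;> nlinarith

/-! ### Summation over the height classes -/

/-- The ledgers of the classes below `N`. -/
def Classes (N : ℕ) (I : ℕ → Option Shelf) (Vt : ℕ → Option Vertical) (z : ℝ)
    (a v q s : ℕ → ℝ) : Prop :=
  ∀ k, 3 ≤ k → k < N → ClassLedger k (a k) (v k) (q k) (s k) (if k = 3 then z else 0) (I k) (Vt k)

/-- The total over all classes of small squares below `N`. -/
noncomputable def total (N : ℕ) (f : ℕ → ℝ) : ℝ := ∑ k ∈ Finset.Ico 3 N, f k

theorem total_update {N k : ℕ} (hk : 3 ≤ k) (hN : k < N) (f : ℕ → ℝ) (y : ℝ) :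
    total N (Function.update f k y) = total N f + (y - f k) := by
  unfold total
  rw [Finset.sum_update_of_mem (Finset.mem_Ico.2 ⟨hk, hN⟩),
    Finset.sum_eq_add_sum_sdiff_singleton_of_mem (Finset.mem_Ico.2 ⟨hk, hN⟩) f]
  ring

namespace Classes
variable {N : ℕ} {I : ℕ → Option Shelf} {Vt : ℕ → Option Vertical} {z : ℝ} {a v q s : ℕ → ℝ}

theorem charge_le (h : Classes N I Vt z a v q s) : total N s ≤ total N v / 2 := by
  unfold total
  rw [Finset.sum_div]
  refine Finset.sum_le_sum fun k hk => ?_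
  obtain ⟨h3, hN⟩ := Finset.mem_Ico.1 hk
  have h1 := (h k h3 hN).charge_le
  have h2 := (h k h3 hN).width_nonneg
  have := rate_le k
  nlinarith

theorem width_le (h : Classes N I Vt z a v q s) {k : ℕ} (hk : 3 ≤ k) (hN : k < N) :
    v k ≤ total N v :=
  Finset.single_le_sum (fun i hi => (h i (Finset.mem_Ico.1 hi).1 (Finset.mem_Ico.1 hi).2).width_nonneg)
    (Finset.mem_Ico.2 ⟨hk, hN⟩)

/-- The excess `z` belongs to the class H_3. It enters the ledger with the first vertical shelf;
before that the initial squares must pay for it, which is `hz`. -/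
theorem le_area (h : Classes N I Vt z a v q s) (hN : 3 < N) (hz : Vt 3 = none → z ≤ a 3) :
    2 * total N v + total N q + z ≤ total N a := by
  have : z = total N fun k => if k = 3 then z else 0 := by
    unfold total
    rw [Finset.sum_ite_eq' (Finset.Ico 3 N) 3, if_pos (Finset.mem_Ico.2 ⟨le_rfl, hN⟩)]
  rw [this]
  unfold total
  rw [Finset.mul_sum, ← Finset.sum_add_distrib, ← Finset.sum_add_distrib]
  refine Finset.sum_le_sum fun k hk => ?_
  obtain ⟨h3, hN⟩ := Finset.mem_Ico.1 hk
  have hk := h k h3 hN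
  rcases hV : Vt k with _ | V <;> rw [hV] at hk
  · obtain ⟨h1, h2, -, h4, -⟩ := hk
    rw [h1, h2]
    split_ifs with hk3
    · subst hk3; have := hz hV; linarith
    · linarith
  · have h1 := VerticalLedger.le_area h3 hk
    have h2 := VerticalLedger.le_charge hk
    linarith

/-- The current H_3-shelf saves 2/2 = 1. If H_4 has no vertical shelf, everything except H_3 is
charged at the rate 1/3. Otherwise the rate is bounded by 1/2 throughout, but the current H_4-shelf
saves another 1/2. -/
theorem le_area_of_opened (h : Classes N I Vt z a v q s) (hN : 5 ≤ N) (hV : Vt 3 ≠ none) :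
    (2 * total N v + total N q + z + total N s ≤
      total N a + v 3 / 2 - 1 + (total N v - v 3) / 3) ∨
    2 * total N v + total N q + z + total N s ≤ total N a + total N v / 2 - 3 / 2 := by
  obtain ⟨N, rfl⟩ := Nat.exists_eq_add_of_le hN
  have hsplit : ∀ f : ℕ → ℝ,
      total (5 + N) f = f 3 + (f 4 + ∑ k ∈ Finset.Ico 5 (5 + N), f k) := fun f => by
    unfold total
    rw [Finset.sum_eq_sum_Ico_succ_bot (by omega), Finset.sum_eq_sum_Ico_succ_bot (by omega)]
  have h3 := h 3 le_rfl (by omega)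
  have h4 := h 4 (by omega) (by omega)
  have h5 : 2 * (∑ k ∈ Finset.Ico 5 (5 + N), v k) + (∑ k ∈ Finset.Ico 5 (5 + N), q k) +
      (∑ k ∈ Finset.Ico 5 (5 + N), s k) ≤ (∑ k ∈ Finset.Ico 5 (5 + N), a k) +
      (∑ k ∈ Finset.Ico 5 (5 + N), v k) / 3 := by
    rw [Finset.mul_sum, Finset.sum_div, ← Finset.sum_add_distrib, ← Finset.sum_add_distrib,
      ← Finset.sum_add_distrib]
    refine Finset.sum_le_sum fun k hk => ?_
    obtain ⟨h5, hN⟩ := Finset.mem_Ico.1 hk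
    have hk := h k (by omega) hN
    have hw := unitWidth_pos k
    rcases hV : Vt k with _ | V <;> rw [hV] at hk
    · obtain ⟨h1, h2, h3, h4, -⟩ := hk
      rw [h1, h2, h3]; linarith
    · have h1 := VerticalLedger.le_area (by omega) hk
      rw [if_neg (by omega), rate_of_five_le h5] at h1
      linarith
  have hnn : 0 ≤ ∑ k ∈ Finset.Ico 5 (5 + N), v k := Finset.sum_nonneg fun k hk =>
    (h k (by have := (Finset.mem_Ico.1 hk).1; omega) (Finset.mem_Ico.1 hk).2).width_nonneg
  simp only [hsplit]
  rcases hV3 : Vt 3 with _ | V3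
  · exact absurd hV3 hV
  rw [hV3] at h3
  have h3' := VerticalLedger.le_area le_rfl h3
  rw [rate_three, unitWidth_three, if_pos rfl] at h3'
  rcases hV4 : Vt 4 with _ | V4 <;> rw [hV4] at h4
  · obtain ⟨h1, h2, h3, h4, -⟩ := h4
    left
    rw [h1, h2, h3]; linarith
  · have h4' := VerticalLedger.le_area (by omega) h4
    rw [rate_four, unitWidth_four, if_neg (by omega)] at h4'
    right
    linarith

theorem update (h : Classes N I Vt z a v q s) {k : ℕ} {a' v' q' s' z' : ℝ} {i : Option Shelf}
    {V : Option Vertical} (hz : z' = z ∨ (k = 3))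
    (hk : ClassLedger k a' v' q' s' (if k = 3 then z' else 0) i V) :
    Classes N (Function.update I k i) (Function.update Vt k V) z'
      (Function.update a k a') (Function.update v k v') (Function.update q k q')
      (Function.update s k s') := by
  intro j h3 hN
  by_cases hj : j = k
  · subst hj; simpa using hk
  · simp only [Function.update_of_ne hj]
    rcases hz with rfl | rfl
    · exact h j h3 hN
    · have := h j h3 hN
      rw [if_neg hj] at this ⊢
      exact this

end Classes

/-! ### The global ledger -/

/-- The lengths of the main regions in units of `1/16`. -/
noncomputable def mainLength : Fin 4 → ℝ := ![16, 8, 12, 14]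

theorem mainLength_zero : mainLength 0 = 16 := rfl
theorem mainLength_one : mainLength 1 = 8 := rfl
theorem mainLength_two : mainLength 2 = 12 := rfl
theorem mainLength_three : mainLength 3 = 14 := rfl

/-- The width of the part of the end that is taken by the main packing. -/
noncomputable def EndBuffer.taken : EndBuffer → ℝ
  | .reserved => 0
  | .active S _ => 2 - 16 * S.height
  | .closed S => 2 - 16 * S.height

/-- The credit of a closed end buffer, where `e` is the balance of the buffer packing in it. -/
noncomputable def EndBuffer.credit (e : ℝ) : EndBuffer → ℝ
  | .closed S => 2 * (2 - 16 * S.height) + e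
  | _ => 0

/-- The ledger of the end of a main region of length `L`, of which `U` is used.  `e` is the balance
and `t` the charged width of the vertical shelves that have used this end for the buffer packing. -/
def EndLedger (L U e t : ℝ) : EndBuffer → Prop
  | .reserved => e = 0 ∧ t = 0
  | .active S n => n ≤ 1 ∧ 1 ≤ 16 * S.height ∧ 16 * S.height ≤ 2 ∧ 0 ≤ S.used ∧
      16 * S.used < 2 ∧ S.length = 1 / 4 ∧ S.dir = .up ∧ U + 16 * S.height ≤ L ∧ 0 ≤ t ∧
      n * (16 * S.height * (16 * S.height - 1) - 1) ≤ e ∧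
      n * (16 * S.height * (16 * S.height - 1)) + 16 * S.used * (16 * S.height / 2 - 1 / 16) ≤ e + t
  | .closed S => 0 ≤ 16 * S.height ∧ 16 * S.height ≤ 2 ∧ S.dir = .up ∧ U + 16 * S.height ≤ L ∧ 0 ≤ t ∧
      0 ≤ 2 * (2 - 16 * S.height) + e ∧
      (7 - 16 * S.height) / 3 ≤ 2 * (2 - 16 * S.height) + e + t ∧
      (16 * S.height < 1 → 0 ≤ e + t)

section
variable {L U e t : ℝ} {E : EndBuffer}

theorem EndLedger.charge_nonneg (h : EndLedger L U e t E) : 0 ≤ t := by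
  cases E
  · exact h.2.ge
  · exact h.2.2.2.2.2.2.2.2.1
  · exact h.2.2.2.2.1

theorem EndLedger.credit_nonneg (h : EndLedger L U e t E) : 0 ≤ E.credit e := by
  cases E
  · exact le_rfl
  · exact le_rfl
  · exact h.2.2.2.2.2.1

theorem EndLedger.taken_nonneg (h : EndLedger L U e t E) : 0 ≤ E.taken := by
  cases E
  · exact le_rfl
  · linarith [h.2.2.1, show EndBuffer.taken (.active ‹_› ‹_›) = 2 - 16 * (‹Shelf›).height from rfl]
  · linarith [h.2.1, show EndBuffer.taken (.closed ‹_›) = 2 - 16 * (‹Shelf›).height from rfl]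

theorem EndLedger.closed_supply (h : EndLedger L U e t E) (hE : E.isClosed = true) :
    3 / 2 + E.taken / 2 ≤ E.credit e + t ∧ (5 + E.taken) / 3 ≤ E.credit e + t ∧
      (1 < E.taken → 2 * E.taken ≤ E.credit e + t) ∧ E.taken ≤ 2 ∧ U ≤ L - 2 + E.taken := by
  cases E with
  | reserved => cases hE
  | active S n => cases hE
  | closed S =>
    obtain ⟨h1, h2, h3, h4, h5, h6, h7, h8⟩ := h
    simp only [EndBuffer.taken, EndBuffer.credit]
    generalize 16 * S.height = y at *
    refine ⟨?_, by linarith, fun h => by linarith [h8 (by linarith)], by linarith, by linarith⟩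
    by_cases hy : y < 1
    · linarith [h8 hy]
    · linarith

end

theorem EndBuffer.isReserved_iff {E : EndBuffer} : E.isReserved = true ↔ E = .reserved := by
  cases E <;> simp [EndBuffer.isReserved]

theorem EndBuffer.isClosed_of_ne {E : EndBuffer} (h : E ≠ .reserved)
    (h' : ∀ S n, E ≠ .active S n) : E.isClosed = true := by
  cases E with
  | reserved => exact absurd rfl h
  | active S n => exact absurd rfl (h' S n)
  | closed S => rfl

/-- The length of `M_i` that is used or lost. -/
noncomputable def reach (L : ℝ) (S : Shelf) : EndBuffer → ℝ
  | .reserved => 16 * S.used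
  | .active F _ => L - 16 * F.height
  | .closed F => L - 16 * F.height

/-- The ledger of the main regions: `V` is the total width of the vertical shelves, `v₃` the part
due to the class `H_3`, `a₂` the area of the `H_2`-squares, and `pay` an advance. -/
structure MainLedger (main : Fin 4 → Shelf) (ends : Fin 3 → EndBuffer) (V v₃ a₂ pay : ℝ) :
    Prop where
  length : ∀ i, 16 * (main i).length = mainLength i
  height : ∀ i, (main i).height = 1 / 4
  dir : ∀ i, (main i).dir ≠ .up
  used_nonneg : ∀ i, 0 ≤ (main i).used
  used_le : ∀ i, 16 * (main i).used ≤ mainLength i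
  order_zero : ends 0 = .reserved → ends 1 = .reserved ∧
    (main 1).used = 0 ∧ (main 2).used = 0 ∧ (main 3).used = 0
  order_one : ends 1 = .reserved → ends 2 = .reserved ∧ (main 2).used = 0 ∧ (main 3).used = 0
  parts : ∃ (m : Fin 4 → ℕ) (r : Fin 4 → ℝ), (∀ i, 16 * (main i).used = 2 * m i + r i) ∧
    (∀ i, 0 ≤ r i) ∧ v₃ = 2 * ∑ i, (m i : ℝ) ∧ V - v₃ ≤ ∑ i, r i
  last : ends 2 = .reserved →
    V ≤ 16 * (main 0).used + 16 * (main 1).used + 16 * (main 2).used + 8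
  area : 2 * (reach 16 (main 0) (ends 0) + reach 8 (main 1) (ends 1) + reach 12 (main 2) (ends 2) +
    16 * (main 3).used) ≤ a₂ + 2 * V + pay

/-- The ledger of the buffer regions `B_1, …, B_4`, where `B` is the credit for the squares in
these regions. -/
structure BufferLedger (buf : Fin 4 → Shelf) (act : Fin 4) (B : ℝ) : Prop where
  height : ∀ j, 16 * (buf j).height = 2
  used_nonneg : ∀ j, 0 ≤ (buf j).used
  used_le : ∀ j, (buf j).used ≤ (buf j).length
  length_zero : 4 ≤ 16 * (buf 0).length
  length_one : 16 * (buf 1).length = 4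
  length_two : 16 * (buf 2).length = 8
  length_three : 16 * (buf 3).length = 4
  later : ∀ j, act < j → (buf j).used = 0
  first : act ≠ 0 → (buf 0).used ≠ 0
  sum_le : 16 * ∑ j, (buf j).used ≤ B
  act_le : ![0, 3, 6, 13] act + 16 * (buf act).used ≤ B

/-- The balance of buffer credits and demands. -/
structure Balance (main : Fin 4 → Shelf) (ends : Fin 3 → EndBuffer) (I₃ : ℝ) (opened : Prop)
    (B Q S : ℝ) (e t : Fin 3 → ℝ) : Prop where
  endLedger : ∀ i, EndLedger (mainLength i.castSucc) (16 * (main i.castSucc).used) (e i) (t i) (ends i)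
  supply : B - (S - ∑ i, t i) ≤ Q - ∑ i, e i
  supply_unopened : ¬ opened → 3 / 4 * B - (S - ∑ i, t i) / 2 ≤ Q - ∑ i, e i
  surplus : 0 ≤ Q - ∑ i, e i + max 0 (I₃ - 3) + ∑ i, (ends i).credit (e i) ∨
    (opened ∧ 16 ≤ B ∧ (ends 0).isClosed = true ∧ (ends 1).isClosed = true ∧
      ∀ F n, ends 2 = .active F n →
        S - t 2 ≤ (16 * (main 0).used + 16 * (main 1).used + 16 * (main 2).used + 8) / 2)

/-! ### Bounds for the total width of vertical shelves -/

section MainLedger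
variable {main : Fin 4 → Shelf} {ends : Fin 3 → EndBuffer} {V v₃ a₂ pay : ℝ}

theorem MainLedger.width_le (h : MainLedger main ends V v₃ a₂ pay) :
    V ≤ 16 * (main 0).used + 16 * (main 1).used + 16 * (main 2).used + 16 * (main 3).used := by
  obtain ⟨m, r, h1, h2, h3, h4⟩ := h.parts
  rw [h1, h1, h1, h1]
  simp only [Fin.sum_univ_four] at h3 h4
  linarith

theorem MainLedger.width_le_of_zero (h : MainLedger main ends V v₃ a₂ pay)
    (h0 : ends 0 = .reserved) : V ≤ 16 := by
  obtain ⟨-, h1, h2, h3⟩ := h.order_zero h0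
  have := h.width_le
  rw [h1, h2, h3] at this
  have := h.used_le 0
  rw [mainLength_zero] at this
  linarith

theorem MainLedger.width_le_of_one (h : MainLedger main ends V v₃ a₂ pay)
    (h1 : ends 1 = .reserved) : V ≤ 24 := by
  obtain ⟨-, h2, h3⟩ := h.order_one h1
  have := h.width_le
  rw [h2, h3] at this
  have h4 := h.used_le 0
  have h5 := h.used_le 1
  rw [mainLength_zero] at h4
  rw [mainLength_one] at h5
  linarith

theorem MainLedger.width_le_of_two (h : MainLedger main ends V v₃ a₂ pay)
    (h2 : ends 2 = .reserved) : V ≤ 44 := by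
  have h0 := h.last h2
  have h3 := h.used_le 2
  have h4 := h.used_le 0
  have h5 := h.used_le 1
  rw [mainLength_zero] at h4
  rw [mainLength_one] at h5
  rw [mainLength_two] at h3
  linarith

end MainLedger

/-! ### Buffer supply against charges -/

section Balance
variable {main : Fin 4 → Shelf} {ends : Fin 3 → EndBuffer} {I₃ : ℝ} {opened : Prop}
  {B Q S : ℝ} {e t : Fin 3 → ℝ}

theorem Balance.charge_nonneg (h : Balance main ends I₃ opened B Q S e t) (i : Fin 3) : 0 ≤ t i :=
  (h.endLedger i).charge_nonneg

theorem Balance.credit_nonneg (h : Balance main ends I₃ opened B Q S e t) (i : Fin 3) :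
    0 ≤ (ends i).credit (e i) :=
  (h.endLedger i).credit_nonneg

theorem Balance.closed_credit (h : Balance main ends I₃ opened B Q S e t) (i : Fin 3) :
    (if (ends i).isClosed = true then 3 / 2 else 0) ≤ (ends i).credit (e i) + t i := by
  split_ifs with hi
  · linarith [((h.endLedger i).closed_supply hi).1, (h.endLedger i).taken_nonneg]
  · linarith [h.charge_nonneg i, h.credit_nonneg i]

/-- The buffer packing of a vertical shelf is omitted because there is enough buffer space. -/
theorem Balance.skip (h : Balance main ends I₃ opened B Q S e t) {V c d gain : ℝ}
    (hV : V / 2 ≤ B + I₃ + 3 / 2 * (∑ i, if (ends i).isClosed = true then 1 else 0) - 3 + gain)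
    (hS : S + d ≤ V / 2) (hc : c ≤ d) (hg : 0 ≤ gain) (ho : ¬ opened → c ≤ d / 2) :
    Balance main ends I₃ opened B (Q - c + gain) (S + d) e t := by
  have hcc := h.closed_credit
  have hs := h.supply
  refine ⟨h.endLedger, by linarith, fun h' => by linarith [ho h', h.supply_unopened h'], .inl ?_⟩
  have h0 := hcc 0
  have h1 := hcc 1
  have h2 := hcc 2
  -- The charges, at most V/2, are covered by B, by the initial length above 3 (the constant 3/16 in
  -- β), by 3/2 for each closed end, and by `gain`.
  have hm := le_max_right 0 (I₃ - 3)
  simp only [Fin.sum_univ_three] at *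
  have hite : ∀ i : Fin 3, (if (ends i).isClosed = true then (3 / 2 : ℝ) else 0) =
      3 / 2 * (if (ends i).isClosed = true then 1 else 0) := fun i => by split_ifs <;> norm_num
  rw [hite] at h0 h1 h2
  linarith

/-- Buffer packing outside of the active end buffers. -/
theorem Balance.buffer (h : Balance main ends I₃ opened B Q S e t) {B' Q' S' : ℝ}
    (hna : ∀ i F n, ends i ≠ .active F n) (hB : B ≤ B') (hQ : Q ≤ Q')
    (hs : B' - B - (S' - S) ≤ Q' - Q)
    (ho : ¬ opened → 3 / 4 * (B' - B) - (S' - S) / 2 ≤ Q' - Q) :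
    Balance main ends I₃ opened B' Q' S' e t := by
  refine ⟨h.endLedger, by linarith [h.supply], fun h' => by linarith [ho h', h.supply_unopened h'], ?_⟩
  refine h.surplus.imp (fun h => by linarith) fun ⟨h1, h2, h3, h4, h5⟩ => ?_
  exact ⟨h1, by linarith, h3, h4, fun F n hF => absurd hF (hna 2 F n)⟩

/-- The buffer regions cannot take a square. -/
theorem Balance.noRoom {V v₃ a₂ pay : ℝ} (h : Balance main ends I₃ opened B Q S e t)
    (hM : MainLedger main ends V v₃ a₂ pay) {B' c d gain : ℝ}
    (hna : ∀ i F n, ends i ≠ .active F n) (hB : B ≤ B') (hS : S + d ≤ V / 2) (hB' : 16 ≤ B')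
    (hc : c ≤ d) (hg : B' - B ≤ gain) (ho : ¬ opened → c ≤ d / 2) :
    Balance main ends I₃ opened B' (Q - c + gain) (S + d) e t := by
  have hs := h.supply
  have hs' : ¬ opened → 3 / 4 * B' - (S + d - ∑ i, t i) / 2 ≤ Q - c + gain - ∑ i, e i :=
    fun h' => by linarith [ho h', h.supply_unopened h']
  refine ⟨h.endLedger, by linarith, hs', ?_⟩
  have t0 := h.charge_nonneg 0
  have t1 := h.charge_nonneg 1
  have t2 := h.charge_nonneg 2
  have c0 := h.credit_nonneg 0
  have c1 := h.credit_nonneg 1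
  have c2 := h.credit_nonneg 2
  have hm := le_max_left 0 (I₃ - 3)
  simp only [Fin.sum_univ_three] at *
  -- While M_1 or M_2 is open, V ≤ 24, so all charges are at most 12 < 16.
  by_cases h0 : ends 0 = .reserved
  · have := hM.width_le_of_zero h0
    left; linarith
  by_cases h1 : ends 1 = .reserved
  · have := hM.width_le_of_one h1
    left; linarith
  -- With vertical H_3-shelves the supply 16 may be too small here; the postponed alternative is
  -- recorded instead.
  by_cases hop : opened
  · exact .inr ⟨hop, hB', EndBuffer.isClosed_of_ne h0 (hna 0), EndBuffer.isClosed_of_ne h1 (hna 1),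
      fun F n hF => absurd hF (hna 2 F n)⟩
  · have hs' := hs' hop
    left
    -- Without H_3-shelves `supply_unopened` applies: (3/4)·16 = 12 against half the charges, which
    -- is at most 44/4 = 11 while M_3 is open. After its closing the supply of the three closed ends
    -- accounts for the parts taken.
    by_cases h2 : ends 2 = .reserved
    · have := hM.width_le_of_two h2
      linarith
    · have b0 := (h.endLedger 0).closed_supply (EndBuffer.isClosed_of_ne h0 (hna 0))
      have b1 := (h.endLedger 1).closed_supply (EndBuffer.isClosed_of_ne h1 (hna 1))
      have b2 := (h.endLedger 2).closed_supply (EndBuffer.isClosed_of_ne h2 (hna 2))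
      have := hM.width_le
      have u0 := b0.2.2.2.2
      have u1 := b1.2.2.2.2
      have u2 := b2.2.2.2.2
      have u3 := hM.used_le 3
      simp only [Fin.castSucc_zero, show Fin.castSucc (1 : Fin 3) = 1 from rfl,
        show Fin.castSucc (2 : Fin 3) = 2 from rfl] at u0 u1 u2
      rw [mainLength_zero] at u0
      rw [mainLength_one] at u1
      rw [mainLength_two] at u2
      rw [mainLength_three] at u3
      linarith [b0.1, b1.1, b2.1]

/-- Buffer packing in the active end buffer `E_i`. -/
theorem Balance.useEnd (h : Balance main ends I₃ opened B Q S e t) {i : Fin 3} {F : Shelf} {n : ℕ}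
    (hi : ends i = .active F n) {E : EndBuffer} {Q' S' : ℝ}
    (hL : EndLedger (mainLength i.castSucc) (16 * (main i.castSucc).used)
      (e i + (Q' - Q)) (t i + (S' - S)) E) :
    Balance main (Function.update ends i E) I₃ opened B Q' S'
      (Function.update e i (e i + (Q' - Q))) (Function.update t i (t i + (S' - S))) := by
  have hse : ∀ (f : Fin 3 → ℝ) y, ∑ j, Function.update f i y j = ∑ j, f j + (y - f i) :=
    fun f y => by fin_cases i <;> simp [Fin.sum_univ_three, Function.update] <;> ring
  have hcr : ∑ j, (ends j).credit (e j) ≤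
      ∑ j, (Function.update ends i E j).credit (Function.update e i (e i + (Q' - Q)) j) := by
    refine Finset.sum_le_sum fun j _ => ?_
    by_cases hj : j = i
    · subst hj
      simp only [Function.update_self]
      rw [hi]
      exact hL.credit_nonneg
    · simp [Function.update_of_ne hj]
  refine ⟨fun j => ?_, ?_, fun h' => ?_, ?_⟩
  · by_cases hj : j = i
    · subst hj; simpa using hL
    · simpa [Function.update_of_ne hj] using h.endLedger j
  · rw [hse, hse]; linarith [h.supply]
  · rw [hse, hse]; linarith [h.supply_unopened h']
  · rw [hse]
    refine h.surplus.imp (fun h => by linarith) fun ⟨h1, h2, h3, h4, h5⟩ => ?_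
    -- In the postponed alternative E_1 and E_2 are closed, so the active end is E_3. There the
    -- total charge and the charge of E_3 grow by the same amount, and the bound on their difference
    -- persists.
    have hi0 : (0 : Fin 3) ≠ i := by rintro rfl; rw [hi] at h3; cases h3
    have hi1 : (1 : Fin 3) ≠ i := by rintro rfl; rw [hi] at h4; cases h4
    have hi2 : i = 2 := by omega
    subst hi2
    refine ⟨h1, h2, by rwa [Function.update_of_ne hi0], by rwa [Function.update_of_ne hi1], ?_⟩
    intro _ _ _
    rw [Function.update_self]
    linarith [h5 F n hi]

/-- A main region is closed. -/
theorem Balance.close {V v₃ a₂ pay : ℝ} (h : Balance main ends I₃ opened B Q S e t)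
    (hM : MainLedger main ends V v₃ a₂ pay) (hS : S ≤ V / 2) {i : Fin 3}
    (hi : ends i = .reserved) {E : EndBuffer}
    (hL : EndLedger (mainLength i.castSucc) (16 * (main i.castSucc).used) 0 0 E) :
    Balance main (Function.update ends i E) I₃ opened B Q S e t := by
  have hei := h.endLedger i
  rw [hi] at hei
  have hcr : ∑ j, (ends j).credit (e j) ≤ ∑ j, (Function.update ends i E j).credit (e j) := by
    refine Finset.sum_le_sum fun j _ => ?_
    by_cases hj : j = i
    · subst hj
      simp only [Function.update_self]
      rw [hi, hei.1]
      exact hL.credit_nonneg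
    · simp [Function.update_of_ne hj]
  refine ⟨fun j => ?_, h.supply, h.supply_unopened, ?_⟩
  · by_cases hj : j = i
    · subst hj; rw [Function.update_self, hei.1, hei.2]; exact hL
    · simpa [Function.update_of_ne hj] using h.endLedger j
  · refine h.surplus.imp (fun h => by linarith) fun ⟨h1, h2, h3, h4, h5⟩ => ?_
    have hi0 : (0 : Fin 3) ≠ i := by rintro rfl; rw [hi] at h3; cases h3
    have hi1 : (1 : Fin 3) ≠ i := by rintro rfl; rw [hi] at h4; cases h4
    have hi2 : i = 2 := by omega
    subst hi2
    refine ⟨h1, h2, by rwa [Function.update_of_ne hi0], by rwa [Function.update_of_ne hi1], ?_⟩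
    intro _ _ _
    rw [hei.2]
    -- This is where the bound for an active E_3 originates: M_3 is being closed, E_3 has no charge
    -- yet, and `last` still holds.
    linarith [hM.last hi]

/-- Filling the main regions does not affect the balance. -/
theorem Balance.mono (h : Balance main ends I₃ opened B Q S e t) {main' : Fin 4 → Shelf} {I₃' : ℝ}
    {opened' : Prop} (hu : ∀ i : Fin 4, (main i).used ≤ (main' i).used)
    (he : ∀ i, ends i ≠ .reserved → (main' i.castSucc).used = (main i.castSucc).used)
    (hI : I₃ ≤ I₃') (ho : opened → opened') :
    Balance main' ends I₃' opened' B Q S e t := by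
  refine ⟨fun i => ?_, h.supply, fun h' => h.supply_unopened (mt ho h'), ?_⟩
  · have hi := h.endLedger i
    by_cases hr : ends i = .reserved
    · rw [hr] at hi ⊢; exact hi
    · rwa [he i hr]
  · refine h.surplus.imp (fun h => ?_) fun ⟨h1, h2, h3, h4, h5⟩ =>
      ⟨ho h1, h2, h3, h4, fun F n hF => ?_⟩
    · have : max 0 (I₃ - 3) ≤ max 0 (I₃' - 3) := max_le_max le_rfl (by linarith)
      linarith
    · linarith [h5 F n hF, hu 0, hu 1, hu 2]

/-- The overflow of `M_4` contradicts the area bound. -/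
theorem Balance.overflow {V v₃ a₂ pay A w z : ℝ} (h : Balance main ends I₃ opened B Q S e t)
    (hz : z = max 0 (I₃ - 3))
    (hM : MainLedger main ends V v₃ a₂ pay) (hr : ∀ i, ends i ≠ .reserved)
    (hw : 14 < 16 * (main 3).used + w) {V' v₃' a₂' : ℝ} {m : ℕ} {r : ℝ}
    (hV : a₂ + 2 * V + pay + 2 * w ≤ a₂' + 2 * V')
    (hm : w = 2 * m + r) (hr0 : 0 ≤ r) (hv : v₃' = v₃ + 2 * m) (hVv : V' - v₃' ≤ V - v₃ + r)
    (hA : 2 * V' + Q + z ≤ A)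
    (hA' : opened → 2 * V' + Q + z + S ≤ A + v₃' / 2 - 1 + (V' - v₃') / 3 ∨
      2 * V' + Q + z + S ≤ A + V' / 2 - 3 / 2) :
    88 < a₂' + A := by
  have harea := hM.area
  have hreach : ∀ (L : ℝ) (M : Shelf) (E : EndBuffer), E ≠ .reserved →
      reach L M E = L - 2 + E.taken := by
    intro L M E hE
    cases E
    · exact absurd rfl hE
    · simp only [reach, EndBuffer.taken]; ring
    · simp only [reach, EndBuffer.taken]; ring
  rw [hreach _ _ _ (hr 0), hreach _ _ _ (hr 1), hreach _ _ _ (hr 2)] at harea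
  -- An end that is still active has credit 0, which is harmless: with one miss and width y the
  -- right side is at least 2(2-y) + y(y-1) - 1 = y² - 3y + 3 > 0.
  have hact : ∀ i, (ends i).credit (e i) ≤ 2 * (ends i).taken + e i := by
    intro i
    have hi := h.endLedger i
    cases hE : ends i with
    | reserved => exact absurd hE (hr i)
    | closed F => exact le_rfl
    | active F n =>
      rw [hE] at hi
      obtain ⟨h1, h2, h3, h4, h5, h6, h6', h7, h8, h9, h10⟩ := hi
      simp only [EndBuffer.taken, EndBuffer.credit]
      interval_cases n
      · norm_num at h9; linarith
      · norm_num at h9; nlinarith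
  have a0 := hact 0
  have a1 := hact 1
  have a2 := hact 2
  -- If the surplus is nonnegative, the counted length exceeds 14+6+10+14 = 44, and the taken parts
  -- of the ends pay for the credits. The remaining cases start from B ≥ 16.
  rcases h.surplus with hR | ⟨hop, hB, hc0, hc1, h2⟩
  · simp only [Fin.sum_univ_three] at hR
    linarith
  have b0 := (h.endLedger 0).closed_supply hc0
  have b1 := (h.endLedger 1).closed_supply hc1
  have hs := h.supply
  have hz0 : 0 ≤ z := hz ▸ le_max_left _ _
  simp only [Fin.sum_univ_three] at hs
  have u0 := b0.2.2.2.2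
  have u1 := b1.2.2.2.2
  simp only [Fin.castSucc_zero, show Fin.castSucc (1 : Fin 3) = 1 from rfl] at u0 u1
  rw [mainLength_zero] at u0
  rw [mainLength_one] at u1
  have c0 : (ends 0).credit (e 0) = 2 * (ends 0).taken + e 0 := by
    cases hE : ends 0 with
    | closed F => rfl
    | _ => rw [hE] at hc0; cases hc0
  have c1 : (ends 1).credit (e 1) = 2 * (ends 1).taken + e 1 := by
    cases hE : ends 1 with
    | closed F => rfl
    | _ => rw [hE] at hc1; cases hc1
  cases hE : ends 2 with
  | reserved => exact absurd hE (hr 2)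
  | active F n =>
    -- The charges outside E_3 are at most (14+6+10+8)/2 = 19 plus half the taken parts; they are
    -- met by 16 and by 3/2 from each of the two closed ends.
    have h5 := h2 F n hE
    have hi := h.endLedger 2
    rw [hE] at hi a2 harea
    obtain ⟨h1, h2, h3, h4, h5, h6, h6', h7, h8, h9, h10⟩ := hi
    simp only [show Fin.castSucc (2 : Fin 3) = 2 from rfl] at h7
    rw [mainLength_two] at h7
    rw [show EndBuffer.taken (.active F n) = 2 - 16 * F.height from rfl] at harea a2
    generalize 16 * F.height = y at *
    interval_cases n
    · norm_num at h9
      linarith [b0.1, b1.1]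
    · norm_num at h9
      nlinarith [b0.1, b1.1, sq_nonneg (y - 5 / 4)]
  | closed F =>
    have hc2 : (ends 2).isClosed = true := by rw [hE]; rfl
    have b2 := (h.endLedger 2).closed_supply hc2
    have u2 := b2.2.2.2.2
    simp only [show Fin.castSucc (2 : Fin 3) = 2 from rfl] at u2
    rw [mainLength_two] at u2
    have c2 : (ends 2).credit (e 2) = 2 * (ends 2).taken + e 2 := by rw [hE]; rfl
    rcases hA' hop with hA' | hA'
    · obtain ⟨m', r', p1, p2, p3, p4⟩ := hM.parts
      simp only [Fin.sum_univ_four] at p3 p4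
      -- Here M is the number of H_3-shelves that fit in front of the end. The number of H_3-shelves
      -- is an integer: either it is at most M, and the part in the end is charged only at the rate
      -- 1/3, or it is M + 1, the whole end is taken and the supply is at least 4.
      have key : ∀ (M : ℕ) (i : Fin 3) (i' : Fin 4), 16 * (main i').used ≤ 2 * M + 2 →
          16 * (main i').used ≤ 2 * M + (ends i).taken →
          (5 + (ends i).taken) / 3 ≤ (ends i).credit (e i) + t i →
          (1 < (ends i).taken → 2 * (ends i).taken ≤ (ends i).credit (e i) + t i) →
          (ends i).taken ≤ 2 →
          m' i' + r' i' / 3 ≤ M + ((ends i).credit (e i) + t i) - 5 / 3 := by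
        intro M i i' k1 k2 k3 k4 k5
        have hp := p1 i'
        have hrp := p2 i'
        rcases Nat.lt_or_ge M (m' i') with hlt | hge
        · have : (M : ℝ) + 1 ≤ m' i' := by exact_mod_cast hlt
          have : (ends i).taken = 2 := by linarith
          have := k4 (by linarith)
          linarith
        · have : (m' i' : ℝ) ≤ M := by exact_mod_cast hge
          linarith
      have k0 := key 7 0 0 (by have := hM.used_le 0; rw [mainLength_zero] at this; norm_num; linarith)
        (by norm_num; linarith) b0.2.1 b0.2.2.1 b0.2.2.2.1
      have k1 := key 3 1 1 (by have := hM.used_le 1; rw [mainLength_one] at this; norm_num; linarith)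
        (by norm_num; linarith) b1.2.1 b1.2.2.1 b1.2.2.2.1
      have k2 := key 5 2 2 (by have := hM.used_le 2; rw [mainLength_two] at this; norm_num; linarith)
        (by norm_num; linarith) b2.2.1 b2.2.2.1 b2.2.2.2.1
      have p13 := p1 3
      have p23 := p2 3
      norm_num at k0 k1 k2
      -- The three bounds sum to 7+3+5-5 = 10 plus the supply of the ends. With the base 60, the
      -- supply 16, the saving 1 and at least 3/2 per unit of M_4, the sum exceeds 60+17-10+21 = 88.
      linarith
    -- At the uniform rate 1/2 the saving is 3/2, and the three ends supply 3/2 each beyond half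
    -- their taken parts: 60 + 16 + 3/2 - 15 + 21 + 9/2 = 88.
    · have u3 := hM.width_le
      linarith [b0.1, b1.1, b2.1]

end Balance

/-! ### Allocation in the main regions -/

/-- The ends after a section of width `w` has been requested: either nothing is closed, or exactly
one main region is. -/
def ClosingStep (main : Fin 4 → Shelf) (ends : Fin 3 → EndBuffer) (w : ℝ)
    (ends' : Fin 3 → EndBuffer) : Prop :=
  ends' = ends ∨ ∃ i : Fin 3, ends i = .reserved ∧ (∀ j < i, ends j ≠ .reserved) ∧
    ¬ (main i.castSucc).Fits w ∧ ends' = Function.update ends i (.ofMain (main i.castSucc))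

/-- The main region `M_j` is the one that is used next. -/
structure Admissible (main : Fin 4 → Shelf) (ends : Fin 3 → EndBuffer) (j : Fin 4) : Prop where
  zero : ends 0 = .reserved → j = 0
  one : ends 1 = .reserved → j = 0 ∨ j = 1
  two : ends 2 = .reserved → j = 3 → 16 * (main 3).used ≤ 6
  isReserved : ∀ i : Fin 3, j = i.castSucc → ends i = .reserved

theorem EndBuffer.ofMain_ne_reserved (S : Shelf) : EndBuffer.ofMain S ≠ .reserved := by
  unfold EndBuffer.ofMain
  dsimp only
  split_ifs <;> simp

section
variable {σ : State} {w : ℝ} {V v₃ a₂ pay : ℝ}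

theorem MainLedger.fits_of_empty (h : MainLedger σ.main σ.ends V v₃ a₂ pay) (hw : w ≤ 1 / 4)
    {j : Fin 4} (hj : (σ.main j).used = 0) : (σ.main j).Fits w := by
  have hl := h.length j
  unfold Shelf.Fits
  rw [hj]
  have : 8 ≤ mainLength j := by fin_cases j <;> norm_num [mainLength]
  linarith

/-- At most one region is closed per request, because regions are entered in order: M_2 is empty
when M_1 closes, and M_3 is empty when M_2 closes. This is why a single advance `pay` suffices. -/
theorem findMain_cases (h : MainLedger σ.main σ.ends V v₃ a₂ pay) (hw : w ≤ 1 / 4) :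
    ∃ ends', ClosingStep σ.main σ.ends w ends' ∧
      ((∃ j, σ.findMain w = some ({ σ with ends := ends' }, j) ∧ (σ.main j).Fits w ∧
        Admissible σ.main ends' j) ∨
      (σ.findMain w = none ∧ (∀ i, ends' i ≠ .reserved) ∧ ¬ (σ.main 3).Fits w)) := by
  have hn := EndBuffer.ofMain_ne_reserved
  -- The choice between M_3 and M_4 is analysed for arbitrary ends `E`, since it is reached both
  -- with the old ends and right after M_2 has been closed.
  have upper : ∀ E : Fin 3 → EndBuffer, E 0 ≠ .reserved → E 1 ≠ .reserved →
      E 2 = σ.ends 2 →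
      (σ.ends 2 = .reserved → E = σ.ends ∨ (σ.main 2).used = 0 ∧ (σ.main 3).used = 0) →
      ∃ ends', (ends' = E ∨ E 2 = .reserved ∧ ¬ (σ.main 2).Fits w ∧
          ends' = Function.update E 2 (.ofMain (σ.main 2))) ∧
        ((∃ j, ({ σ with ends := E } : State).tryUpper w = some ({ σ with ends := ends' }, j) ∧
          (σ.main j).Fits w ∧ Admissible σ.main ends' j) ∨
        (({ σ with ends := E } : State).tryUpper w = none ∧ (∀ i, ends' i ≠ .reserved) ∧
          ¬ (σ.main 3).Fits w)) := by
    intro E h0 h1 h2 h3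
    by_cases hr : E 2 = .reserved
    · by_cases hp : 3 / 8 < (σ.main 3).used ∨ (σ.main 2).used ≤ (σ.main 3).used
      · by_cases hf : (σ.main 2).Fits w
        · refine ⟨E, .inl rfl, .inl ⟨2, ?_, hf, fun h => absurd h h0, fun h => absurd h h1,
            fun _ h => absurd h (by decide), fun i hi => ?_⟩⟩
          · simp [State.tryUpper, EndBuffer.isReserved_iff, hr, hp, hf]
          · have : i = 2 := by revert i; decide
            rw [this, hr]
        · refine ⟨Function.update E 2 (.ofMain (σ.main 2)), .inr ⟨hr, hf, rfl⟩, ?_⟩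
          by_cases hf3 : (σ.main 3).Fits w
          · refine .inl ⟨3, ?_, hf3, fun h => absurd h (by simpa using h0),
              fun h => absurd h (by simpa using h1), fun h => absurd h (by simpa using hn _),
              fun i hi => ?_⟩
            · simp only [State.tryUpper, EndBuffer.isReserved_iff, hr, hp, hf, State.closeMain,
                State.tryFourth, hf3, true_and, if_true, if_false]
              rfl
            · exact absurd hi (by fin_cases i <;> simp [Fin.ext_iff])
          · refine .inr ⟨?_, fun i => ?_, hf3⟩
            · simp only [State.tryUpper, EndBuffer.isReserved_iff, hr, hp, hf, State.closeMain,
                State.tryFourth, hf3, true_and, if_true, if_false]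
            · fin_cases i
              · simpa using h0
              · simpa using h1
              · simpa using hn _
      · push Not at hp
        have hu := h.length 3
        rw [mainLength_three] at hu
        -- At most 6 of the 14 units of M_4 are used, so a section of width at most 4 fits.
        have hf3 : (σ.main 3).Fits w := by
          unfold Shelf.Fits
          linarith
        refine ⟨E, .inl rfl, .inl ⟨3, ?_, hf3, fun h => absurd h h0, fun h => absurd h h1,
            fun _ _ => by linarith, fun i hi => ?_⟩⟩
        · have : ¬ (3 / 8 < (σ.main 3).used ∨ (σ.main 2).used ≤ (σ.main 3).used) := by
            push Not; exact hp
          simp only [State.tryUpper, EndBuffer.isReserved_iff, hr, this,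
                State.tryFourth, hf3, true_and, if_true, if_false]
        · exact absurd hi (by fin_cases i <;> simp [Fin.ext_iff])
    · refine ⟨E, .inl rfl, ?_⟩
      by_cases hf3 : (σ.main 3).Fits w
      · refine .inl ⟨3, ?_, hf3, fun h => absurd h h0,
          fun h => absurd h h1, fun h => absurd h hr, fun i hi => ?_⟩
        · simp only [State.tryUpper, EndBuffer.isReserved_iff, hr,
            State.tryFourth, hf3, false_and, if_true, if_false]
        · exact absurd hi (by fin_cases i <;> simp [Fin.ext_iff])
      · refine .inr ⟨?_, fun i => ?_, hf3⟩
        · simp only [State.tryUpper, EndBuffer.isReserved_iff, hr,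
            State.tryFourth, hf3, false_and, if_false]
        · fin_cases i
          · exact h0
          · exact h1
          · exact hr
  have hlt : ∀ i : Fin 3, ∀ j < i, σ.ends 0 ≠ .reserved → (i = 2 → σ.ends 1 ≠ .reserved) →
      σ.ends j ≠ .reserved := by
    intro i j hj h0 h1
    fin_cases i <;> fin_cases j <;> simp_all
  by_cases h0 : σ.ends 0 = .reserved
  · obtain ⟨hr1, hu1, hu2, hu3⟩ := h.order_zero h0
    by_cases hf : (σ.main 0).Fits w
    · refine ⟨σ.ends, .inl rfl, .inl ⟨0, ?_, hf, fun _ => rfl, fun _ => .inl rfl,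
        fun _ h => absurd h (by decide), fun i hi => ?_⟩⟩
      · simp [State.findMain, EndBuffer.isReserved_iff, h0, hf]
      · have : i = 0 := by revert i; decide
        rw [this, h0]
    · refine ⟨Function.update σ.ends 0 (.ofMain (σ.main 0)),
        .inr ⟨0, h0, fun j hj => absurd hj (Fin.not_lt_zero j), hf, rfl⟩, .inl ⟨1, ?_,
          h.fits_of_empty hw hu1, fun h => absurd h (by simpa using hn _), fun _ => .inr rfl,
          fun _ h => absurd h (by decide), fun i hi => ?_⟩⟩
      · simp [State.findMain, EndBuffer.isReserved_iff, h0, hf, State.closeMain, State.trySecond,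
          hr1, h.fits_of_empty hw hu1]
      · have : i = 1 := by revert i; decide
        rw [this]
        simpa using hr1
  have hfm : σ.findMain w = σ.trySecond w := by
    simp [State.findMain, EndBuffer.isReserved_iff, h0]
  rw [hfm]
  by_cases h1 : σ.ends 1 = .reserved
  · obtain ⟨hr2, hu2, hu3⟩ := h.order_one h1
    by_cases hf : (σ.main 1).Fits w
    · refine ⟨σ.ends, .inl rfl, .inl ⟨1, ?_, hf, fun h => absurd h h0, fun _ => .inr rfl,
        fun _ h => absurd h (by decide), fun i hi => ?_⟩⟩
      · simp [State.trySecond, EndBuffer.isReserved_iff, h1, hf]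
      · have : i = 1 := by revert i; decide
        rw [this, h1]
    · have hts : σ.trySecond w = ({ σ with
          ends := Function.update σ.ends 1 (.ofMain (σ.main 1)) } : State).tryUpper w := by
        simp [State.trySecond, EndBuffer.isReserved_iff, h1, hf, State.closeMain]
      rw [hts]
      obtain ⟨ends', hE, hres⟩ := upper (Function.update σ.ends 1 (.ofMain (σ.main 1)))
        (by simpa using h0) (by simpa using hn _) (by simp) fun _ => .inr ⟨hu2, hu3⟩
      refine ⟨ends', ?_, hres⟩
      rcases hE with rfl | ⟨-, hnf, -⟩
      · exact .inr ⟨1, h1, fun j hj => hlt 1 j hj h0 (by simp), hf, rfl⟩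
      · exact absurd (h.fits_of_empty hw hu2) hnf
  · have hts : σ.trySecond w = σ.tryUpper w := by
      simp [State.trySecond, EndBuffer.isReserved_iff, h1]
    rw [hts]
    obtain ⟨ends', hE, hres⟩ := upper σ.ends h0 h1 rfl fun _ => .inl rfl
    refine ⟨ends', ?_, hres⟩
    rcases hE with rfl | ⟨hr, hnf, rfl⟩
    · exact .inl rfl
    · exact .inr ⟨2, hr, fun j hj => hlt 2 j hj h0 fun _ => h1, hnf, rfl⟩

end

section
variable {main : Fin 4 → Shelf} {ends ends' : Fin 3 → EndBuffer} {w V v₃ a₂ : ℝ}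

theorem EndBuffer.ofMain_height (S : Shelf) :
    ∃ F : Shelf, F.height = S.length - max S.used (S.length - 1 / 8) ∧ F.length = S.height ∧
      F.used = 0 ∧ F.dir = .up ∧
      ((1 / 16 < max S.used (S.length - 1 / 8) - (S.length - 1 / 8) ∧ EndBuffer.ofMain S = .closed F) ∨
      (max S.used (S.length - 1 / 8) - (S.length - 1 / 8) ≤ 1 / 16 ∧
        EndBuffer.ofMain S = .active F 0)) := by
  unfold EndBuffer.ofMain
  rcases S with ⟨x, y, l, h, u, _ | _ | _⟩ <;>
  · dsimp only
    split_ifs with hc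
    · exact ⟨_, rfl, rfl, rfl, rfl, .inl ⟨hc, rfl⟩⟩
    · exact ⟨_, rfl, rfl, rfl, rfl, .inr ⟨not_lt.1 hc, rfl⟩⟩

/-- This explains the threshold 1/16. An end of free width y closed at once has only the credit
2(2-y), and 2(2-y) ≥ (7-y)/3 holds exactly for y ≤ 1. -/
theorem EndBuffer.ofMain_ledger {S : Shelf} {L : ℝ} (hL : 16 * S.length = L) (hh : S.height = 1 / 4)
    (hu : 16 * S.used ≤ L) : EndLedger L (16 * S.used) 0 0 (.ofMain S) := by
  obtain ⟨F, h1, h2, h3, hd, ⟨h4, h5⟩ | ⟨h4, h5⟩⟩ := ofMain_height S <;> rw [h5]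
  · have hm := le_max_left S.used (S.length - 1 / 8)
    have hm' : max S.used (S.length - 1 / 8) ≤ S.length := max_le (by linarith) (by linarith)
    refine ⟨by linarith, by linarith, hd, by linarith, le_rfl, by linarith, by linarith,
      fun _ => by norm_num⟩
  · have hm := le_max_left S.used (S.length - 1 / 8)
    have hm' := le_max_right S.used (S.length - 1 / 8)
    refine ⟨by norm_num, by linarith, by linarith, h3.ge, by rw [h3]; norm_num, by rw [h2, hh],
      hd, by linarith, le_rfl, by norm_num, by rw [h3]; norm_num⟩

/-- The last 2 units are not counted, so an object of width W = 16w that overflows wastes at most W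
- 2 of the counted length. `MainLedger.closingStep` books twice this amount as an advance, to be
repaid by the H_2-square. -/
theorem EndBuffer.reach_ofMain {S : Shelf} {L : ℝ} (hL : 16 * S.length = L) (hf : ¬ S.Fits w) :
    reach L S (.ofMain S) ≤ 16 * S.used + max 0 (16 * w - 2) := by
  unfold Shelf.Fits at hf
  have h0 := le_max_left 0 (16 * w - 2)
  have h0' := le_max_right 0 (16 * w - 2)
  have key : 16 * max S.used (S.length - 1 / 8) ≤ 16 * S.used + max 0 (16 * w - 2) := by
    rcases max_cases S.used (S.length - 1 / 8) with ⟨h, _⟩ | ⟨h, _⟩ <;> rw [h] <;> linarith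
  obtain ⟨F, h1, -, -, -, ⟨-, h5⟩ | ⟨-, h5⟩⟩ := ofMain_height S <;> rw [h5] <;>
    simp only [reach, h1] <;> linarith

theorem MainLedger.closingStep (h : MainLedger main ends V v₃ a₂ 0)
    (hc : ClosingStep main ends w ends') :
    MainLedger main ends' V v₃ a₂ (2 * max 0 (16 * w - 2)) := by
  have hn := EndBuffer.ofMain_ne_reserved
  have h0 := le_max_left 0 (16 * w - 2)
  have ha := h.area
  rcases hc with rfl | ⟨i, hi, hlt, hf, rfl⟩
  · exact { h with area := by linarith }
  · have hr := EndBuffer.reach_ofMain (h.length i.castSucc) hf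
    refine ⟨h.length, h.height, h.dir, h.used_nonneg, h.used_le, fun h' => ?_, fun h' => ?_,
      h.parts, fun h' => ?_, ?_⟩
    · fin_cases i
      · exact absurd h' (by simpa using hn _)
      · exact absurd (by simpa using h') (hlt 0 (by decide))
      · exact absurd (by simpa using h') (hlt 0 (by decide))
    · fin_cases i
      · have := h.order_one (by simpa using h')
        simpa using this
      · exact absurd h' (by simpa using hn _)
      · exact absurd (by simpa using h') (hlt 1 (by decide))
    · fin_cases i
      · exact h.last (by simpa using h')
      · exact h.last (by simpa using h')
      · exact absurd h' (by simpa using hn _)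
    · fin_cases i <;> simp [mainLength, reach] at hr hi ha ⊢ <;> rw [hi] at ha <;>
        simp only at ha ⊢ <;> linarith

/-- The new section splits as `2 * m + r` with m = 1, r = 0 for an H_3-shelf; the sections of
H_2-squares and of other vertical shelves go into `r`. -/
theorem MainLedger.allocate {pay V' v₃' a₂' : ℝ} {m : ℕ} {r : ℝ} {j : Fin 4}
    (h : MainLedger main ends V v₃ a₂ pay) (hw : 0 ≤ w) (hf : (main j).Fits w)
    (hj : Admissible main ends j)
    (ha : a₂ + 2 * V + pay + 2 * (16 * w) ≤ a₂' + 2 * V')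
    (hm : 16 * w = 2 * m + r) (hr : 0 ≤ r) (hv : v₃' = v₃ + 2 * m) (hVv : V' - v₃' ≤ V - v₃ + r)
    (hV : V' = V ∨ (16 * w ≤ 2 ∧ V' ≤ V + 16 * w)) :
    MainLedger (Function.update main j ((main j).advance w)) ends V' v₃' a₂' 0 := by
  have hVle := h.width_le
  have hu : ∀ i, (Function.update main j ((main j).advance w) i).used =
      (main i).used + if i = j then w else 0 := by
    intro i
    by_cases hi : i = j
    · subst hi; simp [Shelf.advance]
    · simp [hi]
  have hsame : ∀ i, (Function.update main j ((main j).advance w) i).length = (main i).length ∧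
      (Function.update main j ((main j).advance w) i).height = (main i).height ∧
      (Function.update main j ((main j).advance w) i).dir = (main i).dir := by
    intro i
    by_cases hi : i = j
    · subst hi; simp [Shelf.advance]
    · simp [hi]
  refine ⟨fun i => (hsame i).1 ▸ h.length i, fun i => (hsame i).2.1 ▸ h.height i,
    fun i => (hsame i).2.2 ▸ h.dir i, fun i => ?_, fun i => ?_, fun h0 => ?_, fun h1 => ?_, ?_,
    fun h2 => ?_, ?_⟩
  · rw [hu]
    have := h.used_nonneg i
    split_ifs <;> linarith
  · rw [hu]
    have h1 := h.used_le i
    have h2 := h.length i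
    unfold Shelf.Fits at hf
    split_ifs with hi
    · subst hi; linarith
    · linarith
  · obtain rfl := hj.zero h0
    simpa [hu] using h.order_zero h0
  · have := h.order_one h1
    rcases hj.one h1 with rfl | rfl <;> simpa [hu] using this
  · obtain ⟨M, R, p1, p2, p3, p4⟩ := h.parts
    refine ⟨fun i => M i + if i = j then m else 0, fun i => R i + if i = j then r else 0,
      fun i => ?_, fun i => ?_, ?_, ?_⟩
    · rw [hu]
      have := p1 i
      dsimp only
      split_ifs <;> push_cast <;> linarith
    · have := p2 i
      dsimp only
      split_ifs <;> linarith
    · push_cast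
      rw [Finset.sum_add_distrib, hv, p3]
      simp
      ring
    · rw [Finset.sum_add_distrib]
      simp
      linarith
  -- While M_3 is open, M_4 is chosen only if at most 6 of it is used, so a vertical shelf there
  -- ends within the first 6 + 2 = 8 units. H_2-squares may reach further but do not count in V.
  · have hl := h.last h2
    have h6 := hj.two h2
    simp only [hu]
    rcases hV with rfl | ⟨hw2, hV⟩
    · split_ifs <;> linarith
    · fin_cases j
      · simp; linarith
      · simp; linarith
      · simp; linarith
      · have := h6 rfl
        simp; linarith
  · have hA := h.area
    have hr : ∀ (L : ℝ) (i : Fin 3), reach L (Function.update main j ((main j).advance w) i.castSucc)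
        (ends i) = reach L (main i.castSucc) (ends i) + 16 * if i.castSucc = j then w else 0 := by
      intro L i
      by_cases hi : i.castSucc = j
      · rw [hj.isReserved i hi.symm]
        simp only [reach, hu]
        ring
      · simp [hi]
    have hr0 := hr 16 0
    have hr1 := hr 8 1
    have hr2 := hr 12 2
    simp only [Fin.castSucc_zero, show Fin.castSucc (1 : Fin 3) = 1 from rfl,
      show Fin.castSucc (2 : Fin 3) = 2 from rfl] at hr0 hr1 hr2
    rw [hr0, hr1, hr2, hu]
    fin_cases j <;> simp <;> linarith

end

section
variable {σ : State} {w V v₃ a₂ V' v₃' a₂' I₃ B Q S A : ℝ} {opened : Prop} {e t : Fin 3 → ℝ}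

theorem Balance.closingStep {ends' : Fin 3 → EndBuffer} {main : Fin 4 → Shelf}
    {ends : Fin 3 → EndBuffer} (h : Balance main ends I₃ opened B Q S e t)
    (hM : MainLedger main ends V v₃ a₂ 0) (hS : S ≤ V / 2)
    (hc : ClosingStep main ends w ends') : Balance main ends' I₃ opened B Q S e t := by
  rcases hc with rfl | ⟨i, hi, hlt, hf, rfl⟩
  · exact h
  · exact h.close hM hS hi (EndBuffer.ofMain_ledger (hM.length _) (hM.height _) (hM.used_le _))

/-- If the total area is small enough, then the main regions can take a section of width `w`. -/
theorem takeMain_eq_some {m : ℕ} {r : ℝ}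
    (hM : MainLedger σ.main σ.ends V v₃ a₂ 0) (h : Balance σ.main σ.ends I₃ opened B Q S e t)
    (hS : S ≤ V / 2) (hw0 : 0 ≤ w) (hw : w ≤ 1 / 4)
    (ha : a₂ + 2 * V + 2 * max 0 (16 * w - 2) + 2 * (16 * w) ≤ a₂' + 2 * V')
    (hm : 16 * w = 2 * m + r) (hr : 0 ≤ r) (hv : v₃' = v₃ + 2 * m) (hVv : V' - v₃' ≤ V - v₃ + r)
    (hV : V' = V ∨ (16 * w ≤ 2 ∧ V' ≤ V + 16 * w))
    (hA : 2 * V' + Q + max 0 (I₃ - 3) ≤ A)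
    (hA' : opened → 2 * V' + Q + max 0 (I₃ - 3) + S ≤ A + v₃' / 2 - 1 + (V' - v₃') / 3 ∨
      2 * V' + Q + max 0 (I₃ - 3) + S ≤ A + V' / 2 - 3 / 2)
    (htot : a₂' + A ≤ 88) :
    ∃ ends' j, ClosingStep σ.main σ.ends w ends' ∧ (σ.main j).Fits w ∧
      Admissible σ.main ends' j ∧
      σ.takeMain w = some ({ σ with
        ends := ends', main := Function.update σ.main j ((σ.main j).advance w) }, σ.main j) ∧
      MainLedger (Function.update σ.main j ((σ.main j).advance w)) ends' V' v₃' a₂' 0 ∧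
      Balance (Function.update σ.main j ((σ.main j).advance w)) ends' I₃ opened B Q S e t := by
  obtain ⟨ends', hc, hres⟩ := findMain_cases hM hw
  have hM' := hM.closingStep hc
  have h' := h.closingStep hM hS hc
  rcases hres with ⟨j, hj, hf, hadm⟩ | ⟨-, hne, hf⟩
  · refine ⟨ends', j, hc, hf, hadm, by simp [State.takeMain, hj],
      hM'.allocate hw0 hf hadm ha hm hr hv hVv hV, h'.mono (fun i => ?_) (fun i hi => ?_) le_rfl id⟩
    · by_cases hi : i = j
      · subst hi; simp [Shelf.advance, hw0]
      · simp [hi]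
    · by_cases hij : i.castSucc = j
      · exact absurd (hadm.isReserved i hij.symm) hi
      · simp [hij]
  · have h3 := hM.length 3
    rw [mainLength_three] at h3
    unfold Shelf.Fits at hf
    have := h'.overflow rfl hM' hne (w := 16 * w) (by linarith) ha hm hr hv hVv hA hA'
    linarith

end

/-- The measures of a perpendicular slice. -/
theorem Shelf.slice_measures {S : Shelf} {w : ℝ} : (S.slice w).length = S.height ∧
    (S.slice w).height = w ∧ (S.slice w).used = 0 := by
  unfold Shelf.slice
  cases S.dir <;> simp

/-! ### Allocation in the buffer regions -/

/-- The extent of a buffer packing in units of `1/16`. -/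
theorem bufExtent_three (x : ℝ) : State.bufExtent 3 x = x := rfl

theorem bufExtent_of_four_le {k : ℕ} (hk : 4 ≤ k) (x : ℝ) : State.bufExtent k x = classWidth k :=
  if_neg (by omega)

/-- The credit in the ledger of the regions `B_1, …, B_4`. -/
noncomputable def bufCredit (k : ℕ) (x : ℝ) : ℝ := if k = 3 then (16 * x) ^ 2 else unitWidth k

section
variable {k : ℕ} {x : ℝ}

/-- The last bound makes the change of buffer region cost at most 1; for H_3 it is (X-1)² ≥ 0. -/
theorem bufExtent_bounds (hk : 3 ≤ k) (hx : IsClass k x) :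
    0 < 16 * State.bufExtent k x ∧ 16 * State.bufExtent k x ≤ 2 ∧
      16 * State.bufExtent k x ≤ bufCredit k x ∧
      2 * (16 * State.bufExtent k x) - 1 ≤ bufCredit k x := by
  rcases hk.eq_or_lt with rfl | hk
  · obtain ⟨h1, h2⟩ := hx
    rw [unitWidth_three] at h1 h2
    rw [bufExtent_three, bufCredit, if_pos rfl]
    exact ⟨by linarith, by linarith, by nlinarith, by nlinarith [sq_nonneg (16 * x - 1)]⟩
  · have hw := unitWidth_pos k
    have h1 := unitWidth_le_one hk
    rw [bufExtent_of_four_le hk, bufCredit, if_neg (by omega)]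
    change 0 < unitWidth k ∧ unitWidth k ≤ 2 ∧ unitWidth k ≤ unitWidth k ∧ _
    refine ⟨hw, by linarith, le_rfl, ?_⟩
    change 2 * unitWidth k - 1 ≤ unitWidth k
    linarith

end

section
variable {buf : Fin 4 → Shelf} {act : Fin 4} {B w c : ℝ}

theorem BufferLedger.mono {B' : ℝ} (h : BufferLedger buf act B) (hB : B ≤ B') :
    BufferLedger buf act B' :=
  { h with
    sum_le := h.sum_le.trans hB
    act_le := h.act_le.trans hB }

/-- An allocation in `B_j`, after which `B_{act'}` is active. -/
theorem BufferLedger.allocate (h : BufferLedger buf act B) {act' j : Fin 4} (hw : 0 < w)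
    (hf : (buf j).Fits w) (hj : j ≤ act') (ha : act ≤ act') (h0 : act' ≠ 0 → (buf 0).used ≠ 0)
    (hc : 16 * w ≤ c)
    (hact : ![0, 3, 6, 13] act' + 16 * (buf act').used + (if act' = j then 16 * w else 0) ≤ B + c) :
    BufferLedger (Function.update buf j ((buf j).advance w)) act' (B + c) := by
  have hu : ∀ i, (Function.update buf j ((buf j).advance w) i).used =
      (buf i).used + if i = j then w else 0 := by
    intro i
    by_cases hi : i = j
    · subst hi; simp [Shelf.advance]
    · simp [hi]
  have hsame : ∀ i, (Function.update buf j ((buf j).advance w) i).length = (buf i).length ∧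
      (Function.update buf j ((buf j).advance w) i).height = (buf i).height := by
    intro i
    by_cases hi : i = j
    · subst hi; simp [Shelf.advance]
    · simp [hi]
  refine ⟨fun i => (hsame i).2 ▸ h.height i, fun i => ?_, fun i => ?_,
    (hsame 0).1 ▸ h.length_zero, (hsame 1).1 ▸ h.length_one, (hsame 2).1 ▸ h.length_two,
    (hsame 3).1 ▸ h.length_three, fun i hi => ?_, fun h0' => ?_, ?_, ?_⟩
  · rw [hu]
    have := h.used_nonneg i
    split_ifs <;> linarith
  · rw [hu, (hsame i).1]
    unfold Shelf.Fits at hf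
    have := h.used_le i
    split_ifs with hi
    · subst hi; exact hf
    · linarith
  · rw [hu, h.later i (ha.trans_lt hi), if_neg (by rintro rfl; exact absurd hj (not_le.2 hi))]
    norm_num
  · rw [hu]
    have h1 := h0 h0'
    have h2 := h.used_nonneg 0
    have h3 : 0 < (buf 0).used := lt_of_le_of_ne h2 (Ne.symm h1)
    split_ifs <;> linarith
  · simp only [hu]
    rw [Finset.sum_add_distrib]
    have := h.sum_le
    simp
    linarith
  · rw [hu]
    split_ifs at hact ⊢ <;> linarith

/-- The next buffer region is activated. -/
theorem BufferLedger.allocate_next (h : BufferLedger buf act B) (hact : act < 3) (hw : 0 < w)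
    (hw2 : 16 * w ≤ 2)
    (hf : ¬ (buf act).Fits w) (hc : 16 * w ≤ c) (hc' : 2 * (16 * w) - 1 ≤ c) :
    (buf (act + 1)).Fits w ∧ BufferLedger
      (Function.update buf (act + 1) ((buf (act + 1)).advance w)) (act + 1) (B + c) := by
  have hlt : act < act + 1 := (by decide : ∀ a : Fin 4, a < 3 → a < a + 1) act hact
  have hz := h.later _ hlt
  have hl : 4 ≤ 16 * (buf (act + 1)).length := by
    have h1 := h.length_one
    have h2 := h.length_two
    have h3 := h.length_three
    have : act = 0 ∨ act = 1 ∨ act = 2 := by omega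
    rcases this with rfl | rfl | rfl
    · exact h1.ge
    · change 4 ≤ 16 * (buf 2).length; linarith
    · exact h3.ge
  have hf' : (buf (act + 1)).Fits w := by
    unfold Shelf.Fits
    rw [hz]; linarith
  refine ⟨hf', h.allocate hw hf' le_rfl hlt.le (fun _ h0 => ?_) hc ?_⟩
  · by_cases ha : act = 0
    · subst ha
      have := h.length_zero
      unfold Shelf.Fits at hf
      rw [h0] at hf
      linarith
    · exact h.first ha h0
  -- The square overflows a region of length l, so the used part exceeds l - w; since the credit is
  -- at least 2w - 1, the offset grows by l - 1. This turns the lengths 4, 4, 8 into the offsets 3,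
  -- 6, 13.
  · rw [hz, if_pos rfl]
    have ha := h.act_le
    unfold Shelf.Fits at hf
    have h0 := h.length_zero
    have h1 := h.length_one
    have h2 := h.length_two
    have : act = 0 ∨ act = 1 ∨ act = 2 := by omega
    rcases this with rfl | rfl | rfl
    · simp at ha ⊢; linarith
    · change (6 : ℝ) + _ + _ ≤ _
      change (3 : ℝ) + _ ≤ _ at ha
      linarith
    · change (13 : ℝ) + _ + _ ≤ _
      change (6 : ℝ) + _ ≤ _ at ha
      linarith

end

/-! ### Packing into an end buffer -/

section
variable {L U e t : ℝ} {F : Shelf} {n : ℕ} {x : ℝ}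

/-- A square with X > y packed into V changes the balance by X² - X - 1 and is charged 1. After two
misses the two requirements on a closed end reduce to 2(y-1)² ≥ 0 and (6y-5)(y-1) ≥ 0, which hold as
y ≥ 1. -/
theorem EndLedger.miss (h : EndLedger L U e t (.active F n)) (hx : F.height < x)
    {E : EndBuffer} (hE : E = if 2 ≤ n + 1 then .closed F else .active F (n + 1)) :
    EndLedger L U (e + ((16 * x) ^ 2 - 16 * x - 1)) (t + 1) E := by
  obtain ⟨h1, h2, h3, h4, h5, h6, h6', h7, h8, h9, h10⟩ := h
  have hy : 16 * F.height < 16 * x := by linarith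
  have hu : 0 ≤ 16 * F.used * (16 * F.height / 2 - 1 / 16) :=
    mul_nonneg (by linarith) (by linarith)
  generalize 16 * x = X at *
  interval_cases n
  · rw [if_neg (by norm_num)] at hE
    subst hE
    refine ⟨by norm_num, h2, h3, h4, h5, h6, h6', h7, by linarith, ?_, ?_⟩
    · norm_num at h9 ⊢; nlinarith
    · norm_num at h10 ⊢; nlinarith
  · rw [if_pos (by norm_num)] at hE
    subst hE
    norm_num at h9 h10
    refine ⟨by linarith, h3, h6', h7, by linarith, ?_, ?_, fun h => absurd h (by linarith)⟩
    · nlinarith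
    · nlinarith

/-- The yield y/2 - 1/16 per unit of length is that of an H_4-subshelf: credit y/2 - 9/16 plus
charge 1/2. At the closing length 2 this gives y - 1/8, more than a closed end has to supply. -/
theorem EndLedger.use (h : EndLedger L U e t (.active F n)) {w d c : ℝ} (hw : 0 < 16 * w)
    (hd : 0 ≤ d) (hc : 0 ≤ c) (hcd : 16 * w * (16 * F.height / 2 - 1 / 16) ≤ d + c)
    {E : EndBuffer}
    (hE : E = if 1 / 8 ≤ (F.advance w).used then .closed (F.advance w)
      else .active (F.advance w) n) :
    EndLedger L U (e + d) (t + c) E := by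
  obtain ⟨h1, h2, h3, h4, h5, h6, h6', h7, h8, h9, h10⟩ := h
  have hn0 : (0 : ℝ) ≤ n := n.cast_nonneg
  have hn1 : (n : ℝ) ≤ 1 := by exact_mod_cast h1
  split_ifs at hE with hc <;> subst hE <;> simp only [Shelf.advance] at hc
  · have hu : 2 * (16 * F.height / 2 - 1 / 16) ≤
        (16 * F.used + 16 * w) * (16 * F.height / 2 - 1 / 16) :=
      mul_le_mul_of_nonneg_right (by linarith) (by linarith)
    refine ⟨by simp only [Shelf.advance]; linarith, h3, h6', h7, by linarith, ?_, ?_,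
      fun h => absurd h (by simp only [Shelf.advance]; linarith)⟩ <;>
    simp only [Shelf.advance] <;> generalize 16 * F.height = y at *
    -- The lower bound for the credit interpolates between 4 - 2y for n = 0 and y² - 3y + 3 for n =
    -- 1.
    · nlinarith [mul_nonneg (sub_nonneg.2 hn1) (by linarith : (0 : ℝ) ≤ 4 - 2 * y),
        mul_nonneg hn0 (by nlinarith [sq_nonneg (y - 3 / 2)] : (0 : ℝ) ≤ y ^ 2 - 3 * y + 3)]
    · have : 0 ≤ n * (y * (y - 1)) := mul_nonneg hn0 (mul_nonneg (by linarith) (by linarith))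
      linarith
  · exact ⟨h1, h2, h3, by simp only [Shelf.advance]; linarith, by simp only [Shelf.advance]; linarith,
      h6, h6', h7, by linarith, by simp only [Shelf.advance]; linarith,
      by simp only [Shelf.advance]; linarith⟩

end

section
variable {main : Fin 4 → Shelf} {ends : Fin 3 → EndBuffer} {V v₃ a₂ pay : ℝ} {F G : Shelf} {n m : ℕ}
  {i : Fin 3} {E : EndBuffer}

/-- Two states of an end buffer that differ only in the buffer packing. -/
def EndBuffer.SameHost (E E' : EndBuffer) : Prop :=
  E ≠ .reserved ∧ E' ≠ .reserved ∧ ∀ (L : ℝ) (S : Shelf), reach L S E = reach L S E'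

theorem MainLedger.useEnd (h : MainLedger main ends V v₃ a₂ pay)
    (hE : (ends i).SameHost E) :
    MainLedger main (Function.update ends i E) V v₃ a₂ pay := by
  obtain ⟨h1, h2, h3⟩ := hE
  have hr : ∀ j, Function.update ends i E j = .reserved ↔ ends j = .reserved := by
    intro j
    by_cases hj : j = i
    · subst hj; simp [h1, h2]
    · simp [hj]
  have hreach : ∀ (L : ℝ) (S : Shelf) j, reach L S (Function.update ends i E j) =
      reach L S (ends j) := by
    intro L S j
    by_cases hj : j = i
    · subst hj; simp [h3]
    · simp [hj]
  refine ⟨h.length, h.height, h.dir, h.used_nonneg, h.used_le, ?_, ?_, h.parts, ?_, ?_⟩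
  · simpa only [hr] using h.order_zero
  · simpa only [hr] using h.order_one
  · simpa only [hr] using h.last
  · simpa only [hreach] using h.area

/-- The ledger of a closed end no longer refers to its used section, so late subshelves can be cut
from it without any booking. -/
theorem Balance.advanceClosed {I₃ B Q S : ℝ} {opened : Prop} {e t : Fin 3 → ℝ}
    (h : Balance main ends I₃ opened B Q S e t) (hi : ends i = .closed F) (w : ℝ) :
    Balance main (Function.update ends i (.closed (F.advance w))) I₃ opened B Q S e t := by
  have hcr : ∀ j, (Function.update ends i (.closed (F.advance w)) j).credit (e j) =
      (ends j).credit (e j) := by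
    intro j
    by_cases hj : j = i
    · subst hj; rw [hi]; simp [EndBuffer.credit, Shelf.advance]
    · simp [hj]
  have hcl : ∀ j, (Function.update ends i (.closed (F.advance w)) j).isClosed =
      (ends j).isClosed := by
    intro j
    by_cases hj : j = i
    · subst hj; rw [hi]; simp [EndBuffer.isClosed]
    · simp [hj]
  refine ⟨fun j => ?_, h.supply, h.supply_unopened, ?_⟩
  · have := h.endLedger j
    by_cases hj : j = i
    · subst hj
      rw [hi] at this
      rw [Function.update_self]
      exact this
    · simpa [hj] using this
  · simp only [hcr, hcl]
    refine h.surplus.imp id fun ⟨h1, h2, h3, h4, h5⟩ => ⟨h1, h2, h3, h4, fun G n hG => ?_⟩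
    by_cases hj : (2 : Fin 3) = i
    · subst hj; simp at hG
    · exact h5 G n (by simpa [hj] using hG)

end

/-! ### The accounts of a state -/

/-- The length of the initial `H_3`-packing in units of `1/16`. -/
noncomputable def initialLength (I : ℕ → Option Shelf) : ℝ := 16 * (I 3).elim 0 Shelf.used

/-- The ledgers after squares of total area `A` (in units of `1/256`) have been packed. -/
structure Accounts (N : ℕ) (σ : State) (A : ℝ) (a v q s : ℕ → ℝ) (a₂ B : ℝ) (e t : Fin 3 → ℝ) :
    Prop where
  classes : Classes N σ.initial σ.vertical (max 0 (initialLength σ.initial - 3)) a v q s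
  width : total N v = 16 * σ.vertWidth
  area : a₂ + total N a = A
  main : MainLedger σ.main σ.ends (16 * σ.vertWidth) (v 3) a₂ 0
  buffer : BufferLedger σ.buf σ.activeBuf B
  balance : Balance σ.main σ.ends (initialLength σ.initial) (σ.vertical 3 ≠ none) B
    (total N q) (total N s) e t
  initial : ∃ u, σ.initial 3 = some ⟨0, 1 / 4, 1 / 4, 1 / 8, u, .right⟩

namespace Accounts
variable {N : ℕ} {σ : State} {A : ℝ} {a v q s : ℕ → ℝ} {a₂ B : ℝ} {e t : Fin 3 → ℝ}
  {k : ℕ} {x : ℝ}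

theorem charge_le (h : Accounts N σ A a v q s a₂ B e t) :
    total N s ≤ 16 * σ.vertWidth / 2 :=
  h.width ▸ h.classes.charge_le

/-- The data of a buffer operation for a vertical `H_k`-shelf that changes the balance by `δ`. -/
structure BufferStep (N : ℕ) (σ τ : State) (k : ℕ) (v q s : ℕ → ℝ) (a₂ B δ : ℝ)
    (e t : Fin 3 → ℝ) : Prop where
  eq : τ = { σ with ends := τ.ends, buf := τ.buf, activeBuf := τ.activeBuf }
  main : MainLedger σ.main τ.ends (16 * σ.vertWidth) (v 3) a₂ 0
  buffer : BufferLedger τ.buf τ.activeBuf B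
  balance : Balance σ.main τ.ends (initialLength σ.initial) (σ.vertical 3 ≠ none) B
    (total N q + δ) (total N s + rate k * unitWidth k) e t

theorem takeBuffer_cases (σ : State) (k : ℕ) (x : ℝ) :
    (∃ i F n, σ.ends i = .active F n ∧ σ.takeBuffer k x = σ.takeEnd i F n k x) ∨
    ((∀ i F n, σ.ends i ≠ .active F n) ∧ σ.takeBuffer k x = σ.takeB k x) := by
  unfold State.takeBuffer
  rcases h0 : σ.ends 0 with _ | ⟨F, n⟩ | F
  case active => exact .inl ⟨0, F, n, h0, by simp⟩
  all_goals
    rcases h1 : σ.ends 1 with _ | ⟨F, n⟩ | F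
    case active => exact .inl ⟨1, F, n, h1, by simp⟩
    all_goals
      rcases h2 : σ.ends 2 with _ | ⟨F, n⟩ | F
      case active => exact .inl ⟨2, F, n, h2, by simp⟩
      all_goals
        refine .inr ⟨fun i => ?_, by simp⟩
        fin_cases i <;> simp [h0, h1, h2]

/-- The credit of a buffer packing in `B`. -/
noncomputable def bufGain (k : ℕ) (x : ℝ) : ℝ :=
  if k = 3 then (16 * x) ^ 2 - 1 else
    if k = 4 then 1 / 2 else max 0 (unitWidth k - 9 * unitWidth k ^ 2 / 16)

/-- These bounds determine the rates. For H_4 the gain 1/2 equals both 1 - 1/2 and 3/4 - 1/4. For k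
≥ 5 the rate 1/3 is admissible because w ≤ 1/2 gives 9w²/16 ≤ w/3. -/
theorem bufGain_bounds (hk : 3 ≤ k) (hx : IsClass k x) :
    0 ≤ bufGain k x ∧ bufCredit k x - rate k * unitWidth k ≤ bufGain k x ∧
      (k ≠ 3 → 3 / 4 * bufCredit k x - rate k * unitWidth k / 2 ≤ bufGain k x) := by
  unfold bufGain bufCredit
  obtain ⟨h1, h2⟩ := hx
  split_ifs with h3 h4
  · subst h3
    rw [unitWidth_three] at *
    rw [rate_three]
    exact ⟨by nlinarith, by linarith, fun h => absurd rfl h⟩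
  · subst h4
    rw [unitWidth_four, rate_four]
    norm_num
  · have h5 : 5 ≤ k := by omega
    have hw := unitWidth_pos k
    have hw2 := unitWidth_le_half h5
    have := le_max_right 0 (unitWidth k - 9 * unitWidth k ^ 2 / 16)
    rw [rate_of_five_le h5]
    exact ⟨le_max_left _ _, by nlinarith, fun _ => by nlinarith⟩

/-- The loss of a vertical shelf is at most its charge. -/
theorem loss_bounds (hk : 3 ≤ k) : unitWidth k ^ 2 / 4 ≤ rate k * unitWidth k ∧
    (k ≠ 3 → unitWidth k ^ 2 / 4 ≤ rate k * unitWidth k / 2) := by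
  have hw := unitWidth_pos k
  rcases hk.eq_or_lt with rfl | hk
  · rw [unitWidth_three, rate_three]; norm_num
  rcases (show 4 ≤ k from hk).eq_or_lt with rfl | hk
  · rw [unitWidth_four, rate_four]; norm_num
  · have h2 := unitWidth_le_half hk
    rw [rate_of_five_le hk]
    exact ⟨by nlinarith, fun _ => by nlinarith⟩

variable {N : ℕ} {σ τ : State} {A : ℝ} {a v q s : ℕ → ℝ} {a₂ B : ℝ} {e t : Fin 3 → ℝ}
  {k : ℕ} {x : ℝ} {S : Shelf}

/-- The credit of a buffer packing in the end buffer `F`. -/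
noncomputable def endGain (k : ℕ) (x : ℝ) (F : Shelf) : ℝ :=
  if k = 3 then (16 * x) ^ 2 - 1 else
    max 0 (16 * F.height * unitWidth k / 2 - 9 * unitWidth k ^ 2 / 16)

/-- The change of the balance if a vertical shelf gets no buffer packing. -/
noncomputable def unbufferedGain (k : ℕ) (x : ℝ) : ℝ :=
  -(unitWidth k ^ 2 / 4) + ((16 * x) ^ 2 - unitWidth k / 2 * (16 * x))

theorem takeEnd_step (h : Accounts N σ A a v q s a₂ B e t) (hk : 3 ≤ k) (hx : IsClass k x)
    {i : Fin 3} {F : Shelf} {n : ℕ} (hi : σ.ends i = .active F n) :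
    ((∃ τ e' t', σ.takeEnd i F n k x = (τ, none) ∧
        BufferStep N σ τ k v q s a₂ B (unbufferedGain k x) e' t') ∨
      ∃ τ e' t', σ.takeEnd i F n k x = (τ, some F) ∧ (k = 3 → x ≤ F.height) ∧
        BufferStep N σ τ k v q s a₂ B (endGain k x F) e' t') := by
  have hw := unitWidth_pos k
  have hw2 := unitWidth_le_two hk
  have hL := h.balance.endLedger i
  rw [hi] at hL
  by_cases hc : k = 3 ∧ F.height < x
  · left
    obtain ⟨rfl, hFx⟩ := hc
    have hL' := hL.miss hFx rfl
    have hL'' := h.balance.useEnd hi (Q' := total N q + unbufferedGain 3 x)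
      (S' := total N s + rate 3 * unitWidth 3) (E := if 2 ≤ n + 1 then .closed F
        else .active F (n + 1)) (by
        convert hL' using 1
        · rw [unbufferedGain, unitWidth_three]; ring
        · rw [rate_three, unitWidth_three]; ring)
    refine ⟨{ σ with ends := Function.update σ.ends i (if 2 ≤ n + 1 then .closed F
        else .active F (n + 1)) }, _, _, by simp only [State.takeEnd, hFx, and_self, if_true], rfl,
      h.main.useEnd ?_, h.buffer, hL''⟩
    rw [hi]
    split_ifs <;> exact ⟨by simp, by simp, fun _ _ => rfl⟩
  · right
    obtain ⟨hb1, hb2, hb3, hb4⟩ := bufExtent_bounds hk hx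
    have hg : 0 ≤ endGain k x F ∧ 16 * State.bufExtent k x * (16 * F.height / 2 - 1 / 16) ≤
        endGain k x F + rate k * unitWidth k := by
      have hF1 := hL.2.1
      have hF2 := hL.2.2.1
      unfold endGain
      split_ifs with h3
      · subst h3
        obtain ⟨h1, h2⟩ := hx
        rw [unitWidth_three] at *
        rw [rate_three, bufExtent_three]
        exact ⟨by nlinarith, by nlinarith⟩
      · have h4 : 4 ≤ k := by omega
        have h1 := unitWidth_le_one h4
        have hm := le_max_right 0 (16 * F.height * unitWidth k / 2 - 9 * unitWidth k ^ 2 / 16)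
        refine ⟨le_max_left _ _, ?_⟩
        rw [bufExtent_of_four_le h4]
        change unitWidth k * _ ≤ _
        rcases h4.eq_or_lt with rfl | h5
        · rw [unitWidth_four] at *
          rw [rate_four]; linarith
        · have := unitWidth_le_half h5
          rw [rate_of_five_le h5]; nlinarith
    have hL' := hL.use (w := State.bufExtent k x) (d := endGain k x F)
      (c := rate k * unitWidth k) hb1 hg.1 (mul_nonneg (by linarith [third_le_rate k]) hw.le) hg.2 rfl
    have hL'' := h.balance.useEnd hi (Q' := total N q + endGain k x F)
      (S' := total N s + rate k * unitWidth k)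
      (E := if 1 / 8 ≤ (F.advance (State.bufExtent k x)).used then
        .closed (F.advance (State.bufExtent k x))
        else .active (F.advance (State.bufExtent k x)) n) (by
        convert hL' using 1 <;> ring)
    refine ⟨{ σ with ends := Function.update σ.ends i (if
          1 / 8 ≤ (F.advance (State.bufExtent k x)).used then
          .closed (F.advance (State.bufExtent k x))
        else .active (F.advance (State.bufExtent k x)) n) }, _, _,
      by simp only [State.takeEnd, hc, if_false],
      fun h3 => by by_contra hh; exact hc ⟨h3, not_le.1 hh⟩, rfl,
      h.main.useEnd ?_, h.buffer, hL''⟩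
    rw [hi]
    split_ifs <;> exact ⟨by simp, by simp, fun _ _ => rfl⟩

theorem takeB_step (h : Accounts N σ A a v q s a₂ B e t) (hk : 3 ≤ k)
    (hx : IsClass k x) (hV : σ.vertical k ≠ none)
    (hS : total N s + rate k * unitWidth k ≤ 16 * σ.vertWidth / 2)
    (hna : ∀ i F n, σ.ends i ≠ .active F n) :
    ((∃ τ B', σ.takeB k x = (τ, none) ∧
        BufferStep N σ τ k v q s a₂ B' (unbufferedGain k x) e t) ∨
      ∃ τ S B' δ, σ.takeB k x = (τ, some S) ∧
        BufferStep N σ τ k v q s a₂ B' δ e t ∧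
        ((S.height = 1 / 8 ∧ δ = bufGain k x) ∨ (4 ≤ k ∧ δ = 0 ∧ classWidth k ≤ S.height ∧
          16 * S.height ≤ 2))) := by
  have hw := unitWidth_pos k
  have hw2 := unitWidth_le_two hk
  obtain ⟨hb1, hb2, hb3, hb4⟩ := bufExtent_bounds hk hx
  obtain ⟨hg1, hg2, hg3⟩ := bufGain_bounds hk hx
  obtain ⟨hl1, hl2⟩ := loss_bounds hk
  have hop : ¬ σ.vertical 3 ≠ none → k ≠ 3 := by rintro h3 rfl; exact h3 hV
  have hBal : Balance σ.main σ.ends (initialLength σ.initial) (σ.vertical 3 ≠ none)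
      (B + bufCredit k x) (total N q + bufGain k x) (total N s + rate k * unitWidth k) e t := by
    refine h.balance.buffer hna (by linarith) (by linarith) (by linarith) fun h' => ?_
    linarith [hg3 (hop h')]
  have hh : ∀ j, (σ.buf j).height = 1 / 8 := fun j => by linarith [h.buffer.height j]
  have hnr : ∀ B', B ≤ B' → 16 ≤ B' →
      B' - B ≤ (16 * x) ^ 2 - unitWidth k / 2 * (16 * x) →
      Balance σ.main σ.ends (initialLength σ.initial) (σ.vertical 3 ≠ none)
      B' (total N q + unbufferedGain k x) (total N s + rate k * unitWidth k) e t := by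
    intro B' h1 h2 h3
    have := h.balance.noRoom h.main (B' := B') hna h1 hS h2 hl1 h3 fun h' => hl2 (hop h')
    convert this using 1
    unfold unbufferedGain
    ring
  unfold State.takeB
  dsimp only
  by_cases hf : (σ.buf σ.activeBuf).Fits (State.bufExtent k x)
  · rw [if_pos hf]
    refine .inr ⟨_, _, _, _, rfl, ⟨rfl, h.main, ?_, hBal⟩, .inl ⟨hh _, rfl⟩⟩
    refine h.buffer.allocate (by linarith) hf le_rfl le_rfl h.buffer.first hb3 ?_
    rw [if_pos rfl]
    linarith [h.buffer.act_le]
  rw [if_neg hf]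
  by_cases hact : σ.activeBuf < 3
  · obtain ⟨hf', hB'⟩ := h.buffer.allocate_next hact (by linarith) hb2 hf hb3 hb4
    have hj : (![1, 2, 3, 3] σ.activeBuf : Fin 4) = σ.activeBuf + 1 := by
      have : ∀ i : Fin 4, i < 3 → (![1, 2, 3, 3] i : Fin 4) = i + 1 := by decide
      exact this _ hact
    rw [hj, if_pos hf']
    exact .inr ⟨_, _, _, _, rfl, ⟨rfl, h.main, hB', hBal⟩, .inl ⟨hh _, rfl⟩⟩
  · have h3 : σ.activeBuf = 3 := by omega
    have hj : (![1, 2, 3, 3] σ.activeBuf : Fin 4) = 3 := by rw [h3]; rfl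
    have hσ : ({ σ with activeBuf := 3 } : State) = σ := by rw [← h3]
    rw [hj]
    rw [h3] at hf
    rw [if_neg hf, hσ]
    have hle := h.buffer.act_le
    rw [h3] at hle
    change (13 : ℝ) + _ ≤ _ at hle
    have hlen := h.buffer.length_three
    unfold Shelf.Fits at hf
    split_ifs with hk3
    · left
      subst hk3
      rw [bufExtent_three] at hf
      rw [unitWidth_three] at *
      obtain ⟨h1, h2⟩ := hx
      rw [unitWidth_three] at *
      -- The gain of packing the square into V is added to B. As B > 13 + 4 - X, the new value
      -- exceeds 16 + (X-1)² ≥ 16.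
      refine ⟨_, B + ((16 * x) ^ 2 - 16 * x), rfl, rfl, h.main,
        h.buffer.mono (by nlinarith), ?_⟩
      rw [unitWidth_three]
      refine hnr _ (by nlinarith) (by nlinarith [sq_nonneg (16 * x - 1)]) (by linarith)
    · have h4 : 4 ≤ k := by omega
      rw [bufExtent_of_four_le h4] at hf hb1 hb3 ⊢
      unfold State.takeAnyEnd
      rcases hfind : (List.finRange 4).find? fun j =>
        decide ((σ.buf j).Fits (classWidth k)) with _ | j
      · dsimp only
        have hwd : unitWidth k = 16 * classWidth k := rfl
        have h1 := unitWidth_le_one h4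
        have hnone : Balance σ.main σ.ends (initialLength σ.initial) (σ.vertical 3 ≠ none)
            B (total N q + unbufferedGain k x) (total N s + rate k * unitWidth k) e t := by
          -- Here B > 13 + 4 - w ≥ 16, because w ≤ 1.
          refine hnr B le_rfl (by linarith) ?_
          nlinarith [hx.1, hx.2]
        rcases hfind' : (List.finRange 3).find? fun i =>
          State.endHasRoom (classWidth k) (σ.ends i) with _ | i
        · exact .inl ⟨_, B, rfl, rfl, h.main, h.buffer, hnone⟩
        · dsimp only
          have hroom := List.find?_some hfind'
          rcases hi : σ.ends i with _ | ⟨F, n⟩ | F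
          · rw [hi] at hroom; simp [State.endHasRoom] at hroom
          · exact absurd hi (hna i F n)
          · have hL := h.balance.endLedger i
            rw [hi] at hL hroom
            simp only [State.endHasRoom, decide_eq_true_eq] at hroom
            refine .inr ⟨_, F, B, 0, rfl, ⟨rfl, h.main.useEnd ?_, h.buffer, ?_⟩,
              .inr ⟨h4, rfl, hroom.1, hL.2.1⟩⟩
            · rw [hi]; exact ⟨by simp, by simp, fun _ _ => rfl⟩
            · refine Balance.advanceClosed ?_ hi _
              have hr : 0 ≤ rate k * unitWidth k :=
                mul_nonneg (by linarith [third_le_rate k]) hw.le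
              exact h.balance.buffer hna le_rfl (by linarith) (by linarith) fun _ => by linarith
      · dsimp only
        have hfit := List.find?_some hfind
        simp only [decide_eq_true_eq] at hfit
        refine .inr ⟨_, _, _, _, rfl, ⟨rfl, h.main, ?_, hBal⟩, .inl ⟨hh _, rfl⟩⟩
        refine h.buffer.allocate (act' := σ.activeBuf) (by linarith) hfit (by rw [h3]; omega) le_rfl
          h.buffer.first hb3 ?_
        have := h.buffer.act_le
        split_ifs <;> linarith

/-- A buffer step either leaves the square for the vertical shelf or finds room in a buffer region. -/
theorem takeBuffer_step (h : Accounts N σ A a v q s a₂ B e t) (hk : 3 ≤ k)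
    (hx : IsClass k x) (hV : σ.vertical k ≠ none)
    (hS : total N s + rate k * unitWidth k ≤ 16 * σ.vertWidth / 2) :
    ((∃ τ B' e' t', σ.takeBuffer k x = (τ, none) ∧
        BufferStep N σ τ k v q s a₂ B' (unbufferedGain k x) e' t') ∨
      ∃ τ S B' δ e' t', σ.takeBuffer k x = (τ, some S) ∧
        BufferStep N σ τ k v q s a₂ B' δ e' t' ∧
        (k = 3 → δ = (16 * x) ^ 2 - 1) ∧
        (4 ≤ k → 16 * S.height ≤ 2 ∧
          (δ ≤ max 0 (16 * S.height * unitWidth k / 2 - 9 * unitWidth k ^ 2 / 16) ∨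
            (k = 4 ∧ 16 * S.height = 2 ∧ δ = 1 / 2)))) := by
  rcases takeBuffer_cases σ k x with ⟨i, F, n, hi, htb⟩ | ⟨hna, htb⟩ <;> rw [htb]
  · rcases h.takeEnd_step hk hx hi with ⟨τ, e', t', he, hs⟩ | ⟨τ, e', t', he, -, hs⟩
    · exact .inl ⟨τ, B, e', t', he, hs⟩
    · refine .inr ⟨τ, F, B, _, e', t', he, hs, fun h3 => if_pos h3, fun h4 => ?_⟩
      have hL := h.balance.endLedger i
      rw [hi] at hL
      exact ⟨hL.2.2.1, .inl (by rw [endGain, if_neg (by omega)])⟩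
  · rcases h.takeB_step hk hx hV hS hna with ⟨τ, B', he, hs⟩ | ⟨τ, S, B', δ, he, hs, hc⟩
    · exact .inl ⟨τ, B', e, t, he, hs⟩
    · refine .inr ⟨τ, S, B', δ, e, t, he, hs, fun h3 => ?_, fun h4 => ?_⟩
      · rcases hc with ⟨-, rfl⟩ | ⟨h4, -⟩
        · rw [bufGain, if_pos h3]
        · omega
      · rcases hc with ⟨hh, rfl⟩ | ⟨-, rfl, -, hh⟩
        · rw [hh]
          refine ⟨by norm_num, ?_⟩
          rw [bufGain, if_neg (by omega)]
          split_ifs with h4'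
          · exact .inr ⟨h4', by norm_num, rfl⟩
          · left
            norm_num
        · exact ⟨hh, .inl (le_max_left _ _)⟩

end Accounts
namespace Accounts
variable {N : ℕ} {σ τ : State} {A : ℝ} {a v q s : ℕ → ℝ} {a₂ B : ℝ} {e t : Fin 3 → ℝ}
  {k : ℕ} {x : ℝ} {V : Vertical}

/-! ### The effect of a step on the accounts -/

/-- For H_3 half the shelf width is 1, so the area of the initial squares is at least the length of
their packing. -/
theorem initial_le_area {I : ℕ → Option Shelf} {Vt : ℕ → Option Vertical}
    (hN : 3 < N) (hc : Classes N I Vt (max 0 (initialLength I - 3)) a v q s) {S : Shelf}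
    (hI : I 3 = some S) (hV : Vt 3 = none) : max 0 (initialLength I - 3) ≤ a 3 := by
  have h := hc 3 le_rfl hN
  rw [hV] at h
  obtain ⟨-, -, -, h0, h⟩ := h
  have h1 := (h S hI).2.2.2.2
  rw [unitWidth_three] at h1
  refine max_le h0 ?_
  rw [initialLength, hI]
  simp only [Option.elim]
  linarith

theorem openVertical (hN : 5 ≤ N) (hk : 3 ≤ k) (hkN : k < N) {A' : ℝ} {a' : ℕ → ℝ} {I₃ : ℝ}
    {opened : Prop} (ho : opened → k ≠ 3 → σ.vertical 3 ≠ none)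
    (hcl : ∀ S : Shelf, S.length = 1 / 4 → S.height = classWidth k → S.used = x →
      Classes N σ.initial (Function.update σ.vertical k (some ⟨S, false, none⟩))
        (max 0 (initialLength σ.initial - 3)) a' (Function.update v k (v k + unitWidth k)) q s)
    (hw : total N v = 16 * σ.vertWidth) (hA : a₂ + total N a' = A') (hA' : A' ≤ 88)
    (hM : MainLedger σ.main σ.ends (16 * σ.vertWidth) (v 3) a₂ 0)
    (hB : BufferLedger σ.buf σ.activeBuf B)
    (hI₃ : I₃ = initialLength σ.initial)
    (h : Balance σ.main σ.ends I₃ opened B (total N q) (total N s) e t)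
    (hS : total N s ≤ 16 * σ.vertWidth / 2)
    (hI : ∃ u, σ.initial 3 = some ⟨0, 1 / 4, 1 / 4, 1 / 8, u, .right⟩) :
    ∃ τ p, σ.openVertical k x = some (τ, p) ∧
      Accounts N τ A' a' (Function.update v k (v k + unitWidth k)) q s a₂ B e t := by
  subst hI₃
  have hwp := unitWidth_pos k
  have hw2 := unitWidth_le_two hk
  have hwd : unitWidth k = 16 * classWidth k := rfl
  obtain ⟨u, hu⟩ := hI
  -- A stand-in with the right measures: the area inequalities are needed before it is known where
  -- the new slice lies.
  obtain ⟨V₀, hV₀⟩ : ∃ V₀ : Vertical, V₀ = ⟨⟨0, 0, 1 / 4, classWidth k, x, .up⟩, false, none⟩ :=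
    ⟨_, rfl⟩
  have hcl₀ := hcl ⟨0, 0, 1 / 4, classWidth k, x, .up⟩ rfl rfl rfl
  rw [← hV₀] at hcl₀
  have htv : total N (Function.update v k (v k + unitWidth k)) =
      16 * (σ.vertWidth + classWidth k) := by
    rw [total_update hk hkN, hw, hwd]; ring
  have hop : opened → Function.update σ.vertical k (some V₀) 3 ≠ none := by
    intro h
    by_cases h3 : k = 3
    · subst h3; simp
    · rw [Function.update_of_ne (Ne.symm h3)]; exact ho h h3
  have h' := h.mono (main' := σ.main) (fun _ => le_rfl) (fun _ _ => rfl) le_rfl hop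
  obtain ⟨m, r, hm, hr, hv3, hvr⟩ : ∃ (m : ℕ) (r : ℝ), 16 * classWidth k = 2 * m + r ∧ 0 ≤ r ∧
      Function.update v k (v k + unitWidth k) 3 = v 3 + 2 * m ∧
      16 * (σ.vertWidth + classWidth k) - Function.update v k (v k + unitWidth k) 3 ≤
        16 * σ.vertWidth - v 3 + r := by
    by_cases h3 : k = 3
    · subst h3
      rw [unitWidth_three] at *
      refine ⟨1, 0, by rw [← hwd]; norm_num, le_rfl, by norm_num, ?_⟩
      rw [Function.update_self]
      linarith
    · rw [Function.update_of_ne (Ne.symm h3)]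
      exact ⟨0, unitWidth k, by rw [← hwd]; norm_num, hwp.le, by norm_num, by linarith⟩
  obtain ⟨ends', j, -, -, -, htm, hM', hB'⟩ := takeMain_eq_some (A := total N a')
    (a₂' := a₂) (V' := 16 * (σ.vertWidth + classWidth k))
    (v₃' := Function.update v k (v k + unitWidth k) 3) hM h' hS
    (w := classWidth k) (by linarith) (by linarith)
    (by rw [← hwd, max_eq_left (by linarith)]; linarith) hm hr hv3 hvr
    (.inr ⟨by linarith, by linarith⟩)
    (htv ▸ hcl₀.le_area (by omega) fun h => initial_le_area (by omega) hcl₀ hu h)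
    (fun ho => htv ▸ hcl₀.le_area_of_opened hN ho) (by linarith)
  have hsl := Shelf.slice_measures (S := σ.main j) (w := classWidth k)
  rw [hM.height j] at hsl
  refine ⟨_, _, by rw [State.openVertical, htm]; rfl, ?_⟩
  refine ⟨hcl _ hsl.1 hsl.2.1 ?_, htv, hA, hM', hB, ?_, ⟨u, hu⟩⟩
  · simp only [Shelf.advance]; rw [hsl.2.2, zero_add]
  · refine hB'.mono (fun _ => le_rfl) (fun _ _ => rfl) le_rfl fun h => ?_
    by_cases h3 : k = 3
    · subst h3; simp
    · simpa [Function.update_of_ne (Ne.symm h3)] using h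

theorem setVertical (h : Accounts N σ A a v q s a₂ B e t) (hk : 3 ≤ k) (hkN : k < N)
    {B' q' s' : ℝ} {e' t' : Fin 3 → ℝ}
    (hτ : τ = { σ with ends := τ.ends, buf := τ.buf, activeBuf := τ.activeBuf })
    (hM : MainLedger σ.main τ.ends (16 * σ.vertWidth) (v 3) a₂ 0)
    (hB : BufferLedger τ.buf τ.activeBuf B')
    (hbal : Balance σ.main τ.ends (initialLength σ.initial) (σ.vertical 3 ≠ none) B'
      (total N q + (q' - q k)) (total N s + (s' - s k)) e' t')
    (hV : VerticalLedger k (a k + (16 * x) ^ 2) (v k) q' s'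
      (if k = 3 then max 0 (initialLength σ.initial - 3) else 0) V) :
    Accounts N { τ with vertical := Function.update τ.vertical k (some V) }
      (A + (16 * x) ^ 2) (Function.update a k (a k + (16 * x) ^ 2)) v (Function.update q k q')
      (Function.update s k s') a₂ B' e' t' := by
  have hcl := h.classes.update (k := k) (V := some V) (i := σ.initial k) (.inl rfl) hV
  rw [Function.update_eq_self, Function.update_eq_self] at hcl
  rw [hτ]
  refine ⟨hcl, h.width, ?_, hM, hB, ?_, h.initial⟩
  · rw [total_update hk hkN]; linarith [h.area]
  · rw [total_update hk hkN, total_update hk hkN]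
    refine hbal.mono (fun _ => le_rfl) (fun _ _ => rfl) le_rfl fun h3 => ?_
    by_cases hk3 : k = 3
    · subst hk3; simp
    · change Function.update σ.vertical k (some V) 3 ≠ none
      rwa [Function.update_of_ne (Ne.symm hk3)]

theorem packInto (h : Accounts N σ A a v q s a₂ B e t) (hN : 5 ≤ N) (hk : 3 ≤ k) (hkN : k < N)
    (hA : A + (16 * x) ^ 2 ≤ 88)
    (hf : V.shelf.Fits x → VerticalLedger k (a k + (16 * x) ^ 2) (v k) (q k) (s k)
      (if k = 3 then max 0 (initialLength σ.initial - 3) else 0)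
      { V with shelf := V.shelf.advance x })
    (hn : ¬ V.shelf.Fits x → ∀ S : Shelf, S.length = 1 / 4 → S.height = classWidth k →
      S.used = x → VerticalLedger k (a k + (16 * x) ^ 2) (v k + unitWidth k) (q k) (s k)
      (if k = 3 then max 0 (initialLength σ.initial - 3) else 0) ⟨S, false, none⟩) :
    ∃ τ p a' v', σ.packInto k x V = some (τ, p) ∧
      Accounts N τ (A + (16 * x) ^ 2) a' v' q s a₂ B e t := by
  unfold State.packInto
  split_ifs with hfit
  · refine ⟨_, _, Function.update a k (a k + (16 * x) ^ 2), v, rfl, ?_⟩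
    have := h.setVertical (τ := σ) hk hkN rfl h.main h.buffer (q' := q k) (s' := s k)
      (by simpa using h.balance) (hf hfit)
    rwa [Function.update_eq_self, Function.update_eq_self] at this
  · obtain ⟨τ, p, h1, h2⟩ := openVertical (σ := σ) (x := x) (A' := A + (16 * x) ^ 2)
      (a' := Function.update a k (a k + (16 * x) ^ 2)) (v := v) (q := q) (s := s)
      (opened := σ.vertical 3 ≠ none) hN hk hkN (fun h _ => h) (fun S h1 h2 h3 => by
        have hcl := h.classes.update (k := k) (V := some ⟨S, false, none⟩) (i := σ.initial k)
          (.inl rfl) (hn hfit S h1 h2 h3)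
        rwa [Function.update_eq_self, Function.update_eq_self, Function.update_eq_self] at hcl)
      h.width (by rw [total_update hk hkN]; linarith [h.area]) hA h.main h.buffer rfl h.balance
      h.charge_le h.initial
    exact ⟨τ, p, _, _, h1, h2⟩

theorem class_of_vertical (h : Accounts N σ A a v q s a₂ B e t) (hk : 3 ≤ k) (hkN : k < N)
    (hV : σ.vertical k = some V) : VerticalLedger k (a k) (v k) (q k) (s k)
      (if k = 3 then max 0 (initialLength σ.initial - 3) else 0) V := by
  have := h.classes k hk hkN
  rwa [hV] at this

theorem packBuffer (h : Accounts N σ A a v q s a₂ B e t) (hk : 3 ≤ k) (hkN : k < N)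
    (hx : IsClass k x) (hV : σ.vertical k = some V) (hst : V.started = false)
    (hb : V.shelf.length - classWidth k < V.shelf.used + x) :
    ∃ τ p a' q' s' B' e' t', σ.packBuffer k x V = some (τ, p) ∧
      Accounts N τ (A + (16 * x) ^ 2) a' v q' s' a₂ B' e' t' := by
  have hVL := h.class_of_vertical hk hkN hV
  obtain ⟨hsub, hfit⟩ := hVL.fits hx hst
  have hunb := hVL.start_unbuffered hk hx hst hb
  have hlen := hVL.1
  -- Packing into V would be a legitimate continuation, whose ledger bounds the new total charge;
  -- the charge is the same if a buffer is used.
  have hS : total N s + rate k * unitWidth k ≤ 16 * σ.vertWidth / 2 := by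
    have := (h.classes.update (i := σ.initial k) (V := some _) (.inl rfl) hunb).charge_le
    rw [total_update hk hkN, total_update hk hkN, sub_self, add_zero, h.width] at this
    linarith
  have hfits : V.shelf.Fits x := by unfold Shelf.Fits; rw [hlen]; exact hfit
  have hwp := unitWidth_pos k
  -- The second condition for skipping allows the buffer supply to fall short by X - 1; the excess
  -- area of the square in V makes this up.
  have hgain : 0 ≤ (16 * x) ^ 2 - unitWidth k / 2 * (16 * x) ∧
      16 * x - 1 ≤ (16 * x) ^ 2 - unitWidth k / 2 * (16 * x) := by
    obtain ⟨h1, h2⟩ := hx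
    rcases hk.eq_or_lt with rfl | hk
    · rw [unitWidth_three] at *
      constructor <;> nlinarith [sq_nonneg (16 * x - 1)]
    · have := unitWidth_le_one hk
      constructor <;> nlinarith
  obtain ⟨hl1, hl2⟩ := loss_bounds hk
  have hVne : σ.vertical k ≠ none := by rw [hV]; simp
  have hop : ¬ σ.vertical 3 ≠ none → k ≠ 3 := by rintro h3 rfl; exact h3 hVne
  unfold State.packBuffer
  by_cases hskip : σ.alpha ≤ σ.beta ∨ σ.alpha + 1 / 16 ≤ σ.beta + x
  · rw [if_pos hskip]
    have hbal := h.balance.skip (c := unitWidth k ^ 2 / 4) (d := rate k * unitWidth k)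
      (gain := (16 * x) ^ 2 - unitWidth k / 2 * (16 * x)) (V := 16 * σ.vertWidth) (by
        have hsum := h.buffer.sum_le
        have hcard : (σ.closedEnds : ℝ) = ∑ i, if (σ.ends i).isClosed = true then (1 : ℝ) else 0 := by
          rw [State.closedEnds, Finset.card_filter]; push_cast; rfl
        unfold State.alpha State.beta State.bufLength at hskip
        rw [hcard] at hskip
        unfold initialLength
        rcases hskip with h | h <;> linarith) hS hl1 hgain.1 fun h' => hl2 (hop h')
    unfold State.packInto
    rw [if_pos hfits]
    refine ⟨_, _, _, _, _, B, e, t, rfl, h.setVertical (τ := σ) hk hkN rfl h.main h.buffer ?_ hunb⟩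
    convert hbal using 1 <;> ring
  · rw [if_neg hskip]
    rcases h.takeBuffer_step hk hx hVne hS with
      ⟨τ, B', e', t', htb, hs⟩ | ⟨τ, S, B', δ, e', t', htb, hs, h3, h4⟩ <;> rw [htb]
    · dsimp only
      unfold State.packInto
      rw [if_pos hfits]
      refine ⟨_, _, _, _, _, B', e', t', rfl, h.setVertical hk hkN hs.eq hs.main hs.buffer ?_ hunb⟩
      convert hs.balance using 1
      · unfold unbufferedGain; ring
      · ring
    · dsimp only
      split_ifs with hk3
      · subst hk3
        refine ⟨_, _, _, _, _, B', e', t', rfl, h.setVertical hk hkN hs.eq hs.main hs.buffer ?_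
          (hVL.start_direct hst)⟩
        convert hs.balance using 1
        · rw [h3 rfl]; ring
        · ring
      · have hk4 : 4 ≤ k := by omega
        obtain ⟨hT1, hT2, hT3⟩ := Shelf.slice_measures (S := S) (w := classWidth k)
        obtain ⟨h5, h6⟩ := h4 hk4
        refine ⟨_, _, _, _, _, B', e', t', rfl, h.setVertical hk hkN hs.eq hs.main hs.buffer ?_
          (hVL.start_sub (T := (S.slice (classWidth k)).advance x) (cr := δ) hk4 hx hst hb ?_ ?_ ?_ ?_)⟩
        · convert hs.balance using 1 <;> ring
        · exact hT2
        · simp only [Shelf.advance]; rw [hT3, zero_add]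
        · simp only [Shelf.advance]; rw [hT1]; exact h5
        · simp only [Shelf.advance]; rw [hT1]; exact h6

theorem packVertical (h : Accounts N σ A a v q s a₂ B e t) (hN : 5 ≤ N) (hk : 3 ≤ k) (hkN : k < N)
    (hA : A + (16 * x) ^ 2 ≤ 88) (hx : IsClass k x) (hV : σ.vertical k = some V) :
    ∃ τ p a' v' q' s' B' e' t', σ.packVertical k x V = some (τ, p) ∧
      Accounts N τ (A + (16 * x) ^ 2) a' v' q' s' a₂ B' e' t' := by
  have hVL := h.class_of_vertical hk hkN hV
  have hlen := hVL.1
  unfold State.packVertical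
  rcases hsub : V.sub with _ | T <;> dsimp only
  · split_ifs with hb
    · obtain ⟨τ, p, a', q', s', B', e', t', h1, h2⟩ := h.packBuffer hk hkN hx hV hb.1 hb.2
      exact ⟨τ, p, a', v, q', s', B', e', t', h1, h2⟩
    · obtain ⟨τ, p, a', v', h1, h2⟩ := h.packInto hN hk hkN hA (V := V)
        (fun hf => hVL.pack hx hsub (by rw [← hlen]; exact hf) hb)
        (fun hf S h1 h2 h3 => hVL.reopen hk hx hsub (by rw [← hlen]; exact not_le.1 hf) h1 h2 h3)
      exact ⟨τ, p, a', v', q, s, B, e, t, h1, h2⟩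
  · split_ifs with hf
    · refine ⟨_, _, _, _, _, _, B, e, t, rfl, h.setVertical (τ := σ) hk hkN rfl h.main h.buffer
        (q' := q k) (s' := s k) (by simpa using h.balance) (hVL.pack_sub hx hsub)⟩
    · obtain ⟨τ, p, a', v', h1, h2⟩ := h.packInto hN hk hkN hA (V := { V with sub := none })
        (fun hf' => VerticalLedger.pack_close (V := V) hx hVL hsub (not_le.1 hf) (by rw [← hlen]; exact hf'))
        (fun hf' S h1 h2 h3 => VerticalLedger.reopen_close (V := V) hk hx hVL hsub (not_le.1 hf)
          (by rw [← hlen]; exact not_le.1 hf') h1 h2 h3)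
      exact ⟨τ, p, a', v', q, s, B, e, t, h1, h2⟩

theorem packInitial (h : Accounts N σ A a v q s a₂ B e t) (hN : 5 ≤ N) (hk : 3 ≤ k) (hkN : k < N)
    (hA : A + (16 * x) ^ 2 ≤ 88) (hx : IsClass k x) (hV : σ.vertical k = none) :
    ∃ τ p a' v', σ.packInitial k x = some (τ, p) ∧
      Accounts N τ (A + (16 * x) ^ 2) a' v' q s a₂ B e t := by
  have hcl := h.classes k hk hkN
  rw [hV] at hcl
  obtain ⟨hv, hq, hs, ha, hI⟩ := hcl
  have hwp := unitWidth_pos k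
  obtain ⟨S, hS, hS1, hS2, hS3, hS4, hS5⟩ : ∃ S, S = (σ.initial k).getD
      ⟨0, 3 / 8 + σ.heightA, 1 / 4, classWidth k, 0, .right⟩ ∧ S.length = 1 / 4 ∧
      S.height = classWidth k ∧ 0 ≤ S.used ∧ S.used ≤ 1 / 4 ∧
      unitWidth k / 2 * (16 * S.used) ≤ a k := by
    refine ⟨_, rfl, ?_⟩
    rcases hIk : σ.initial k with _ | S
    · norm_num; exact ha
    · exact hI S hIk
  have hp := hx.pos
  obtain ⟨u, hu⟩ := h.initial
  have hz : ∀ I : ℕ → Option Shelf, k = 3 → I 3 = some S →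
      (if k = 3 then max 0 (initialLength I - 3) else 0) = max 0 (16 * S.used - 3) := by
    intro I hk h3
    rw [if_pos hk, initialLength, h3]; rfl
  have hopen : ∀ S' : Shelf, ¬ S.Fits x → S'.length = 1 / 4 → S'.height = classWidth k →
      S'.used = x → Classes N σ.initial (Function.update σ.vertical k (some ⟨S', false, none⟩))
        (max 0 (initialLength σ.initial - 3)) (Function.update a k (a k + (16 * x) ^ 2))
        (Function.update v k (v k + unitWidth k)) q s := by
    intro S' hf h1 h2 h3
    unfold Shelf.Fits at hf
    have hVL := VerticalLedger.open_first (a := a k) (I := S.used) (S := S')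
      (z := if k = 3 then max 0 (initialLength σ.initial - 3) else 0) hk hx hS5
      (by linarith) hS4 (by
        by_cases h3 : k = 3
        · subst h3
          rw [hz _ rfl (by rw [hS, hu]; rfl), if_pos rfl]
        · rw [if_neg h3, if_neg h3]) h1 h2 h3
    have hcl := h.classes.update (k := k) (V := some ⟨S', false, none⟩) (i := σ.initial k)
      (.inl rfl) hVL
    have h0 : Function.update q k 0 = q := by rw [← hq, Function.update_eq_self]
    have h0' : Function.update s k 0 = s := by rw [← hs, Function.update_eq_self]
    rw [Function.update_eq_self, h0, h0'] at hcl
    rwa [hv, zero_add]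
  have hstep : ¬ S.Fits x → ∀ buf : Fin 4 → Shelf, BufferLedger buf σ.activeBuf B →
      ∃ τ p a' v', ({ σ with buf := buf } : State).openVertical k x = some (τ, p) ∧
      Accounts N τ (A + (16 * x) ^ 2) a' v' q s a₂ B e t := by
    intro hf buf hbuf
    obtain ⟨τ, p, h1, h2⟩ := openVertical (σ := { σ with buf := buf }) (x := x)
      (A' := A + (16 * x) ^ 2)
      (a' := Function.update a k (a k + (16 * x) ^ 2)) (v := v) (q := q) (s := s)
      (opened := σ.vertical 3 ≠ none) hN hk hkN (fun h _ => h) (fun S' => hopen S' hf)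
      h.width (by rw [total_update hk hkN]; linarith [h.area]) hA h.main hbuf rfl h.balance
      h.charge_le h.initial
    exact ⟨τ, p, _, _, h1, h2⟩
  unfold State.packInitial
  rw [← hS]
  dsimp only
  by_cases hf : S.Fits x
  · rw [if_pos hf]
    refine ⟨_, _, Function.update a k (a k + (16 * x) ^ 2), v, rfl, ?_⟩
    have hle : initialLength σ.initial ≤
        initialLength (Function.update σ.initial k (some (S.advance x))) := by
      by_cases h3 : k = 3
      · subst h3
        unfold initialLength
        rw [Function.update_self, hu]
        rw [hu] at hS
        subst hS
        simp only [Option.elim, Option.getD, Shelf.advance]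
        linarith
      · unfold initialLength
        rw [Function.update_of_ne (Ne.symm h3)]
    refine ⟨?_, h.width, by rw [total_update hk hkN]; linarith [h.area], h.main, h.buffer,
      h.balance.mono (fun _ => le_rfl) (fun _ _ => rfl) hle id, ?_⟩
    · have hcl := h.classes.update (k := k) (V := none) (i := some (S.advance x))
        (z' := max 0 (initialLength (Function.update σ.initial k (some (S.advance x))) - 3))
        (a' := a k + (16 * x) ^ 2) (v' := v k) (q' := q k) (s' := s k) (by
          by_cases h3 : k = 3
          · exact .inr h3
          · left
            unfold initialLength
            rw [Function.update_of_ne (Ne.symm h3)]) (by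
          refine ⟨hv, hq, hs, by positivity, fun S' hS' => ?_⟩
          obtain rfl := Option.some.inj hS'
          unfold Shelf.Fits at hf
          refine ⟨hS1, hS2, by simp only [Shelf.advance]; linarith,
            by simp only [Shelf.advance]; linarith, ?_⟩
          simp only [Shelf.advance]
          nlinarith [hx.1])
      have h0 : Function.update σ.vertical k none = σ.vertical := by
        rw [← hV, Function.update_eq_self]
      rw [Function.update_eq_self, Function.update_eq_self, Function.update_eq_self, h0] at hcl
      exact hcl
    · by_cases h3 : k = 3
      · subst h3
        rw [hu] at hS
        subst hS
        exact ⟨u + x, by simp [Shelf.advance]⟩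
      · exact ⟨u, by simp [Function.update_of_ne (Ne.symm h3), hu]⟩
  rw [if_neg hf]
  by_cases hj : k = 3 ∧ (σ.buf 0).used = 0
  · rw [if_pos hj]
    obtain ⟨rfl, hj⟩ := hj
    -- An unused B_1 must still be active, so moving its start to the end of the initial packing
    -- only changes its length, which remains at least 4.
    have hact : σ.activeBuf = 0 := by
      by_contra hc
      exact h.buffer.first hc hj
    refine hstep hf _ ?_
    have hsu : ∀ i, (Function.update σ.buf 0
        ⟨S.used, 1 / 4, 1 / 2 - S.used, 1 / 8, 0, .right⟩ i).used = (σ.buf i).used := by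
      intro i
      by_cases hi : i = 0
      · subst hi; simp [hj]
      · simp [hi]
    have hb := h.buffer
    refine ⟨fun i => ?_, fun i => hsu i ▸ hb.used_nonneg i, fun i => ?_, ?_, ?_, ?_, ?_,
      fun i hi => ?_, fun h0 => absurd hact h0, ?_, ?_⟩
    · by_cases hi : i = 0
      · subst hi; norm_num
      · simpa [hi] using hb.height i
    · rw [hsu]
      by_cases hi : i = 0
      · subst hi; rw [hj]; simp; linarith
      · simpa [hi] using hb.used_le i
    · simp; linarith
    · simpa using hb.length_one
    · simpa using hb.length_two
    · simpa using hb.length_three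
    · rw [hsu]; exact hb.later i hi
    · simp only [hsu]; exact hb.sum_le
    · rw [hsu]; exact hb.act_le
  · rw [if_neg hj]
    exact hstep hf σ.buf h.buffer

theorem packTwo (h : Accounts N σ A a v q s a₂ B e t) (hN : 5 ≤ N)
    (hA : A + (16 * x) ^ 2 ≤ 88) (hx : IsClass 2 x) :
    ∃ τ p a₂', (σ.takeMain x).map (fun r => (r.1, r.2.place x)) = some (τ, p) ∧
      Accounts N τ (A + (16 * x) ^ 2) a v q s a₂' B e t := by
  obtain ⟨h1, h2⟩ := hx
  rw [unitWidth_two] at h1 h2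
  obtain ⟨u, hu⟩ := h.initial
  obtain ⟨ends', j, -, -, -, htm, hM', hB'⟩ := takeMain_eq_some (A := total N a)
    (a₂' := a₂ + (16 * x) ^ 2) (V' := 16 * σ.vertWidth)
    (v₃' := v 3) (m := 0) (r := 16 * x) h.main h.balance h.charge_le
    (w := x) (by linarith) (by linarith)
    -- The square pays 2X for its section and 2(X-2) for the closing: X² ≥ 4X - 4.
    (by rw [max_eq_right (by linarith)]; nlinarith [sq_nonneg (16 * x - 2)]) (by norm_num) (by linarith)
    (by norm_num) (by linarith) (.inl rfl)
    (h.width ▸ h.classes.le_area (by omega) fun h' => initial_le_area (by omega) h.classes hu h')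
    (fun ho => h.width ▸ h.classes.le_area_of_opened hN ho) (by linarith [h.area])
  refine ⟨{ σ with ends := ends', main := Function.update σ.main j ((σ.main j).advance x) }, _,
    a₂ + (16 * x) ^ 2, by rw [htm]; rfl, h.classes, h.width, by linarith [h.area], hM',
    h.buffer, hB', h.initial⟩

theorem isClass_heightClass (h0 : 0 < x) (h1 : x ≤ 1) : IsClass (heightClass x) x := by
  obtain ⟨h2, h3⟩ := (heightClass_eq_iff h0 h1 _).1 rfl
  refine ⟨?_, ?_⟩
  · rw [← unitWidth_succ]; unfold unitWidth; linarith
  · unfold unitWidth; linarith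

/-- Packing a small square preserves the accounts. -/
theorem step (h : Accounts N σ A a v q s a₂ B e t) (hN : 5 ≤ N) (h0 : 0 < x) (h1 : x ≤ 1 / 4)
    (hxN : heightClass x < N) (hA : A + (16 * x) ^ 2 ≤ 88) :
    ∃ τ p a' v' q' s' a₂' B' e' t', σ.step x = some (τ, p) ∧
      Accounts N τ (A + (16 * x) ^ 2) a' v' q' s' a₂' B' e' t' := by
  have hx := isClass_heightClass h0 (by linarith)
  generalize hk : heightClass x = k at *
  unfold State.step
  rw [hk]
  dsimp only
  have hk2 : 2 ≤ k := by
    by_contra hc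
    have := unitWidth_anti (i := k) (j := 1) (by omega)
    have h2 : unitWidth 1 = 8 := by norm_num [unitWidth, classWidth]
    linarith [hx.1]
  rw [if_neg (by omega)]
  split_ifs with h2
  · subst h2
    obtain ⟨τ, p, a₂', h1, h2⟩ := h.packTwo hN hA hx
    exact ⟨τ, p, a, v, q, s, a₂', B, e, t, h1, h2⟩
  · rcases hV : σ.vertical k with _ | V <;> dsimp only
    · obtain ⟨τ, p, a', v', h1, h2⟩ := h.packInitial hN (by omega) hxN hA hx hV
      exact ⟨τ, p, a', v', q, s, a₂, B, e, t, h1, h2⟩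
    · obtain ⟨τ, p, a', v', q', s', B', e', t', h1, h2⟩ :=
        h.packVertical hN (by omega) hxN hA hx hV
      exact ⟨τ, p, a', v', q', s', a₂, B', e', t', h1, h2⟩

theorem init (N : ℕ) : Accounts N State.init 0 0 0 0 0 0 0 0 0 := by
  have hI : initialLength State.init.initial = 0 := by simp [initialLength, State.init]
  have ht : total N 0 = 0 := by simp [total]
  refine ⟨fun k h3 _ => ?_, by simp [State.init, total], by simp [total], ?_, ?_, ?_,
    ⟨0, by simp [State.init]⟩⟩
  · refine ⟨rfl, rfl, rfl, le_rfl, fun S hS => ?_⟩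
    simp only [State.init] at hS
    split_ifs at hS with hk
    · obtain rfl := Option.some.inj hS
      subst hk
      norm_num [classWidth]
  · have hu : ∀ i, (State.init.main i).used = 0 := by
      intro i; fin_cases i <;> rfl
    refine ⟨fun i => ?_, fun i => ?_, fun i => ?_, fun i => (hu i).ge, fun i => ?_, fun _ => ?_,
      fun _ => ?_, ⟨0, 0, fun i => ?_, fun i => le_rfl, ?_, ?_⟩, fun _ => ?_, ?_⟩
    · fin_cases i <;> norm_num [State.init, mainLength]
    · fin_cases i <;> norm_num [State.init]
    · fin_cases i <;> simp [State.init]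
    · rw [hu]; fin_cases i <;> norm_num [mainLength]
    · exact ⟨rfl, hu 1, hu 2, hu 3⟩
    · exact ⟨rfl, hu 2, hu 3⟩
    · rw [hu]; simp
    · simp
    · simp [State.init]
    · simp only [hu]; norm_num [State.init]
    · change 2 * (16 * (0 : ℝ) + 16 * 0 + 16 * 0 + 16 * 0) ≤ 0 + 2 * (16 * 0) + 0
      norm_num
  · have hu : ∀ i, (State.init.buf i).used = 0 := by
      intro i; fin_cases i <;> rfl
    refine ⟨fun i => ?_, fun i => (hu i).ge, fun i => ?_, ?_, ?_, ?_, ?_, fun i _ => hu i,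
      fun h => absurd rfl h, by simp [hu], by rw [hu]; simp [State.init]⟩
    · fin_cases i <;> norm_num [State.init]
    · rw [hu]; fin_cases i <;> norm_num [State.init]
    · change 4 ≤ 16 * (1 / 4 : ℝ); norm_num
    · change 16 * (1 / 4 : ℝ) = 4; norm_num
    · change 16 * (1 / 2 : ℝ) = 8; norm_num
    · change 16 * (1 / 4 : ℝ) = 4; norm_num
  · rw [hI, ht]
    refine ⟨fun i => ⟨rfl, rfl⟩, by simp, fun _ => by simp, .inl (by simp [State.init, EndBuffer.credit])⟩

end Accounts

/-! ### Half-open boxes -/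

/-- The half-open square with lower left corner `c` and side length `s`. -/
def tile (c : ℝ × ℝ) (s : ℝ) : Set (ℝ × ℝ) := Set.Ico c.1 (c.1 + s) ×ˢ Set.Ico c.2 (c.2 + s)

/-- Adjacent half-open boxes are disjoint as sets, so the layout can be treated by plain inclusions;
interiors and closures appear only in the passage to squares. -/
theorem interior_square_subset (c : ℝ × ℝ) (s : ℝ) : interior (square c s) ⊆ tile c s := by
  unfold square tile
  rw [interior_prod_eq, interior_Icc, interior_Icc]
  exact Set.prod_mono Set.Ioo_subset_Ico_self Set.Ioo_subset_Ico_self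

theorem square_subset_of_tile_subset {c : ℝ × ℝ} {s : ℝ} (hs : 0 < s)
    (h : tile c s ⊆ unitSquare) : square c s ⊆ unitSquare := by
  have hcl : IsClosed unitSquare := isClosed_Icc.prod isClosed_Icc
  refine subset_trans ?_ (hcl.closure_subset_iff.2 h)
  unfold square tile
  rw [closure_prod_eq, closure_Ico (by linarith), closure_Ico (by linarith)]

namespace Shelf

/-- The part of a shelf behind the used section. -/
def free (S : Shelf) : Set (ℝ × ℝ) :=
  match S.dir with
  | .right => Set.Ico (S.x + S.used) (S.x + S.length) ×ˢ Set.Ico S.y (S.y + S.height)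
  | .left => Set.Ico S.x (S.x + S.length - S.used) ×ˢ Set.Ico S.y (S.y + S.height)
  | .up => Set.Ico S.x (S.x + S.height) ×ˢ Set.Ico (S.y + S.used) (S.y + S.length)

/-- The section of width `w` directly behind the used section. -/
def strip (S : Shelf) (w : ℝ) : Set (ℝ × ℝ) :=
  match S.dir with
  | .right => Set.Ico (S.x + S.used) (S.x + S.used + w) ×ˢ Set.Ico S.y (S.y + S.height)
  | .left => Set.Ico (S.x + S.length - S.used - w) (S.x + S.length - S.used) ×ˢ
      Set.Ico S.y (S.y + S.height)
  | .up => Set.Ico S.x (S.x + S.height) ×ˢ Set.Ico (S.y + S.used) (S.y + S.used + w)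

variable {S : Shelf} {w s : ℝ}

theorem strip_subset (h : S.Fits w) : S.strip w ⊆ S.free := by
  obtain ⟨x, y, l, h', u, d⟩ := S
  unfold Fits at h
  rintro ⟨p, q⟩
  cases d <;> simp only [strip, free, Set.mem_prod, Set.mem_Ico] at h ⊢ <;>
    rintro ⟨⟨h1, h2⟩, h3, h4⟩ <;> refine ⟨⟨?_, ?_⟩, ?_, ?_⟩ <;> linarith

theorem free_advance_subset (h : 0 ≤ w) : (S.advance w).free ⊆ S.free := by
  obtain ⟨x, y, l, h', u, d⟩ := S
  rintro ⟨p, q⟩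
  cases d <;> simp only [advance, free, Set.mem_prod, Set.mem_Ico] <;>
    rintro ⟨⟨h1, h2⟩, h3, h4⟩ <;> refine ⟨⟨?_, ?_⟩, ?_, ?_⟩ <;> linarith

theorem disjoint_strip : Disjoint (S.strip w) (S.advance w).free := by
  obtain ⟨x, y, l, h', u, d⟩ := S
  rw [Set.disjoint_left]
  rintro ⟨p, q⟩
  cases d <;> simp only [strip, advance, free, Set.mem_prod, Set.mem_Ico] <;>
    rintro ⟨⟨h1, h2⟩, h3, h4⟩ ⟨⟨h5, h6⟩, h7, h8⟩ <;> linarith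

theorem free_slice_subset : (S.slice w).free ⊆ S.strip w := by
  obtain ⟨x, y, l, h', u, d⟩ := S
  rintro ⟨p, q⟩
  cases d <;> simp only [strip, slice, free, Set.mem_prod, Set.mem_Ico] <;>
    rintro ⟨⟨h1, h2⟩, h3, h4⟩ <;> refine ⟨⟨?_, ?_⟩, ?_, ?_⟩ <;> linarith

theorem tile_place_subset (h : s ≤ S.height) : tile (S.place s) s ⊆ S.strip s := by
  obtain ⟨x, y, l, h', u, d⟩ := S
  rintro ⟨p, q⟩
  cases d <;> simp only [strip, place, tile, Set.mem_prod, Set.mem_Ico] at h ⊢ <;>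
    rintro ⟨⟨h1, h2⟩, h3, h4⟩ <;> refine ⟨⟨?_, ?_⟩, ?_, ?_⟩ <;> linarith

end Shelf

/-- The buffer shelf of an end. -/
def EndBuffer.free : EndBuffer → Set (ℝ × ℝ)
  | .reserved => ∅
  | .active S _ => S.free
  | .closed S => S.free

theorem EndBuffer.free_ofMain_subset {S : Shelf} (hd : S.dir ≠ .up) :
    (EndBuffer.ofMain S).free ⊆ S.free := by
  have key : ∀ F : Shelf, (if 1 / 16 < max S.used (S.length - 1 / 8) - (S.length - 1 / 8) then
      EndBuffer.closed F else .active F 0).free = F.free := by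
    intro F; split_ifs <;> rfl
  unfold ofMain
  dsimp only
  rw [key]
  have := le_max_left S.used (S.length - 1 / 8)
  obtain ⟨x, y, l, h', u, d⟩ := S
  rintro ⟨p, q⟩
  cases d <;> simp only [Shelf.free, Set.mem_prod, Set.mem_Ico] at this hd ⊢
  · rintro ⟨⟨h1, h2⟩, h3, h4⟩; refine ⟨⟨?_, ?_⟩, ?_, ?_⟩ <;> linarith
  · rintro ⟨⟨h1, h2⟩, h3, h4⟩; refine ⟨⟨?_, ?_⟩, ?_, ?_⟩ <;> linarith
  · exact absurd rfl hd

/-! ### Free regions -/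

/-- The names of the free regions. -/
inductive Region
  | main (j : Fin 4)
  | tail (i : Fin 3)
  | buf (j : Fin 4)
  | stack
  | init (k : ℕ)
  | vert (k : ℕ)
  | sub (k : ℕ)

noncomputable instance : DecidableEq Region := Classical.decEq _

/-- The free part of a region. -/
def State.free (σ : State) : Region → Set (ℝ × ℝ)
  | .main j => {p | (∀ i : Fin 3, j = i.castSucc → σ.ends i = .reserved) ∧ p ∈ (σ.main j).free}
  | .tail i => (σ.ends i).free
  | .buf j => (σ.buf j).free
  | .stack => Set.Ico 0 (1 / 4) ×ˢ Set.Ico (3 / 8 + σ.heightA) (1 / 2)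
  | .init k => {p | σ.vertical k = none ∧ ∃ S, σ.initial k = some S ∧ p ∈ S.free}
  | .vert k => {p | ∃ V, σ.vertical k = some V ∧ p ∈ V.shelf.free}
  | .sub k => {p | ∃ V T, σ.vertical k = some V ∧ V.sub = some T ∧ p ∈ T.free}

/-- The regions `F` are disjoint parts of the container outside of the occupied set `O`. -/
structure Good (O : Set (ℝ × ℝ)) (F : Region → Set (ℝ × ℝ)) : Prop where
  occupied : ∀ i, Disjoint O (F i)
  disjoint : ∀ i j, i ≠ j → Disjoint (F i) (F j)
  inside : ∀ i, F i ⊆ unitSquare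

/-- A square of side `x` can be placed at `p`, outside of the occupied set `O`. -/
def Placeable (O : Set (ℝ × ℝ)) (p : ℝ × ℝ) (x : ℝ) : Prop :=
  Disjoint O (tile p x) ∧ square p x ⊆ unitSquare

namespace Good
variable {O : Set (ℝ × ℝ)} {F G : Region → Set (ℝ × ℝ)} {a b : Region} {S : Shelf} {w x : ℝ}

theorem mono (h : Good O F) (hG : ∀ i, G i ⊆ F i) : Good O G :=
  ⟨fun i => (h.occupied i).mono_right (hG i), fun i j hij => (h.disjoint i j hij).mono (hG i) (hG j),
    fun i => (hG i).trans (h.inside i)⟩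

/-- A region is divided. -/
theorem divide (h : Good O F) {X Y : Set (ℝ × ℝ)} (hX : X ⊆ F a) (hY : Y ⊆ F a)
    (hXY : Disjoint X Y) : Good O (Function.update (Function.update F a X) b Y) := by
  have key : ∀ i, ∃ j, Function.update (Function.update F a X) b Y i ⊆ F j ∧
      (i = j ∨ (i = b ∧ j = a)) := by
    intro i
    by_cases hb : i = b
    · subst hb; exact ⟨a, by simpa using hY, .inr ⟨rfl, rfl⟩⟩
    · refine ⟨i, ?_, .inl rfl⟩
      rw [Function.update_of_ne hb]
      by_cases ha : i = a
      · subst ha; simpa using hX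
      · rw [Function.update_of_ne ha]
  refine ⟨fun i => ?_, fun i j hij => ?_, fun i => ?_⟩
  · obtain ⟨j, hj, -⟩ := key i
    exact (h.occupied j).mono_right hj
  · obtain ⟨i', hi', hi⟩ := key i
    obtain ⟨j', hj', hj⟩ := key j
    by_cases hne : i' = j'
    · have haux : ∀ i, i = a → i ≠ b →
          Function.update (Function.update F a X) b Y i = X := by
        rintro i rfl hb
        rw [Function.update_of_ne hb, Function.update_self]
      have haux' : ∀ i, i = b → Function.update (Function.update F a X) b Y i = Y := by
        rintro i rfl; rw [Function.update_self]
      subst hne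
      rcases hi with rfl | ⟨hib, hia⟩ <;> rcases hj with rfl | ⟨hjb, hja⟩
      · exact absurd rfl hij
      · rw [haux' j hjb, haux i hja (by rw [← hjb]; exact hij)]; exact hXY
      · rw [haux' i hib, haux j hia (by rw [← hib]; exact hij.symm)]; exact hXY.symm
      · exact absurd (hib.trans hjb.symm) hij
    · exact (h.disjoint i' j' hne).mono hi' hj'
  · obtain ⟨j, hj, -⟩ := key i
    exact hj.trans (h.inside j)

theorem slice (h : Good O F) (hS : S.free ⊆ F a) (hw : 0 ≤ w) (hf : S.Fits w) (b : Region) :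
    Good O (Function.update (Function.update F a (S.advance w).free) b (S.slice w).free) :=
  h.divide ((Shelf.free_advance_subset hw).trans hS)
    ((Shelf.free_slice_subset.trans (Shelf.strip_subset hf)).trans hS)
    (Shelf.disjoint_strip.mono_left Shelf.free_slice_subset).symm

theorem place (h : Good O F) (hS : S.free ⊆ F a) (hx : 0 < x) (hf : S.Fits x)
    (hxh : x ≤ S.height) : Placeable O (S.place x) x ∧
      Good (O ∪ tile (S.place x) x) (Function.update F a (S.advance x).free) := by
  have hT := Shelf.tile_place_subset hxh
  have hTF := (hT.trans (Shelf.strip_subset hf)).trans hS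
  have hadv := (Shelf.free_advance_subset (S := S) hx.le).trans hS
  refine ⟨⟨(h.occupied a).mono_right hTF,
    square_subset_of_tile_subset hx (hTF.trans (h.inside a))⟩, ?_⟩
  have h' : Good O (Function.update F a (S.advance x).free) := h.mono fun i => by
    by_cases hi : i = a
    · subst hi; simpa using hadv
    · simp [hi]
  refine ⟨fun i => Disjoint.union_left (h'.occupied i) ?_, h'.disjoint, h'.inside⟩
  by_cases hi : i = a
  · subst hi
    rw [Function.update_self]
    exact Shelf.disjoint_strip.mono_left hT
  · rw [Function.update_of_ne hi]
    exact (h.disjoint a i (Ne.symm hi)).mono_left hTF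

end Good

/-! ### The effect of changing a component of the state -/

section
variable {σ : State}

theorem free_setEnd {i : Fin 3} {E : EndBuffer} (h1 : σ.ends i ≠ .reserved) (h2 : E ≠ .reserved)
    (r : Region) : ({ σ with ends := Function.update σ.ends i E } : State).free r ⊆
      Function.update σ.free (.tail i) E.free r := by
  rcases r with j | i' | j | _ | k | k | k <;>
    (try simp only [ne_eq, reduceCtorEq, not_false_eq_true, Function.update_of_ne]) <;>
    try exact subset_rfl
  · rintro p ⟨h, hp⟩
    refine ⟨fun i' hi' => ?_, hp⟩
    have := h i' hi'
    by_cases hi : i' = i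
    · subst hi; simp [h2] at this
    · simpa [hi] using this
  · by_cases hi : i' = i
    · subst hi; simp [State.free]
    · simp [State.free, hi]

/-- A main region counts as free only while its end is reserved. Closing empties it and leaves just
the end available. -/
theorem free_close {i : Fin 3} {E : EndBuffer} (h2 : E ≠ .reserved)
    (r : Region) : ({ σ with ends := Function.update σ.ends i E } : State).free r ⊆
      Function.update (Function.update σ.free (.main i.castSucc) ∅) (.tail i) E.free r := by
  rcases r with j | i' | j | _ | k | k | k <;>
    (try simp only [ne_eq, reduceCtorEq, not_false_eq_true, Function.update_of_ne]) <;>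
    try exact subset_rfl
  · rintro p ⟨h, hp⟩
    by_cases hj : j = i.castSucc
    · exact absurd (h i hj) (by simpa using h2)
    · rw [Function.update_of_ne (by simpa using hj)]
      refine ⟨fun i' hi' => ?_, hp⟩
      have : Function.update σ.ends i E i' = _ := h i' hi'
      rwa [Function.update_of_ne (by rintro rfl; exact hj hi')] at this
  · by_cases hi : i' = i
    · subst hi; simp [State.free]
    · simp [State.free, hi]

theorem free_setBuf {j : Fin 4} {S : Shelf} (act : Fin 4) (r : Region) :
    ({ σ with buf := Function.update σ.buf j S, activeBuf := act } : State).free r ⊆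
      Function.update σ.free (.buf j) S.free r := by
  rcases r with j' | i' | j' | _ | k | k | k <;>
    (try simp only [ne_eq, reduceCtorEq, not_false_eq_true, Function.update_of_ne]) <;>
    try exact subset_rfl
  by_cases hj : j' = j
  · subst hj; simp [State.free]
  · simp [State.free, hj]

theorem free_setMain {j : Fin 4} {S : Shelf} (r : Region) :
    ({ σ with main := Function.update σ.main j S } : State).free r ⊆
      Function.update σ.free (.main j) S.free r := by
  rcases r with j' | i' | j' | _ | k | k | k <;>
    (try simp only [ne_eq, reduceCtorEq, not_false_eq_true, Function.update_of_ne]) <;>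
    try exact subset_rfl
  by_cases hj : j' = j
  · subst hj
    rintro p ⟨h, hp⟩
    simpa using hp
  · simp [State.free, hj]

/-- The free part of the open buffer subshelf. -/
def Vertical.subFree (V : Vertical) : Set (ℝ × ℝ) := {p | ∃ T, V.sub = some T ∧ p ∈ T.free}

/-- The initial shelf ceases to be a free region once a vertical shelf exists; for H_3 this allows
B_1 to take over its remainder. -/
theorem free_setVertical {k : ℕ} {V : Vertical} {v : ℝ} (r : Region) :
    ({ σ with vertical := Function.update σ.vertical k (some V), vertWidth := v } : State).free r ⊆
      Function.update (Function.update (Function.update σ.free (.init k) ∅) (.vert k) V.shelf.free)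
        (.sub k) V.subFree r := by
  rcases r with j' | i' | j' | _ | k' | k' | k' <;>
    (try simp only [ne_eq, reduceCtorEq, not_false_eq_true, Function.update_of_ne]) <;>
    try exact subset_rfl
  all_goals
    by_cases hk : k' = k
    · subst hk; simp [State.free, Vertical.subFree]
    · simp [State.free, hk]

end

namespace Good
variable {O : Set (ℝ × ℝ)} {F : Region → Set (ℝ × ℝ)} {a b : Region}

/-- A region takes over a part of another one. -/
theorem merge (h : Good O F) (hab : a ≠ b) {Y : Set (ℝ × ℝ)} (hY : Y ⊆ F a ∪ F b) :
    Good O (Function.update (Function.update F a ∅) b Y) := by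
  have key : ∀ i, i ≠ b → Function.update (Function.update F a ∅) b Y i ⊆ F i ∧
      Disjoint (Function.update (Function.update F a ∅) b Y i) Y := by
    intro i hb
    rw [Function.update_of_ne hb]
    by_cases ha : i = a
    · subst ha; simp
    · rw [Function.update_of_ne ha]
      exact ⟨subset_rfl, (Disjoint.union_right (h.disjoint i a ha) (h.disjoint i b hb)).mono_right hY⟩
  refine ⟨fun i => ?_, fun i j hij => ?_, fun i => ?_⟩
  · by_cases hb : i = b
    · subst hb
      rw [Function.update_self]
      exact (Disjoint.union_right (h.occupied a) (h.occupied i)).mono_right hY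
    · exact (h.occupied i).mono_right (key i hb).1
  · by_cases hi : i = b
    · subst hi
      rw [Function.update_self]
      exact (key j hij.symm).2.symm
    · by_cases hj : j = b
      · subst hj
        rw [Function.update_self]
        exact (key i hij).2
      · exact (h.disjoint i j hij).mono (key i hi).1 (key j hj).1
  · by_cases hb : i = b
    · subst hb
      rw [Function.update_self]
      exact hY.trans (Set.union_subset (h.inside a) (h.inside i))
    · exact (key i hb).1.trans (h.inside i)

end Good

theorem update_subset_update {F G : Region → Set (ℝ × ℝ)} {X : Set Region}
    (h : ∀ r, r ∉ X → G r ⊆ F r) (a : Region) (Y : Set (ℝ × ℝ)) :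
    ∀ r, r ∉ X → Function.update G a Y r ⊆ Function.update F a Y r := by
  intro r hr
  by_cases ha : r = a
  · subst ha; simp
  · rw [Function.update_of_ne ha, Function.update_of_ne ha]; exact h r hr

/-! ### Invariance of the geometric layout -/

/-- The free regions of a state and the occupied set `O`. -/
structure Layout (N : ℕ) (σ : State) (O : Set (ℝ × ℝ)) : Prop where
  good : Good O σ.free
  heightA_eq : σ.heightA = ∑ k ∈ Finset.Ico 4 N, if (σ.initial k).isSome then classWidth k else 0
  first : σ.vertical 3 = none → ∃ u, σ.buf 0 = ⟨1 / 4, 1 / 4, 1 / 4, 1 / 8, u, .right⟩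

namespace Layout
variable {N : ℕ} {σ τ : State} {O : Set (ℝ × ℝ)} {k : ℕ} {x w : ℝ} {p : ℝ × ℝ} {S : Shelf}
  {V : Vertical} {F : Region → Set (ℝ × ℝ)}

/-- The regions in `X` are exempt from the comparison with `F`: when a vertical shelf is about to be
opened, its initial shelf may already have been given away. -/
theorem takeMain {X : Set Region} {W v₃ a₂ pay : ℝ}
    (hM : MainLedger σ.main σ.ends W v₃ a₂ pay) (hw : w ≤ 1 / 4) (hF : Good O F)
    (hX : ∀ r ∈ X, ∃ k, r = .init k) (hσ : ∀ r, r ∉ X → σ.free r ⊆ F r)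
    (he : σ.takeMain w = some (τ, S)) :
    ∃ j F', S.Fits w ∧ S.height = 1 / 4 ∧ S.free ⊆ F' (.main j) ∧ Good O F' ∧
      (∀ r, r ∉ X → τ.free r ⊆ Function.update F' (.main j) (S.advance w).free r) ∧
      τ = { σ with main := τ.main, ends := τ.ends } := by
  have hXmain : ∀ j, Region.main j ∉ X := fun j hj => by obtain ⟨k, hk⟩ := hX _ hj; cases hk
  obtain ⟨ends', hc, hres⟩ := findMain_cases hM hw
  rcases hres with ⟨j, hj, hf, hadm⟩ | ⟨hn, -⟩
  · rw [State.takeMain, hj] at he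
    simp only [Option.map_some, Option.some.injEq, Prod.mk.injEq] at he
    obtain ⟨rfl, rfl⟩ := he
    obtain ⟨F', hF', hσ'⟩ : ∃ F', Good O F' ∧
        ∀ r, r ∉ X → ({ σ with ends := ends' } : State).free r ⊆ F' r := by
      rcases hc with rfl | ⟨i, hi, -, -, rfl⟩
      · exact ⟨F, hF, hσ⟩
      · refine ⟨_, hF.divide (a := .main i.castSucc) (b := .tail i) (Set.empty_subset _) ?_
          (Set.empty_disjoint _), fun r hr =>
            (free_close (EndBuffer.ofMain_ne_reserved _) r).trans
              (update_subset_update (update_subset_update hσ _ _) _ _ r hr)⟩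
        refine (EndBuffer.free_ofMain_subset (hM.dir _)).trans
          (subset_trans (fun p hp => ?_) (hσ _ (hXmain _)))
        exact ⟨fun i' hi' => by rwa [← Fin.castSucc_injective _ hi'], hp⟩
    refine ⟨j, F', hf, hM.height j, subset_trans (fun p hp => ?_) (hσ' _ (hXmain _)), hF',
      fun r hr => (free_setMain (σ := { σ with ends := ends' }) r).trans
        (update_subset_update hσ' _ _ r hr), rfl⟩
    exact ⟨fun i hi => hadm.isReserved i hi, hp⟩
  · rw [State.takeMain, hn] at he
    simp at he

theorem free_setVertical_subset {v : ℝ}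
    (h : ∀ r, r ≠ .init k → r ≠ .vert k → r ≠ .sub k → σ.free r ⊆ F r)
    (hV : V.shelf.free ⊆ F (.vert k)) (hs : V.subFree ⊆ F (.sub k)) (r : Region) :
    ({ σ with vertical := Function.update σ.vertical k (some V), vertWidth := v } : State).free r ⊆
      F r := by
  refine (free_setVertical r).trans ?_
  by_cases h1 : r = .sub k
  · subst h1; simpa using hs
  rw [Function.update_of_ne h1]
  by_cases h2 : r = .vert k
  · subst h2; simpa using hV
  rw [Function.update_of_ne h2]
  by_cases h3 : r = .init k
  · subst h3; simp
  rw [Function.update_of_ne h3]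
  exact h r h3 h2 h1

theorem openVertical {W v₃ a₂ pay : ℝ} (hM : MainLedger σ.main σ.ends W v₃ a₂ pay) (hx : 0 < x)
    (hxk : x ≤ classWidth k) (hk : classWidth k ≤ 1 / 4) (hF : Good O F)
    (hσ : ∀ r, r ≠ .init k → σ.free r ⊆ F r)
    (hA : σ.heightA = ∑ k ∈ Finset.Ico 4 N, if (σ.initial k).isSome then classWidth k else 0)
    (hfirst : k ≠ 3 → σ.vertical 3 = none → ∃ u, σ.buf 0 = ⟨1 / 4, 1 / 4, 1 / 4, 1 / 8, u, .right⟩)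
    (he : σ.openVertical k x = some (τ, p)) : Placeable O p x ∧ Layout N τ (O ∪ tile p x) := by
  obtain ⟨⟨σ₁, S⟩, htm, he⟩ := Option.map_eq_some_iff.1 he
  simp only [Prod.mk.injEq] at he
  obtain ⟨rfl, rfl⟩ := he
  obtain ⟨j, F', hf, hh, hS, hF', hσ₁, heq⟩ := takeMain (X := {.init k}) hM hk hF
    (fun r hr => ⟨k, hr⟩) hσ htm
  obtain ⟨hT1, hT2, hT3⟩ := Shelf.slice_measures (S := S) (w := classWidth k)
  have h1 := hF'.slice hS (by linarith) hf (.vert k)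
  obtain ⟨hp, h2⟩ := h1.place (a := .vert k) (S := S.slice (classWidth k)) (x := x)
    (by rw [Function.update_self]) hx (by unfold Shelf.Fits; rw [hT1, hT3]; linarith)
    (by rw [hT2]; exact hxk)
  refine ⟨hp, h2.mono (free_setVertical_subset (fun r h1 h2 h3 => ?_) ?_ ?_), ?_, fun h3 => ?_⟩
  · rw [Function.update_of_ne h2, Function.update_of_ne h2]
    exact hσ₁ r h1
  · rw [Function.update_self]
  · rintro q ⟨T, hT, -⟩
    cases hT
  · rw [heq]; exact hA
  · rw [heq] at h3 ⊢
    by_cases hk3 : k = 3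
    · subst hk3; simp at h3
    · refine hfirst hk3 ?_
      change Function.update σ.vertical k _ 3 = none at h3
      rwa [Function.update_of_ne (Ne.symm hk3)] at h3

theorem setVertical (h : Layout N σ O) {O' : Set (ℝ × ℝ)}
    (hτ : τ = { σ with ends := τ.ends, buf := τ.buf, activeBuf := τ.activeBuf })
    (hb : (∃ u, σ.buf 0 = ⟨1 / 4, 1 / 4, 1 / 4, 1 / 8, u, .right⟩) →
      ∃ u, τ.buf 0 = ⟨1 / 4, 1 / 4, 1 / 4, 1 / 8, u, .right⟩)
    (hF : Good O' F) (hσ : ∀ r, r ≠ .vert k → r ≠ .sub k → τ.free r ⊆ F r)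
    (hV : V.shelf.free ⊆ F (.vert k)) (hs : V.subFree ⊆ F (.sub k)) :
    Layout N { τ with vertical := Function.update τ.vertical k (some V) } O' := by
  refine ⟨hF.mono (free_setVertical_subset (fun r _ h2 h3 => hσ r h2 h3) hV hs), ?_, fun h3 => ?_⟩
  · rw [hτ]; exact h.heightA_eq
  · refine hb (h.first ?_)
    rw [hτ] at h3
    change Function.update σ.vertical k _ 3 = none at h3
    by_cases hk3 : k = 3
    · subst hk3; simp at h3
    · rwa [Function.update_of_ne (Ne.symm hk3)] at h3

/-- Packing into the current vertical shelf. -/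
theorem pack (h : Layout N σ O) (hx : 0 < x)
    (hτ : τ = { σ with ends := τ.ends, buf := τ.buf, activeBuf := τ.activeBuf })
    (hb : (∃ u, σ.buf 0 = ⟨1 / 4, 1 / 4, 1 / 4, 1 / 8, u, .right⟩) →
      ∃ u, τ.buf 0 = ⟨1 / 4, 1 / 4, 1 / 4, 1 / 8, u, .right⟩)
    (hF : Good O τ.free) {V₀ : Vertical} (hV₀ : τ.vertical k = some V₀) (hVs : V.shelf = V₀.shelf)
    (hsub : V.sub = V₀.sub ∨ V.sub = none) (hf : V.shelf.Fits x) (hh : x ≤ V.shelf.height) :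
    Placeable O (V.shelf.place x) x ∧ Layout N
      { τ with vertical := Function.update τ.vertical k (some { V with shelf := V.shelf.advance x }) }
      (O ∪ tile (V.shelf.place x) x) := by
  obtain ⟨h1, h2⟩ := hF.place (a := .vert k) (S := V.shelf)
    (fun q hq => ⟨V₀, hV₀, hVs ▸ hq⟩) hx hf hh
  refine ⟨h1, h.setVertical hτ hb h2 (fun r hv _ => ?_) ?_ ?_⟩
  · rw [Function.update_of_ne hv]
  · rw [Function.update_self]
  · rw [Function.update_of_ne (by simp)]
    rintro q ⟨T, hT, hq⟩
    rcases hsub with hs | hs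
    · exact ⟨V₀, T, hV₀, hs ▸ hT, hq⟩
    · change V.sub = _ at hT
      rw [hs] at hT
      cases hT

/-- The outcome of a buffer step. -/
structure BufferStep (σ τ : State) (w : ℝ) (R : Option Shelf) : Prop where
  eq : τ = { σ with ends := τ.ends, buf := τ.buf, activeBuf := τ.activeBuf }
  first : (∃ u, σ.buf 0 = ⟨1 / 4, 1 / 4, 1 / 4, 1 / 8, u, .right⟩) →
    ∃ u, τ.buf 0 = ⟨1 / 4, 1 / 4, 1 / 4, 1 / 8, u, .right⟩
  free : (R = none ∧ ∀ r, τ.free r ⊆ σ.free r) ∨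
    ∃ S a, R = some S ∧ (∀ k, a ≠ .vert k ∧ a ≠ .sub k) ∧ S.free ⊆ σ.free a ∧ S.Fits w ∧
      w ≤ S.height ∧ ∀ r, τ.free r ⊆ Function.update σ.free a (S.advance w).free r

section
variable {A : ℝ} {a v q s : ℕ → ℝ} {a₂ B : ℝ} {e t : Fin 3 → ℝ}

theorem takeEnd (h : Accounts N σ A a v q s a₂ B e t) (hk : 3 ≤ k) (hx : IsClass k x)
    {i : Fin 3} {S : Shelf} {n : ℕ} (hi : σ.ends i = .active S n) :
    BufferStep σ (σ.takeEnd i S n k x).1 (State.bufExtent k x) (σ.takeEnd i S n k x).2 := by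
  obtain ⟨hb1, hb2, -, -⟩ := bufExtent_bounds hk hx
  have hL := h.balance.endLedger i
  rw [hi] at hL
  obtain ⟨-, h2, -, h4, h5, h6, -⟩ := hL
  have hne : σ.ends i ≠ .reserved := by rw [hi]; simp
  unfold State.takeEnd
  by_cases hc : k = 3 ∧ S.height < x
  · rw [if_pos hc]
    refine ⟨rfl, id, .inl ⟨rfl, fun r => ?_⟩⟩
    refine (free_setEnd hne (by split_ifs <;> simp) r).trans ?_
    by_cases hr : r = .tail i
    · subst hr
      rw [Function.update_self]
      change _ ⊆ (σ.ends i).free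
      rw [hi]
      split_ifs <;> exact subset_rfl
    · rw [Function.update_of_ne hr]
  · rw [if_neg hc]
    refine ⟨rfl, id, .inr ⟨S, .tail i, rfl, by simp, ?_, ?_, ?_, fun r => ?_⟩⟩
    · change _ ⊆ (σ.ends i).free
      rw [hi]; exact subset_rfl
    · unfold Shelf.Fits; linarith
    · rcases hk.eq_or_lt with rfl | hk
      · rw [bufExtent_three]; by_contra hh; exact hc ⟨rfl, not_le.1 hh⟩
      · have := unitWidth_le_one hk
        rw [bufExtent_of_four_le hk]
        unfold unitWidth at this
        linarith
    · refine (free_setEnd hne (by split_ifs <;> simp) r).trans ?_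
      split_ifs <;> exact subset_rfl

theorem takeBuf (act j : Fin 4) (hf : (σ.buf j).Fits w) (hh : w ≤ (σ.buf j).height) :
    BufferStep σ (({ σ with activeBuf := act } : State).takeBuf j w).1 w
      (({ σ with activeBuf := act } : State).takeBuf j w).2 := by
  refine ⟨rfl, fun ⟨u, hu⟩ => ?_, .inr ⟨_, .buf j, rfl, by simp, subset_rfl, hf, hh,
    fun r => free_setBuf act r⟩⟩
  change ∃ u, Function.update σ.buf j _ 0 = _
  by_cases hj : 0 = j
  · subst hj
    rw [Function.update_self]
    change ∃ u', (σ.buf 0).advance w = _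
    rw [hu]
    exact ⟨u + w, rfl⟩
  · rw [Function.update_of_ne hj]; exact ⟨u, hu⟩

theorem takeAnyEnd (act : Fin 4) (hh : ∀ j, w ≤ (σ.buf j).height) :
    BufferStep σ (({ σ with activeBuf := act } : State).takeAnyEnd w).1 w
      (({ σ with activeBuf := act } : State).takeAnyEnd w).2 := by
  have hnone : BufferStep σ { σ with activeBuf := act } w none :=
    ⟨rfl, id, .inl ⟨rfl, fun r => subset_rfl⟩⟩
  unfold State.takeAnyEnd
  rcases hfind : (List.finRange 4).find? fun j => decide ((σ.buf j).Fits w) with _ | j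
  · dsimp only
    rcases hfind' : (List.finRange 3).find? fun i => State.endHasRoom w (σ.ends i) with _ | i
    · exact hnone
    · dsimp only
      have hroom := List.find?_some hfind'
      rcases hi : σ.ends i with _ | ⟨S, n⟩ | S
      · exact hnone
      · exact hnone
      · rw [hi] at hroom
        simp only [State.endHasRoom, decide_eq_true_eq] at hroom
        refine ⟨rfl, id, .inr ⟨S, .tail i, rfl, by simp, ?_, hroom.2, hroom.1, fun r =>
          (free_setEnd (σ := { σ with activeBuf := act }) (by rw [hi]; simp) (by simp) r).trans
            subset_rfl⟩⟩
        change _ ⊆ (σ.ends i).free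
        rw [hi]; exact subset_rfl
  · dsimp only
    have hfit := List.find?_some hfind
    simp only [decide_eq_true_eq] at hfit
    exact takeBuf act j hfit (hh j)

theorem takeBuffer (h : Accounts N σ A a v q s a₂ B e t) (hk : 3 ≤ k) (hx : IsClass k x) :
    BufferStep σ (σ.takeBuffer k x).1 (State.bufExtent k x) (σ.takeBuffer k x).2 := by
  obtain ⟨hb1, hb2, -, -⟩ := bufExtent_bounds hk hx
  have hh : ∀ j, State.bufExtent k x ≤ (σ.buf j).height := fun j => by
    linarith [h.buffer.height j]
  rcases Accounts.takeBuffer_cases σ k x with ⟨i, S, n, hi, htb⟩ | ⟨-, htb⟩ <;> rw [htb]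
  · exact takeEnd h hk hx hi
  · unfold State.takeB
    dsimp only
    by_cases hf : (σ.buf σ.activeBuf).Fits (State.bufExtent k x)
    · rw [if_pos hf]
      exact takeBuf (σ := σ) σ.activeBuf σ.activeBuf hf (hh _)
    · rw [if_neg hf]
      by_cases hf' : (σ.buf (![1, 2, 3, 3] σ.activeBuf)).Fits (State.bufExtent k x)
      · rw [if_pos hf']
        exact takeBuf _ _ hf' (hh _)
      · rw [if_neg hf']
        by_cases h3 : k = 3
        · rw [if_pos h3]
          exact ⟨rfl, id, .inl ⟨rfl, fun r => subset_rfl⟩⟩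
        · rw [if_neg h3]
          exact takeAnyEnd _ hh

end

end Layout

namespace Layout
variable {N : ℕ} {σ τ : State} {O : Set (ℝ × ℝ)} {k : ℕ} {x w : ℝ} {p : ℝ × ℝ} {S : Shelf}
  {V : Vertical} {A : ℝ} {a v q s : ℕ → ℝ} {a₂ B : ℝ} {e t : Fin 3 → ℝ}

theorem packInto (h : Layout N σ O) (ha : Accounts N σ A a v q s a₂ B e t) (hk : 3 ≤ k)
    (hx : IsClass k x) {V₀ : Vertical} (hV₀ : σ.vertical k = some V₀) (hVs : V.shelf = V₀.shelf)
    (hsub : V.sub = V₀.sub ∨ V.sub = none) (hh : V.shelf.height = classWidth k)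
    (he : σ.packInto k x V = some (τ, p)) : Placeable O p x ∧ Layout N τ (O ∪ tile p x) := by
  have hxk : x ≤ classWidth k := by have := hx.2; unfold unitWidth at this; linarith
  have hk4 : classWidth k ≤ 1 / 4 := by
    have := unitWidth_le_two hk; unfold unitWidth at this; linarith
  have hxp : 0 < x := by linarith [hx.pos]
  unfold State.packInto at he
  by_cases hf : V.shelf.Fits x
  · rw [if_pos hf] at he
    simp only [Option.some.injEq, Prod.mk.injEq] at he
    obtain ⟨rfl, rfl⟩ := he
    exact h.pack (τ := σ) hxp rfl id h.good hV₀ hVs hsub hf (hh ▸ hxk)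
  · rw [if_neg hf] at he
    exact openVertical ha.main hxp hxk hk4 h.good (fun r _ => subset_rfl) h.heightA_eq
      (fun _ => h.first) he

theorem packBuffer (h : Layout N σ O) (ha : Accounts N σ A a v q s a₂ B e t) (hk : 3 ≤ k)
    (hkN : k < N) (hx : IsClass k x) (hV : σ.vertical k = some V) (hst : V.started = false)
    (he : σ.packBuffer k x V = some (τ, p)) : Placeable O p x ∧ Layout N τ (O ∪ tile p x) := by
  have hVL := ha.class_of_vertical hk hkN hV
  obtain ⟨hsub, hfit⟩ := hVL.fits hx hst
  have hxk : x ≤ classWidth k := by have := hx.2; unfold unitWidth at this; linarith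
  have hxp : 0 < x := by linarith [hx.pos]
  have hfits : V.shelf.Fits x := by unfold Shelf.Fits; rw [hVL.1]; exact hfit
  have hxh : x ≤ V.shelf.height := by rw [hVL.2.1]; exact hxk
  unfold State.packBuffer at he
  by_cases hskip : σ.alpha ≤ σ.beta ∨ σ.alpha + 1 / 16 ≤ σ.beta + x
  · rw [if_pos hskip] at he
    exact h.packInto ha hk hx hV (V := { V with started := true }) rfl (.inl rfl) hVL.2.1 he
  · rw [if_neg hskip] at he
    have hstep := takeBuffer ha hk hx
    rcases htb : σ.takeBuffer k x with ⟨σ₁, R⟩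
    rw [htb] at he hstep
    obtain ⟨heq, hfirst, ⟨rfl, hfree⟩ | ⟨S, r, rfl, hr, hS, hSf, hSh, hfree⟩⟩ := hstep <;>
      dsimp only at he heq hfirst hfree
    · unfold State.packInto at he
      rw [if_pos hfits] at he
      simp only [Option.some.injEq, Prod.mk.injEq] at he
      obtain ⟨rfl, rfl⟩ := he
      exact h.pack (τ := σ₁) (V := { V with started := true }) (V₀ := V) hxp heq hfirst
        (h.good.mono hfree) (by rw [heq]; exact hV) rfl (.inl rfl) hfits hxh
    · by_cases hk3 : k = 3
      · rw [if_pos hk3] at he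
        simp only [Option.some.injEq, Prod.mk.injEq] at he
        obtain ⟨rfl, rfl⟩ := he
        subst hk3
        rw [bufExtent_three] at hSf hSh hfree
        obtain ⟨h1, h2⟩ := h.good.place hS hxp hSf hSh
        refine ⟨h1, h.setVertical heq hfirst h2 (fun r _ _ => hfree r) ?_ ?_⟩
        · rw [Function.update_of_ne (hr 3).1.symm]
          exact fun q hq => ⟨V, hV, hq⟩
        · rintro q ⟨T, hT, -⟩
          change V.sub = _ at hT
          rw [hsub] at hT
          cases hT
      · rw [if_neg hk3] at he
        simp only [Option.some.injEq, Prod.mk.injEq] at he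
        obtain ⟨rfl, rfl⟩ := he
        have hk4 : 4 ≤ k := by omega
        rw [bufExtent_of_four_le hk4] at hSf hSh hfree
        obtain ⟨hT1, hT2, hT3⟩ := Shelf.slice_measures (S := S) (w := classWidth k)
        have h0 := h.good.slice hS (by linarith) hSf (.sub k)
        obtain ⟨h1, h2⟩ := h0.place (a := .sub k) (S := S.slice (classWidth k)) (x := x)
          (by rw [Function.update_self]) hxp (by unfold Shelf.Fits; rw [hT1, hT3]; linarith)
          (by rw [hT2]; exact hxk)
        refine ⟨h1, h.setVertical heq hfirst h2 (fun r _ hs => ?_) ?_ ?_⟩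
        · rw [Function.update_of_ne hs, Function.update_of_ne hs]
          exact hfree r
        · rw [Function.update_of_ne (by simp), Function.update_of_ne (by simp),
            Function.update_of_ne (hr k).1.symm]
          exact fun q hq => ⟨V, hV, hq⟩
        · rw [Function.update_self]
          rintro q ⟨T, hT, hq⟩
          obtain rfl := Option.some.inj hT
          exact hq

theorem packVertical (h : Layout N σ O) (ha : Accounts N σ A a v q s a₂ B e t) (hk : 3 ≤ k)
    (hkN : k < N) (hx : IsClass k x) (hV : σ.vertical k = some V)
    (he : σ.packVertical k x V = some (τ, p)) : Placeable O p x ∧ Layout N τ (O ∪ tile p x) := by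
  have hVL := ha.class_of_vertical hk hkN hV
  have hxk : x ≤ classWidth k := by have := hx.2; unfold unitWidth at this; linarith
  have hxp : 0 < x := by linarith [hx.pos]
  unfold State.packVertical at he
  rcases hsub : V.sub with _ | T <;> rw [hsub] at he <;> dsimp only at he
  · split_ifs at he with hb
    · exact h.packBuffer ha hk hkN hx hV hb.1 he
    · exact h.packInto ha hk hx hV rfl (.inl rfl) hVL.2.1 he
  · have hTh : T.height = classWidth k := by
      have hst := hVL.started_of_sub hsub
      obtain ⟨S, st, sub⟩ := V
      subst hst hsub
      exact hVL.2.2.2.2.2.2.1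
    by_cases hf : T.Fits x
    · rw [if_pos hf] at he
      simp only [Option.some.injEq, Prod.mk.injEq] at he
      obtain ⟨rfl, rfl⟩ := he
      obtain ⟨h1, h2⟩ := h.good.place (a := .sub k) (S := T) (fun q hq => ⟨V, T, hV, hsub, hq⟩) hxp
        hf (hTh ▸ hxk)
      refine ⟨h1, h.setVertical (τ := σ) rfl id h2 (fun r _ hr => ?_) ?_ ?_⟩
      · rw [Function.update_of_ne hr]
      · rw [Function.update_of_ne (by simp)]
        exact fun q hq => ⟨V, hV, hq⟩
      · rw [Function.update_self]
        rintro q ⟨T', hT, hq⟩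
        obtain rfl := Option.some.inj hT
        exact hq
    · rw [if_neg hf] at he
      exact h.packInto ha hk hx hV (V := { V with sub := none }) rfl (.inr rfl) hVL.2.1 he

/-- The bound 1/8 is the height of A, so one initial shelf for every class k ≥ 4 can be stacked
there. -/
theorem sum_classWidth_le (N : ℕ) : ∑ k ∈ Finset.Ico 4 N, classWidth k ≤ 1 / 8 := by
  have key : ∀ n : ℕ, ∑ k ∈ Finset.Ico 4 (4 + n), classWidth k ≤ 1 / 8 - 2 * classWidth (4 + n) := by
    intro n
    induction n with
    | zero => norm_num [classWidth]
    | succ n ih =>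
      rw [← add_assoc, Finset.sum_Ico_succ_top (by omega)]
      have : classWidth (4 + n) = 2 * classWidth (4 + n + 1) := by
        unfold classWidth; rw [pow_succ]; ring
      linarith
  by_cases hN : 4 ≤ N
  · obtain ⟨n, rfl⟩ := Nat.exists_eq_add_of_le hN
    have : 0 ≤ classWidth (4 + n) := by unfold classWidth; positivity
    linarith [key n]
  · rw [Finset.Ico_eq_empty_of_le (by omega)]; norm_num

theorem free_setInitial {y : ℝ} (r : Region) :
    ({ σ with initial := Function.update σ.initial k (some S), heightA := y } : State).free r ⊆
      Function.update (Function.update σ.free .stack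
        (Set.Ico 0 (1 / 4) ×ˢ Set.Ico (3 / 8 + y) (1 / 2))) (.init k) S.free r := by
  rcases r with j' | i' | j' | _ | k' | k' | k' <;>
    (try simp only [ne_eq, reduceCtorEq, not_false_eq_true, Function.update_of_ne,
      Function.update_self]) <;>
    try exact subset_rfl
  by_cases hk : k' = k
  · subst hk
    rw [Function.update_self]
    rintro q ⟨-, S', hS, hq⟩
    change Function.update σ.initial k' (some S) k' = _ at hS
    rw [Function.update_self] at hS
    obtain rfl := Option.some.inj hS
    exact hq
  · rw [Function.update_of_ne (by simpa using hk), Function.update_of_ne (by simp)]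
    rintro q ⟨h1, S', hS, hq⟩
    change Function.update σ.initial k (some S) k' = _ at hS
    rw [Function.update_of_ne hk] at hS
    exact ⟨h1, S', hS, hq⟩

theorem packInitial (h : Layout N σ O) (ha : Accounts N σ A a v q s a₂ B e t) (hk : 3 ≤ k)
    (hkN : k < N) (hx : IsClass k x) (hV : σ.vertical k = none)
    (he : σ.packInitial k x = some (τ, p)) : Placeable O p x ∧ Layout N τ (O ∪ tile p x) := by
  have hxk : x ≤ classWidth k := by have := hx.2; unfold unitWidth at this; linarith
  have hk4 : classWidth k ≤ 1 / 4 := by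
    have := unitWidth_le_two hk; unfold unitWidth at this; linarith
  have hxp : 0 < x := by linarith [hx.pos]
  have hcl := ha.classes k hk hkN
  rw [hV] at hcl
  obtain ⟨u, hu⟩ := ha.initial
  unfold State.packInitial at he
  rcases hIk : σ.initial k with _ | S
  · have hk3 : k ≠ 3 := by rintro rfl; rw [hu] at hIk; cases hIk
    rw [hIk] at he
    set S : Shelf := ⟨0, 3 / 8 + σ.heightA, 1 / 4, classWidth k, 0, .right⟩ with hS
    have hf : S.Fits x := by unfold Shelf.Fits; rw [hS]; simp only; linarith
    simp only [Option.getD_none, Option.isNone_none, if_true] at he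
    rw [if_pos hf] at he
    simp only [Option.some.injEq, Prod.mk.injEq] at he
    obtain ⟨rfl, rfl⟩ := he
    have hmem : k ∈ Finset.Ico 4 N := Finset.mem_Ico.2 ⟨by omega, hkN⟩
    have hsum : σ.heightA + classWidth k = ∑ j ∈ Finset.Ico 4 N,
        if (Function.update σ.initial k (some (S.advance x)) j).isSome then classWidth j else 0 := by
      have hupd : (fun j => if (Function.update σ.initial k (some (S.advance x)) j).isSome
          then classWidth j else 0) = Function.update
          (fun j => if (σ.initial j).isSome then classWidth j else 0) k (classWidth k) := by
        funext j
        by_cases hj : j = k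
        · subst hj; simp
        · simp [hj]
      rw [hupd, Finset.sum_update_of_mem hmem, h.heightA_eq,
        Finset.sum_eq_add_sum_sdiff_singleton_of_mem hmem, hIk]
      simp [add_comm]
    have hle : σ.heightA + classWidth k ≤ 1 / 8 := by
      rw [hsum]
      refine (Finset.sum_le_sum fun j _ => ?_).trans (sum_classWidth_le N)
      split_ifs
      · exact le_rfl
      · unfold classWidth; positivity
    have hw : 0 < classWidth k := by unfold classWidth; positivity
    have h0 := h.good.divide (a := .stack) (b := .init k)
      (X := Set.Ico 0 (1 / 4) ×ˢ Set.Ico (3 / 8 + (σ.heightA + classWidth k)) (1 / 2)) (Y := S.free)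
      (by
        rintro ⟨q₁, q₂⟩
        simp only [State.free, Set.mem_prod, Set.mem_Ico]
        rintro ⟨⟨h1, h2⟩, h3, h4⟩
        exact ⟨⟨h1, h2⟩, by linarith, h4⟩) (by
        rintro ⟨q₁, q₂⟩
        simp only [State.free, Shelf.free, hS, Set.mem_prod, Set.mem_Ico]
        rintro ⟨⟨h1, h2⟩, h3, h4⟩
        exact ⟨⟨by linarith, by linarith⟩, by linarith, by linarith⟩) (by
        rw [Set.disjoint_left]
        rintro ⟨q₁, q₂⟩
        simp only [Shelf.free, hS, Set.mem_prod, Set.mem_Ico]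
        rintro ⟨-, h1, -⟩ ⟨-, -, h2⟩
        linarith)
    obtain ⟨h1, h2⟩ := h0.place (a := .init k) (S := S) (by rw [Function.update_self]) hxp hf hxk
    refine ⟨h1, h2.mono fun r => (free_setInitial r).trans ?_, hsum, h.first⟩
    by_cases hr : r = .init k
    · subst hr; simp
    · simp [hr]
  · obtain ⟨hS1, hS2, -⟩ := hcl.2.2.2.2 S hIk
    rw [hIk] at he
    simp only [Option.getD_some, Option.isNone_some] at he
    by_cases hf : S.Fits x
    · rw [if_pos hf] at he
      simp only [Option.some.injEq, Prod.mk.injEq] at he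
      obtain ⟨rfl, rfl⟩ := he
      obtain ⟨h1, h2⟩ := h.good.place (a := .init k) (S := S) (fun q hq => ⟨hV, S, hIk, hq⟩) hxp
        hf (hS2 ▸ hxk)
      refine ⟨h1, h2.mono fun r => (free_setInitial r).trans ?_, ?_, h.first⟩
      · by_cases hr : r = .init k
        · subst hr; simp
        · rw [Function.update_of_ne hr, Function.update_of_ne hr]
          by_cases hr' : r = .stack
          · subst hr'; simp [State.free]
          · rw [Function.update_of_ne hr']
      · simp only [Bool.false_eq_true, if_false]
        rw [h.heightA_eq]
        refine Finset.sum_congr rfl fun j _ => ?_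
        by_cases hj : j = k
        · subst hj; simp [hIk]
        · simp [hj]
    · rw [if_neg hf] at he
      by_cases hj : k = 3 ∧ (σ.buf 0).used = 0
      · rw [if_pos hj] at he
        obtain ⟨rfl, hj⟩ := hj
        obtain ⟨u', hu'⟩ := h.first hV
        rw [hu] at hIk
        obtain rfl := Option.some.inj hIk
        have hu0 : u' = 0 := by rw [hu'] at hj; exact hj
        -- The new B_1 consists of the rest of the initial H_3-shelf, left of 1/4, and the untouched
        -- old B_1.
        have hmerge := h.good.merge (a := .init 3) (b := .buf 0) (by simp)
          (Y := Shelf.free ⟨u, 1 / 4, 1 / 2 - u, 1 / 8, 0, .right⟩) (by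
          rintro ⟨q₁, q₂⟩ hq
          simp only [Shelf.free, Set.mem_prod, Set.mem_Ico] at hq
          obtain ⟨⟨h1, h2⟩, h3, h4⟩ := hq
          by_cases hq : q₁ < 1 / 4
          · left
            refine ⟨hV, _, hu, ?_⟩
            simp only [Shelf.free, Set.mem_prod, Set.mem_Ico]
            refine ⟨⟨?_, ?_⟩, ?_, ?_⟩ <;> linarith
          · right
            simp only [State.free, hu', hu0, Shelf.free, Set.mem_prod, Set.mem_Ico]
            refine ⟨⟨?_, ?_⟩, ?_, ?_⟩ <;> linarith)
        refine openVertical (σ := { σ with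
          buf := Function.update σ.buf 0 ⟨u, 1 / 4, 1 / 2 - u, 1 / 8, 0, .right⟩ })
          ha.main hxp hxk hk4 hmerge (fun r hr => ?_) h.heightA_eq (fun hc => absurd rfl hc) he
        refine (free_setBuf σ.activeBuf r).trans ?_
        by_cases hr' : r = .buf 0
        · subst hr'; simp
        · rw [Function.update_of_ne hr', Function.update_of_ne hr', Function.update_of_ne hr]
      · rw [if_neg hj] at he
        exact openVertical ha.main hxp hxk hk4 h.good (fun r _ => subset_rfl) h.heightA_eq
          (fun _ => h.first) he

theorem packTwo (h : Layout N σ O) (ha : Accounts N σ A a v q s a₂ B e t) (hx : IsClass 2 x)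
    (he : (σ.takeMain x).map (fun r => (r.1, r.2.place x)) = some (τ, p)) :
    Placeable O p x ∧ Layout N τ (O ∪ tile p x) := by
  have hx4 : x ≤ 1 / 4 := by have := hx.2; rw [unitWidth_two] at this; linarith
  obtain ⟨⟨σ₁, S⟩, htm, he⟩ := Option.map_eq_some_iff.1 he
  simp only [Prod.mk.injEq] at he
  obtain ⟨rfl, rfl⟩ := he
  obtain ⟨j, F', hf, hh, hS, hF', hσ₁, heq⟩ := takeMain (X := ∅) ha.main hx4 h.good
    (fun r hr => absurd hr (Set.notMem_empty r)) (fun r _ => subset_rfl) htm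
  obtain ⟨h1, h2⟩ := hF'.place hS (by linarith [hx.pos]) hf (hh ▸ hx4)
  refine ⟨h1, h2.mono fun r => hσ₁ r (Set.notMem_empty r), ?_, ?_⟩ <;> rw [heq]
  · exact h.heightA_eq
  · exact h.first

/-- Packing a small square preserves the layout. -/
theorem step (h : Layout N σ O) (ha : Accounts N σ A a v q s a₂ B e t) (h0 : 0 < x)
    (h1 : x ≤ 1 / 4) (hxN : heightClass x < N) (he : σ.step x = some (τ, p)) :
    Placeable O p x ∧ Layout N τ (O ∪ tile p x) := by
  have hx := Accounts.isClass_heightClass h0 (by linarith)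
  unfold State.step at he
  generalize heightClass x = k at *
  dsimp only at he
  by_cases hk : k < 2
  · rw [if_pos hk] at he; cases he
  rw [if_neg hk] at he
  by_cases hk2 : k = 2
  · rw [if_pos hk2] at he
    subst hk2
    exact h.packTwo ha hx he
  · rw [if_neg hk2] at he
    rcases hV : σ.vertical k with _ | V <;> rw [hV] at he
    · exact h.packInitial ha (by omega) hxN hx hV he
    · exact h.packVertical ha (by omega) hxN hx hV he

/-- The region of the subdivision of the container that contains a point. -/
noncomputable def regionOf (q : ℝ × ℝ) : Region :=
  if q.2 < 1 / 4 then .main 0 else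
    if q.2 < 1 / 2 then
      if 1 / 2 ≤ q.1 then .main 1 else
        if q.2 < 3 / 8 then if q.1 < 1 / 4 then .init 3 else .buf 0
        else if q.1 < 1 / 4 then .stack else .buf 1
    else if 7 / 8 ≤ q.1 then .buf 2 else
      if 3 / 4 ≤ q.2 then .main 3 else if q.1 < 1 / 8 then .buf 3 else .main 2

/-- Since the region is recovered from the point, disjointness of the initial regions follows
without comparing them in pairs. -/
theorem mem_free_init {r : Region} {q : ℝ × ℝ} (h : q ∈ State.init.free r) :
    regionOf q = r ∧ (0 ≤ q.1 ∧ q.1 < 1) ∧ 0 ≤ q.2 ∧ q.2 < 1 := by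
  obtain ⟨q₁, q₂⟩ := q
  unfold regionOf
  rcases r with j | i | j | _ | k | k | k
  · replace h := h.2
    fin_cases j <;> simp [State.init, Shelf.free] at h <;> obtain ⟨⟨h1, h2⟩, h3, h4⟩ := h <;>
      refine ⟨?_, ⟨by linarith, by linarith⟩, by linarith, by linarith⟩ <;> dsimp only <;>
      split_ifs <;> first | rfl | (exfalso; linarith)
  · exact absurd h (Set.notMem_empty _)
  · change _ ∈ (State.init.buf j).free at h
    fin_cases j <;> simp [State.init, Shelf.free] at h <;> obtain ⟨⟨h1, h2⟩, h3, h4⟩ := h <;>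
      refine ⟨?_, ⟨by linarith, by linarith⟩, by linarith, by linarith⟩ <;> dsimp only <;>
      split_ifs <;> first | rfl | (exfalso; linarith)
  · simp [State.init, State.free] at h
    obtain ⟨⟨h1, h2⟩, h3, h4⟩ := h
    refine ⟨?_, ⟨by linarith, by linarith⟩, by linarith, by linarith⟩
    dsimp only
    split_ifs <;> first | rfl | (exfalso; linarith)
  · obtain ⟨-, S, hS, h⟩ := h
    simp only [State.init] at hS
    split_ifs at hS with hk
    obtain rfl := Option.some.inj hS
    subst hk
    simp [Shelf.free] at h
    obtain ⟨⟨h1, h2⟩, h3, h4⟩ := h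
    refine ⟨?_, ⟨by linarith, by linarith⟩, by linarith, by linarith⟩
    dsimp only
    split_ifs <;> first | rfl | (exfalso; linarith)
  · obtain ⟨V, hV, -⟩ := h; cases hV
  · obtain ⟨V, T, hV, -⟩ := h; cases hV

theorem init (N : ℕ) : Layout N State.init ∅ := by
  refine ⟨⟨fun r => Set.empty_disjoint _, fun r r' hr => ?_, fun r q hq => ?_⟩, ?_,
    fun _ => ⟨0, rfl⟩⟩
  · rw [Set.disjoint_left]
    exact fun q hq hq' => hr ((mem_free_init hq).1.symm.trans (mem_free_init hq').1)
  · obtain ⟨-, ⟨h1, h2⟩, h3, h4⟩ := mem_free_init hq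
    refine ⟨⟨h1, ?_⟩, h3, ?_⟩ <;> norm_num <;> linarith
  · symm
    refine Finset.sum_eq_zero fun k hk => ?_
    have := (Finset.mem_Ico.1 hk).1
    have hk : State.init.initial k = none := if_neg (by omega)
    rw [hk]
    rfl

end Layout

/-- The subroutine does not fail and packs the squares outside of the occupied set. -/
theorem exists_run {N : ℕ} (hN : 5 ≤ N) (xs : List ℝ)
    (hxs : ∀ x ∈ xs, 0 < x ∧ x ≤ 1 / 4 ∧ heightClass x < N) {σ : State} {O : Set (ℝ × ℝ)}
    {A : ℝ} {a v q s : ℕ → ℝ} {a₂ B : ℝ} {e t : Fin 3 → ℝ}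
    (ha : Accounts N σ A a v q s a₂ B e t) (h : Layout N σ O)
    (hA : A + 256 * (xs.map fun x => x ^ 2).sum ≤ 88) :
    ∃ ps, σ.run xs = some ps ∧ ps.length = xs.length ∧
      (∀ r ∈ ps.zip xs, Placeable O r.1 r.2) ∧
      (ps.zip xs).Pairwise fun r r' => Disjoint (tile r.1 r.2) (tile r'.1 r'.2) := by
  induction xs generalizing σ O A a v q s a₂ B e t with
  | nil => exact ⟨[], rfl, rfl, by simp, by simp⟩
  | cons x xs ih =>
    obtain ⟨h0, h1, hxN⟩ := hxs x (by simp)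
    have hnn : 0 ≤ (xs.map fun x => x ^ 2).sum := List.sum_nonneg fun y hy => by
      obtain ⟨z, -, rfl⟩ := List.mem_map.1 hy
      positivity
    rw [List.map_cons, List.sum_cons] at hA
    obtain ⟨τ, p, a', v', q', s', a₂', B', e', t', hstep, ha'⟩ :=
      ha.step hN h0 h1 hxN (by linarith)
    obtain ⟨hp, h'⟩ := h.step ha h0 h1 hxN hstep
    obtain ⟨ps, hrun, hlen, hps, hpw⟩ :=
      ih (fun y hy => hxs y (by simp [hy])) ha' h' (by linarith)
    refine ⟨p :: ps, ?_, by simp [hlen], ?_, ?_⟩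
    · rw [State.run, hstep]
      dsimp only
      rw [hrun]
      rfl
    · intro r hr
      rw [List.zip_cons_cons, List.mem_cons] at hr
      rcases hr with rfl | hr
      · exact hp
      · exact ⟨(hps r hr).1.mono_left Set.subset_union_left, (hps r hr).2⟩
    · rw [List.zip_cons_cons, List.pairwise_cons]
      exact ⟨fun r hr => (hps r hr).1.mono_left Set.subset_union_right, hpw⟩

end OnlinePacking

theorem mainTheorem2 (xs : List ℝ) (hsmall : ∀ x ∈ xs, 0 < x ∧ x ≤ 1 / 4)
    (harea : (xs.map fun x => x ^ 2).sum ≤ 11 / 32) :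
    ∃ ps, OnlinePacking.packSmall xs = some ps ∧ OnlinePacking.IsPacking xs ps := by
  obtain ⟨N, hN⟩ : ∃ N, ∀ x ∈ xs, OnlinePacking.heightClass x < N :=
    ⟨(xs.map OnlinePacking.heightClass).sum + 1, fun x hx =>
      Nat.lt_succ_of_le (List.single_le_sum (by simp) _ (List.mem_map_of_mem hx))⟩
  -- The number of classes is bounded for the given sequence; adding 5 ensures that H_3 and H_4 are
  -- among them. The area bound becomes 256·11/32 = 88.
  obtain ⟨ps, hrun, hlen, hps, hpw⟩ := OnlinePacking.exists_run (N := N + 5) (by omega) xs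
    (fun x hx => ⟨(hsmall x hx).1, (hsmall x hx).2, (hN x hx).trans_le (by omega)⟩)
    (OnlinePacking.Accounts.init _) (OnlinePacking.Layout.init _) (by linarith)
  exact ⟨ps, hrun, hlen, fun r hr => (hps r hr).2, hpw.imp fun h =>
    h.mono (OnlinePacking.interior_square_subset _ _) (OnlinePacking.interior_square_subset _ _)⟩
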